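/- **Notation.** Let $\mu=(\mu_1\ge\dots\ge\mu_m)$ and $\nu=(\nu_1\ge\dots\ge\nu_n)$ be partitions of the same integer $d$, and let $r,s\ge 0$ be integers. The disconnected double Hurwitz number with $s$ completed $(r+1)$-cycles is $$h_{\mu,\nu}^{s}=\frac{1}{\prod_i\mu_i\prod_j\nu_j}\sum_{|\lambda|=d}\chi^\lambda_\mu\Big(\frac{p_{r+1}(\lambda)}{(r+1)!}\Big)^s\chi^\lambda_\nu,\qquad p_k(\lambda)=\sum_{i\ge1}\Big(\big(\lambda_i-i+\tfrac12\big)^k-\big(-i+\tfrac12\big)^k\Big),$$ where $\chi^\lambda_\mu$ is the value of the character of the irreducible representation of $S_d$ given by $\lambda$ on the conjugacy class of cycle type $\mu$. Put $\zeta(z)=e^{z/2}-e^{-z/2}$. For $I,M\subset[m]$, $J,N\subset[n]$, $K,R\subset[s]$ write $\mu_I=\sum_{i\in I}\mu_i$, $\nu_J=\sum_{j\in J}\nu_j$, $z_K=\sum_{k\in K}z_k$, and $$\zeta\begin{pmatrix}I&J&K\\M&N&R\end{pmatrix}=\zeta\left(\det\begin{pmatrix}\mu_I-\nu_J&z_K\\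 \mu_M-\nu_N&z_R\end{pmatrix}\right).$$ **Commutation patterns.** Let $\mathcal E(I,J,K)$ be a symbol of energy $\mu_I-\nu_J$. Start with the word $$\prod_{i=1}^m\mathcal E(\{i\},\emptyset,\emptyset)\prod_{k=1}^s\mathcal E(\emptyset,\emptyset,\{k\})\prod_{j=1}^n\mathcal E(\emptyset,\{j\},\emptyset).$$ As long as not all symbols of the word have zero energy, take the leftmost symbol $Y=\mathcal E(M,N,R)$ of negative energy. If it has no left neighbour, the run is discarded. Otherwise let $X=\mathcal E(I,J,K)$ be its left neighbour and replace $XY$ either by $YX$, or by the single symbol $\mathcal E(I\cup M,J\cup N,K\cup R)$; in the second case one says that the commutator $[X,Y]$ is computed. A run that ends with a word of symbols of zero energy, $\prod_{t\in T}\mathcal E(I_t,J_t,S_t)$, is described by the sequence $P$ of its commutators $[\mathcal E(P^l_I,P^l_J,P^l_K),\mathcal E(P^l_M,P^l_N,P^l_R)]$, $l\in L(P)$, in the order in which they are computed; write $T(P)=T$. Its contribution is $$\prod_{t\in T(P)}\frac1{\zeta(z_{S_t})}\ \prod_{l\in L(P)}\zeta\begin{pmatrix}P^l_I&P^l_J&P^l_K\\P^l_M&P^l_N&P^l_R\end{pmatrix},$$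 with the following convention: if $P_K^l=P_R^l=\emptyset$ and the two energies are $a$ and $-a$, the $l$-th $\zeta$-factor is replaced by the number $a$, and if $S_t=\emptyset$ the factor $1/\zeta(z_{S_t})$ is replaced by $1$. The sequence $P$ is a *commutation pattern* if no symbol $\mathcal E(\emptyset,\emptyset,\{k\})$ is left in the final word and the contribution is not zero. Let $CP^s_{\mu,\nu}$ be the finite set of commutation patterns. **Theorem 4.6.** The sum $$\sum_{P\in CP^s_{\mu,\nu}}\ \prod_{t\in T(P)}\frac1{\zeta(z_{S_t})}\ \prod_{l\in L(P)}\zeta\begin{pmatrix}P^l_I&P^l_J&P^l_K\\P^l_M&P^l_N&P^l_R\end{pmatrix},$$ which is a priori an element of the field of fractions of $\mathbb Q[[z_1,\dots,z_s]]$, is a formal power series, and $$h^s_{\mu,\nu}=\frac{1}{\prod_{i=1}^m\mu_i\prod_{j=1}^n\nu_j}\,[z_1^{r+1}\cdots z_s^{r+1}]\sum_{P\in CP^s_{\mu,\nu}}\ \prod_{t\in T(P)}\frac1{\zeta(z_{S_t})}\ \prod_{l\in L(P)}\zeta\begin{pmatrix}P^l_I&P^l_J&P^l_K\\P^l_M&P^l_N&P^l_R\end{pmatrix}.$$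 -/

import Mathlib

open Finset

namespace HurwitzCC

noncomputable section

/-! ### Partitions -/

/-- The parts of a partition in weakly decreasing order. -/
def rows {d : ℕ} (lam : Nat.Partition d) : List ℕ := lam.parts.sort (· ≥ ·)

/-- The length `l(λ)` of a partition. -/
abbrev len {d : ℕ} (lam : Nat.Partition d) : ℕ := (rows lam).length

/-- The parts `λ_1 ≥ λ_2 ≥ ⋯` of a partition (indexed from `0`). -/
def part {d : ℕ} (lam : Nat.Partition d) (i : Fin (len lam)) : ℕ := (rows lam).get i

theorem sum_part {d : ℕ} (lam : Nat.Partition d) : ∑ i, part lam i = d := by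
  have h1 : ∑ i, part lam i = (rows lam).sum := by
    simp only [part, List.get_eq_getElem]
    exact Fin.sum_univ_getElem (rows lam)
  rw [h1, ← Multiset.sum_coe, rows, Multiset.sort_eq, lam.parts_sum]

/-! ### Irreducible characters of the symmetric group -/

/-- The boxes of the Young diagram of `λ`: the box `⟨i, j⟩` lies in row `i` and column `j`. -/
abbrev Box {d : ℕ} (lam : Nat.Partition d) : Type := (i : Fin (len lam)) × Fin (part lam i)

theorem card_box {d : ℕ} (lam : Nat.Partition d) : Fintype.card (Box lam) = d := by
  rw [Fintype.card_sigma]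
  simpa using sum_part lam

/-- A numbering of the boxes of the Young diagram of `λ` by `1, …, d`
(a Young tableau of shape `λ`; which one is chosen does not matter up to isomorphism). -/
def tableau {d : ℕ} (lam : Nat.Partition d) : Fin d ≃ Box lam :=
  (Fintype.equivFinOfCardEq (card_box lam)).symm

open Classical in
/-- The permutations that preserve every row of the tableau. -/
def rowGroup {d : ℕ} (lam : Nat.Partition d) : Finset (Equiv.Perm (Fin d)) :=
  {σ | ∀ x, (tableau lam (σ x)).1 = (tableau lam x).1}

open Classical in
/-- The permutations that preserve every column of the tableau. -/
def columnGroup {d : ℕ} (lam : Nat.Partition d) : Finset (Equiv.Perm (Fin d)) :=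
  {σ | ∀ x, ((tableau lam (σ x)).2 : ℕ) = ((tableau lam x).2 : ℕ)}

/-- The Young symmetrizer `c_λ = a_λ b_λ` in the group algebra `ℚ[S_d]`: `a_λ` is the sum over the
row group and `b_λ` is the signed sum over the column group. -/
def youngSymmetrizer {d : ℕ} (lam : Nat.Partition d) : MonoidAlgebra ℚ (Equiv.Perm (Fin d)) :=
  (∑ σ ∈ rowGroup lam, MonoidAlgebra.of ℚ _ σ) *
    ∑ σ ∈ columnGroup lam, ((Equiv.Perm.sign σ : ℤ) : ℚ) • MonoidAlgebra.of ℚ _ σ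

/-- The irreducible representation of `S_d` given by `λ` (the Specht module): the left ideal of
`ℚ[S_d]` generated by the Young symmetrizer. -/
abbrev spechtModule {d : ℕ} (lam : Nat.Partition d) :
    Submodule (MonoidAlgebra ℚ (Equiv.Perm (Fin d))) (MonoidAlgebra ℚ (Equiv.Perm (Fin d))) :=
  Submodule.span _ {youngSymmetrizer lam}

/-- The character of the irreducible representation given by `λ`: the trace of the action of a
permutation by left multiplication. -/
def spechtCharacter {d : ℕ} (lam : Nat.Partition d) (σ : Equiv.Perm (Fin d)) : ℚ :=
  LinearMap.trace ℚ (spechtModule lam)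
    (Algebra.lsmul ℚ ℚ (spechtModule lam) (MonoidAlgebra.of ℚ (Equiv.Perm (Fin d)) σ))

theorem exists_perm_of_partition {d : ℕ} (mu : Nat.Partition d) :
    ∃ σ : Equiv.Perm (Fin d), σ.partition.parts = mu.parts := by
  have hsplit := Multiset.filter_add_not (fun n => 2 ≤ n) mu.parts
  have hone : mu.parts.filter (fun n => ¬ 2 ≤ n)
      = Multiset.replicate (mu.parts.filter (fun n => ¬ 2 ≤ n)).card 1 := by
    refine Multiset.eq_replicate_card.2 fun b hb => ?_
    have h1 := Multiset.mem_filter.1 hb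
    have h2 := mu.parts_pos h1.1
    omega
  have hsum : (mu.parts.filter (fun n => 2 ≤ n)).sum
      + (mu.parts.filter (fun n => ¬ 2 ≤ n)).card = d := by
    have h3 := congrArg Multiset.sum hsplit
    rw [Multiset.sum_add, mu.parts_sum, hone, Multiset.sum_replicate] at h3
    simpa using h3
  obtain ⟨σ, hσ⟩ := (Equiv.Perm.exists_with_cycleType_iff (Fin d)
    (m := mu.parts.filter (fun n => 2 ≤ n))).2
      ⟨by rw [Fintype.card_fin]; omega, fun a ha => (Multiset.mem_filter.1 ha).2⟩
  refine ⟨σ, ?_⟩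
  rw [Equiv.Perm.parts_partition, hσ, ← Equiv.Perm.sum_cycleType, hσ, Fintype.card_fin]
  conv_rhs => rw [← hsplit, hone]
  congr 2
  omega

/-- `χ_μ^λ`: the character of the irreducible representation given by `λ`, evaluated on the
conjugacy class of the permutations of cycle type `μ`. -/
def chi {d : ℕ} (lam mu : Nat.Partition d) : ℚ :=
  spechtCharacter lam (exists_perm_of_partition mu).choose

/-- The value of `χ_μ^λ` does not depend on the chosen permutation of cycle type `μ`. -/
theorem chi_eq {d : ℕ} (lam mu : Nat.Partition d) (σ : Equiv.Perm (Fin d))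
    (hσ : σ.partition.parts = mu.parts) : chi lam mu = spechtCharacter lam σ := by
  have h : IsConj σ (exists_perm_of_partition mu).choose := by
    rw [Equiv.Perm.partition_eq_of_isConj]
    exact Nat.Partition.ext (hσ.trans (exists_perm_of_partition mu).choose_spec.symm)
  obtain ⟨g, hg⟩ := isConj_iff.1 h
  have h1 : MonoidAlgebra.of ℚ (Equiv.Perm (Fin d)) g⁻¹ *
      (MonoidAlgebra.of ℚ (Equiv.Perm (Fin d)) g * MonoidAlgebra.of ℚ (Equiv.Perm (Fin d)) σ) =
      MonoidAlgebra.of ℚ (Equiv.Perm (Fin d)) σ := by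
    rw [← map_mul, ← map_mul, inv_mul_cancel_left]
  have h2 := LinearMap.trace_mul_comm ℚ
    (Algebra.lsmul ℚ ℚ (spechtModule lam) (MonoidAlgebra.of ℚ (Equiv.Perm (Fin d)) g *
      MonoidAlgebra.of ℚ (Equiv.Perm (Fin d)) σ))
    (Algebra.lsmul ℚ ℚ (spechtModule lam) (MonoidAlgebra.of ℚ (Equiv.Perm (Fin d)) g⁻¹))
  rw [← map_mul (Algebra.lsmul ℚ ℚ (spechtModule lam)),
    ← map_mul (Algebra.lsmul ℚ ℚ (spechtModule lam)), h1,
    ← map_mul (MonoidAlgebra.of ℚ (Equiv.Perm (Fin d))),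
    ← map_mul (MonoidAlgebra.of ℚ (Equiv.Perm (Fin d))), hg] at h2
  exact h2

/-! ### Hurwitz numbers with completed cycles -/

/-- The shifted symmetric power sum
`p_k(λ) = ∑_{i ≥ 1} ((λ_i - i + 1/2)^k - (-i + 1/2)^k)`; the terms with `λ_i = 0` vanish. -/
def shiftedPowerSum (k : ℕ) {d : ℕ} (lam : Nat.Partition d) : ℚ :=
  ∑ i : Fin (len lam),
    (((part lam i : ℚ) - ((i : ℕ) + 1 : ℚ) + 1 / 2) ^ k - (-((i : ℕ) + 1 : ℚ) + 1 / 2) ^ k)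

/-- The disconnected double Hurwitz number `h_{μ,ν}^{(r),s}` with `s` completed `(r+1)`-cycles. -/
def hurwitzNumber (r s : ℕ) {d : ℕ} (mu nu : Nat.Partition d) : ℚ :=
  1 / ((∏ i, (part mu i : ℚ)) * ∏ j, (part nu j : ℚ)) *
    ∑ lam : Nat.Partition d,
      chi lam mu * (shiftedPowerSum (r + 1) lam / ((r + 1).factorial : ℚ)) ^ s * chi lam nu

/-! ### The function `ζ` -/

/-- `ζ(z) = e^{z/2} - e^{-z/2}` as a formal power series in one variable. -/
def zetaSeries : PowerSeries ℚ :=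
  PowerSeries.rescale (1 / 2 : ℚ) (PowerSeries.exp ℚ) -
    PowerSeries.rescale (-(1 / 2) : ℚ) (PowerSeries.exp ℚ)

/-- `ζ(f)` for a power series `f` in `z_1, …, z_s` without constant term. -/
def zeta {s : ℕ} (f : MvPowerSeries (Fin s) ℚ) : MvPowerSeries (Fin s) ℚ :=
  zetaSeries.subst f

/-- `z_K = ∑_{k ∈ K} z_k`. -/
def zsum {s : ℕ} (K : Finset (Fin s)) : MvPowerSeries (Fin s) ℚ := ∑ k ∈ K, MvPowerSeries.X k

/-! ### The algorithm and commutation patterns -/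

/-- The label `(I, J, K)` of an operator `𝓔(I, J, K)`. -/
@[ext]
structure Op (m n s : ℕ) where
  I : Finset (Fin m)
  J : Finset (Fin n)
  K : Finset (Fin s)

variable {m n s : ℕ}

instance : Finite (Op m n s) :=
  Finite.of_injective (fun X : Op m n s => (X.I, X.J, X.K)) fun X Y h => by
    simp only [Prod.mk.injEq] at h
    exact Op.ext h.1 h.2.1 h.2.2

/-- The label `(I ∪ M, J ∪ N, K ∪ L)` of the operator produced by commuting `𝓔(I, J, K)` and
`𝓔(M, N, L)`. -/
def Op.union (X Y : Op m n s) : Op m n s := ⟨X.I ∪ Y.I, X.J ∪ Y.J, X.K ∪ Y.K⟩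

/-- The energy `μ_I - ν_J` of `𝓔(I, J, K)`. -/
def energy (a : Fin m → ℕ) (b : Fin n → ℕ) (X : Op m n s) : ℤ :=
  ∑ i ∈ X.I, (a i : ℤ) - ∑ j ∈ X.J, (b j : ℤ)

/-- The word
`∏_i 𝓔({i}, ∅, ∅) ∏_k 𝓔(∅, ∅, {k}) ∏_j 𝓔(∅, {j}, ∅)` from which the algorithm starts. -/
def initialWord (m n s : ℕ) : List (Op m n s) :=
  (List.finRange m).map (fun i => ⟨{i}, ∅, ∅⟩) ++
    (List.finRange s).map (fun k => ⟨∅, ∅, {k}⟩) ++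
    (List.finRange n).map (fun j => ⟨∅, {j}, ∅⟩)

/-- `Run a b w P T`: starting from the word of operators `w`, the algorithm can make its choices in
such a way that the commutators it computes are, in this order, the entries of `P`, and that it ends
with the word `T` of zero energy operators. In each step the leftmost operator `Y` of negative
energy is considered together with its left neighbour `X`, and `X Y` is replaced either by `Y X`
(passing term) or by the operator produced by `[X, Y]` (commutator term). If `Y` has no left
neighbour, the result is zero and there is no way to continue. -/
inductive Run (a : Fin m → ℕ) (b : Fin n → ℕ) :
    List (Op m n s) → List (Op m n s × Op m n s) → List (Op m n s) → Prop
  | done (w : List (Op m n s)) (hw : ∀ X ∈ w, energy a b X = 0) : Run a b w [] w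
  | passing (pre post : List (Op m n s)) (X Y : Op m n s) (P : List (Op m n s × Op m n s))
      (T : List (Op m n s)) (hpre : ∀ Z ∈ pre, 0 ≤ energy a b Z) (hX : 0 ≤ energy a b X)
      (hY : energy a b Y < 0) (h : Run a b (pre ++ Y :: X :: post) P T) :
      Run a b (pre ++ X :: Y :: post) P T
  | commutator (pre post : List (Op m n s)) (X Y : Op m n s) (P : List (Op m n s × Op m n s))
      (T : List (Op m n s)) (hpre : ∀ Z ∈ pre, 0 ≤ energy a b Z) (hX : 0 ≤ energy a b X)
      (hY : energy a b Y < 0) (h : Run a b (pre ++ X.union Y :: post) P T) :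
      Run a b (pre ++ X :: Y :: post) ((X, Y) :: P) T

theorem Run.length_le {a : Fin m → ℕ} {b : Fin n → ℕ} {w : List (Op m n s)}
    {P : List (Op m n s × Op m n s)} {T : List (Op m n s)} (h : Run a b w P T) :
    P.length ≤ w.length := by
  induction h with
  | done => simp
  | passing pre post X Y P T _ _ _ _ ih => simpa using ih
  | commutator pre post X Y P T _ _ _ _ ih =>
    simp only [List.length_append, List.length_cons] at ih ⊢
    omega

theorem Run.coe_final {a : Fin m → ℕ} {b : Fin n → ℕ} {w : List (Op m n s)}
    {P : List (Op m n s × Op m n s)} {T : List (Op m n s)} (h : Run a b w P T) :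
    (T : Multiset (Op m n s)) + ((P.map Prod.fst : Multiset (Op m n s)) + (P.map Prod.snd : List _))
      = (w : Multiset (Op m n s)) + (P.map fun c => c.1.union c.2 : List _) := by
  induction h with
  | done => simp
  | passing pre post X Y P T _ _ _ _ ih =>
    rw [ih]
    congr 1
    exact Multiset.coe_eq_coe.2 (List.Perm.append_left _ (List.Perm.swap _ _ _))
  | commutator pre post X Y P T _ _ _ _ ih =>
    simp only [List.map_cons, ← Multiset.cons_coe, ← Multiset.coe_add, ← Multiset.singleton_add]
      at ih ⊢
    calc _ = {X} + {Y} + ((T : Multiset (Op m n s)) + ((P.map Prod.fst : Multiset (Op m n s))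
        + (P.map Prod.snd : List _))) := by abel
      _ = _ := by rw [ih]; abel

/-- The commutators computed in a run determine the final operators up to their order. -/
theorem Run.perm_final {a : Fin m → ℕ} {b : Fin n → ℕ} {w : List (Op m n s)}
    {P : List (Op m n s × Op m n s)} {T T' : List (Op m n s)} (h : Run a b w P T)
    (h' : Run a b w P T') : T.Perm T' :=
  Multiset.coe_eq_coe.1 (add_right_cancel (h.coe_final.trans h'.coe_final.symm))

open Classical in
/-- The zero energy operators `𝓔_0(z_{S_t})`, `t ∈ T(P)`, that remain at the end of the run of the
algorithm in which the commutators computed are those of `P`. -/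
def finalOperators (a : Fin m → ℕ) (b : Fin n → ℕ) (P : List (Op m n s × Op m n s)) :
    List (Op m n s) :=
  if h : ∃ T, Run a b (initialWord m n s) P T then h.choose else []

open Classical in
/-- The factor produced by the commutator `[𝓔(I, J, K), 𝓔(M, N, L)]`: the function `ζ` of the
determinant of `(μ_I - ν_J, z_K; μ_M - ν_N, z_L)`. The commutator `[𝓔_n(0), 𝓔_{-n}(0)]`
(formally `ζ(0) 𝓔_0(0)`) is read as the scalar operator `n`, that is, as the limit for `t → 0` of
`ζ(n t) 𝓔_0(t)`; it gets the factor `n`. -/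
def commutatorFactor (a : Fin m → ℕ) (b : Fin n → ℕ) (c : Op m n s × Op m n s) :
    MvPowerSeries (Fin s) ℚ :=
  if c.1.K = ∅ ∧ c.2.K = ∅ ∧ energy a b c.1 + energy a b c.2 = 0 then
    ((energy a b c.1 : ℤ) : MvPowerSeries (Fin s) ℚ)
  else
    zeta (Matrix.det !![((energy a b c.1 : ℤ) : MvPowerSeries (Fin s) ℚ), zsum c.1.K;
      ((energy a b c.2 : ℤ) : MvPowerSeries (Fin s) ℚ), zsum c.2.K])

open Classical in
/-- The vacuum expectation `1 / ζ(z_S)` of a final operator `𝓔_0(z_S)`. For `S = ∅` the operator is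
the scalar operator `[𝓔_n(0), 𝓔_{-n}(0)] = n`, which has already been counted in full by
`commutatorFactor`. -/
def finalFactor (X : Op m n s) : FractionRing (MvPowerSeries (Fin s) ℚ) :=
  if X.K = ∅ then 1 else 1 / algebraMap (MvPowerSeries (Fin s) ℚ) _ (zeta (zsum X.K))

/-- The contribution
`∏_{t ∈ T(P)} 1 / ζ(z_{S_t}) ∏_{l ∈ L(P)} ζ(P_I^l P_J^l P_K^l; P_M^l P_N^l P_R^l)`. -/
def contribution (a : Fin m → ℕ) (b : Fin n → ℕ) (P : List (Op m n s × Op m n s)) :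
    FractionRing (MvPowerSeries (Fin s) ℚ) :=
  ((finalOperators a b P).map finalFactor).prod *
    (P.map fun c => algebraMap (MvPowerSeries (Fin s) ℚ) _ (commutatorFactor a b c)).prod

/-- `P` is a commutation pattern: the algorithm can be run in such a way that the commutators
computed are the entries of `P`, and the contribution of this run does not vanish. A run contributes
zero if an operator `𝓔(∅, ∅, {k})` has not been involved in any commutator. -/
def IsCommutationPattern (a : Fin m → ℕ) (b : Fin n → ℕ) (P : List (Op m n s × Op m n s)) : Prop :=
  (∃ T, Run a b (initialWord m n s) P T) ∧
    (∀ k, (⟨∅, ∅, {k}⟩ : Op m n s) ∉ finalOperators a b P) ∧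
    contribution a b P ≠ 0

theorem finite_isCommutationPattern (s : ℕ) (a : Fin m → ℕ) (b : Fin n → ℕ) :
    {P : List (Op m n s × Op m n s) | IsCommutationPattern a b P}.Finite :=
  (List.finite_length_le (Op m n s × Op m n s) (initialWord m n s).length).subset
    fun _ hP => hP.1.choose_spec.length_le

/-- The set `CP_{μ,ν}^s` of all commutation patterns. -/
def commutationPatterns (s : ℕ) (a : Fin m → ℕ) (b : Fin n → ℕ) :
    Finset (List (Op m n s × Op m n s)) :=
  (finite_isCommutationPattern s a b).toFinset

end

end HurwitzCC

namespace HurwitzCC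

noncomputable section

/-! ### Exponentials of formal power series -/

/-! The classical argument is a computation in the fermionic Fock space. The character values are
matrix elements of products of the operators 𝓔_{±μ_i}(0). The operator 𝓔_0(z), freed of its constant
1/ζ(z), is diagonal, and its eigenvalue at λ is the generating series of the p_k(λ)/k!. So the sum
over λ is a coefficient of the vacuum expectation of the initial word. The algorithm evaluates this
expectation by [𝓔_x(u), 𝓔_y(v)] = ζ(det) 𝓔_{x+y}(u+v), and each run is one term of the expansion.

The Fock space is replaced by a finite model: antisymmetric functions of N nonnegative integer
exponents. The vacuum consists of the coefficients of the Vandermonde determinant, and 𝓔_e is the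
second quantization of a weighted shift (`shiftOp`). Two such operators commute up to a third one
and an error caused by the cutoff at exponent 0. On states of degree small compared with N the error
is a scalar, the central cocycle (`IsFermionic.shiftOp_comm`). Two telescoping geometric sums show
that the constants built into `opValue` absorb it, so that the relation of the algorithm is exact
(`IsFermionic.opValue_comm`). The words that occur have total absolute energy at most 2d, hence N =
2d suffices. `exists_sum_runValue` turns the recursion into a sum over runs. `wordState_initialWord`
evaluates the initial word by inserting the basis indexed by partitions; the result is visibly a
power series.

What remains is the Frobenius formula `spechtCharacter_eq_matrixElement`: the character χ of the
Specht module equals the fermionic matrix element M. The Young symmetrizer c satisfies c y c ∈ ℚ c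
for all y and c² = n c with n ≠ 0, which gives ∑_g χ(g)² = d!. A dominance argument pairs c with M
and gives ∑_g χ(g) M(g) = d!. The Heisenberg relation and a count of commuting pairs give d! times
the number of partitions of d for ∑_λ ∑_g M(g)². So ∑_λ ∑_g (χ(g) − M(g))² = 0, and over ℚ every
term vanishes. -/

/-- The exponential of a multivariate power series without constant term. -/
def expSeries {σ : Type*} (f : MvPowerSeries σ ℚ) : MvPowerSeries σ ℚ :=
  (PowerSeries.exp ℚ).subst f

theorem expSeries_zero {σ : Type*} : expSeries (0 : MvPowerSeries σ ℚ) = 1 := by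
  rw [expSeries, PowerSeries.subst_zero_eq_C_constantCoeff, PowerSeries.constantCoeff_exp]
  simp

/-- The universal case of the functional equation: both coefficients at e are 1/(e₀! e₁!). -/
theorem expSeries_X_add_X :
    expSeries (MvPowerSeries.X 0 + MvPowerSeries.X 1 : MvPowerSeries (Fin 2) ℚ) =
      expSeries (MvPowerSeries.X 0) * expSeries (MvPowerSeries.X 1) := by
  ext e
  rw [expSeries, expSeries, expSeries, PowerSeries.coeff_subst_X_zero_add_X_one,
    PowerSeries.coeff_subst_X_zero_subst_mul_X_one]
  simp only [PowerSeries.coeff_exp, eq_ratCast, Rat.cast_id]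
  rw [Nat.cast_add_choose]
  have h0 : ((e 0).factorial : ℚ) ≠ 0 := by positivity
  have h1 : ((e 1).factorial : ℚ) ≠ 0 := by positivity
  have h2 : ((e 0 + e 1).factorial : ℚ) ≠ 0 := by positivity
  field_simp

/-- Substitution of f and g for the two variables of the universal identity. -/
theorem expSeries_add {σ : Type*} {f g : MvPowerSeries σ ℚ}
    (hf : MvPowerSeries.constantCoeff f = 0) (hg : MvPowerSeries.constantCoeff g = 0) :
    expSeries (f + g) = expSeries f * expSeries g := by
  have hb : MvPowerSeries.HasSubst (![f, g] : Fin 2 → MvPowerSeries σ ℚ) :=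
    MvPowerSeries.hasSubst_of_constantCoeff_zero fun i => by fin_cases i <;> simp [hf, hg]
  have key := congrArg (MvPowerSeries.subst (![f, g] : Fin 2 → MvPowerSeries σ ℚ))
    expSeries_X_add_X
  rw [MvPowerSeries.subst_mul hb] at key
  have hs : ∀ a : MvPowerSeries (Fin 2) ℚ, MvPowerSeries.constantCoeff a = 0 →
      MvPowerSeries.subst (![f, g] : Fin 2 → MvPowerSeries σ ℚ) (expSeries a) =
        expSeries (MvPowerSeries.subst (![f, g] : Fin 2 → MvPowerSeries σ ℚ) a) := by
    intro a ha
    have := MvPowerSeries.subst_comp_subst_apply (R := ℚ)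
      (PowerSeries.HasSubst.of_constantCoeff_zero ha).const hb (PowerSeries.exp ℚ)
    exact this
  rw [hs _ (by simp), hs _ (by simp), hs _ (by simp), MvPowerSeries.subst_add hb,
    MvPowerSeries.subst_X hb, MvPowerSeries.subst_X hb] at key
  simpa using key

theorem constantCoeff_smul_eq_zero {σ : Type*} (t : ℚ) {f : MvPowerSeries σ ℚ}
    (hf : MvPowerSeries.constantCoeff f = 0) : MvPowerSeries.constantCoeff (t • f) = 0 := by
  rw [MvPowerSeries.smul_eq_C_mul]; simp [hf]

theorem subst_rescale_exp {σ : Type*} (t : ℚ) {f : MvPowerSeries σ ℚ}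
    (hf : MvPowerSeries.constantCoeff f = 0) :
    (PowerSeries.rescale t (PowerSeries.exp ℚ)).subst f = expSeries (t • f) := by
  have hf' := PowerSeries.HasSubst.of_constantCoeff_zero hf
  rw [PowerSeries.rescale_eq_subst,
    PowerSeries.subst_comp_subst_apply (PowerSeries.HasSubst.smul_X' t) hf',
    PowerSeries.subst_smul hf', PowerSeries.subst_X hf', expSeries]

theorem zeta_eq {s : ℕ} {f : MvPowerSeries (Fin s) ℚ}
    (hf : MvPowerSeries.constantCoeff f = 0) :
    zeta f = expSeries ((1 / 2 : ℚ) • f) - expSeries ((-(1 / 2) : ℚ) • f) := by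
  rw [zeta, zetaSeries, PowerSeries.subst_sub (PowerSeries.HasSubst.of_constantCoeff_zero hf),
    subst_rescale_exp _ hf, subst_rescale_exp _ hf]

theorem constantCoeff_zsum {s : ℕ} (K : Finset (Fin s)) :
    MvPowerSeries.constantCoeff (zsum K) = 0 := by
  simp [zsum]

theorem zsum_union {s : ℕ} {K L : Finset (Fin s)} (h : Disjoint K L) :
    zsum (K ∪ L) = zsum K + zsum L := Finset.sum_union h

theorem zsum_empty {s : ℕ} : zsum (∅ : Finset (Fin s)) = 0 := Finset.sum_empty

/-- Since ζ(z) = z + O(z²), the coefficient of z_k is 1 for each k in K; powers n ≥ 2 of z_K have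
order too large to contribute. This makes 1/ζ(z_K) a genuine inverse in the field of fractions. -/
theorem zeta_ne_zero {s : ℕ} {K : Finset (Fin s)} (hK : K ≠ ∅) : zeta (zsum K) ≠ 0 := by
  obtain ⟨k, hk⟩ := Finset.nonempty_iff_ne_empty.2 hK
  intro h
  have h1 := congrArg (MvPowerSeries.coeff (Finsupp.single k 1)) h
  have hs := PowerSeries.HasSubst.of_constantCoeff_zero (constantCoeff_zsum K)
  rw [zeta, PowerSeries.coeff_subst hs, finsum_eq_single _ 1] at h1
  · rw [pow_one, zsum, map_sum, Finset.sum_eq_single k] at h1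
    · simp [zetaSeries, PowerSeries.coeff_exp] at h1
    · intro j _ hj
      rw [MvPowerSeries.coeff_X, if_neg]
      intro h2
      exact hj ((Finsupp.single_left_inj one_ne_zero).1 h2).symm
    · exact fun h => absurd hk h
  · intro n hn
    rcases Nat.lt_or_ge n 2 with h2 | h2
    · interval_cases n
      · rw [zetaSeries, map_sub, PowerSeries.coeff_rescale, PowerSeries.coeff_rescale]
        simp
      · exact absurd rfl hn
    · have : MvPowerSeries.coeff (Finsupp.single k 1) (zsum K ^ n) = 0 := by
        refine MvPowerSeries.coeff_of_lt_order ?_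
        have h3 : (1 : ℕ∞) ≤ (zsum K).order := by
          rw [MvPowerSeries.one_le_order_iff_constCoeff_eq_zero]
          exact constantCoeff_zsum K
        have h4 := MvPowerSeries.le_order_pow (f := zsum K) n
        refine lt_of_lt_of_le ?_ h4
        have h5 : (n : ℕ∞) ≤ n • (zsum K).order := by
          rw [nsmul_eq_mul]
          exact le_mul_of_one_le_right zero_le h3
        refine lt_of_lt_of_le ?_ h5
        rw [Finsupp.degree_single]
        exact_mod_cast h2
      rw [this, smul_zero]

/-- The coefficients of a product of power series in separate variables. -/
theorem coeff_prod_subst_X {s : ℕ} (g : Fin s → PowerSeries ℚ) (e : Fin s →₀ ℕ) :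
    MvPowerSeries.coeff e (∏ k, (g k).subst (MvPowerSeries.X k : MvPowerSeries (Fin s) ℚ)) =
      ∏ k, PowerSeries.coeff (e k) (g k) := by
  classical
  rw [MvPowerSeries.coeff_prod]
  simp only [PowerSeries.coeff_subst_single]
  rw [Finset.sum_eq_single
    (Finsupp.equivFunOnFinite.symm fun k => Finsupp.single k (e k))]
  · simp
  · intro l hl hne
    by_contra hz
    have h1 : ∀ i, l i = Finsupp.single i (l i i) := by
      intro i
      by_contra h2
      exact hz (Finset.prod_eq_zero (Finset.mem_univ i) (if_neg h2))
    apply hne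
    have h2 := (Finset.mem_finsuppAntidiag.1 hl).1
    have h3 : ∀ i, l i i = e i := by
      intro i
      rw [← h2, Finsupp.finsetSum_apply, Finset.sum_eq_single i]
      · intro j _ hj
        rw [h1 j, Finsupp.single_apply, if_neg hj]
      · simp
    ext i : 1
    rw [h1 i, h3 i]
    rfl
  · intro h
    exfalso
    apply h
    rw [Finset.mem_finsuppAntidiag]
    refine ⟨?_, fun _ _ => Finset.mem_univ _⟩
    conv_rhs => rw [← Finsupp.univ_sum_single e]
    rfl

/-! ### Shift operators on functions of `N` integer variables -/

/-- The point obtained from `k` by adding `a` to the `i`-th coordinate. -/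
def shift {N : ℕ} (k : Fin N → ℤ) (i : Fin N) (a : ℤ) : Fin N → ℤ := Function.update k i (k i + a)

section shift

variable {N : ℕ} (k : Fin N → ℤ)

@[simp] theorem shift_same (i : Fin N) (a : ℤ) : shift k i a i = k i + a := by simp [shift]

theorem shift_ne {i j : Fin N} (h : j ≠ i) (a : ℤ) : shift k i a j = k j := by simp [shift, h]

theorem shift_comm {i j : Fin N} (h : i ≠ j) (a b : ℤ) :
    shift (shift k i a) j b = shift (shift k j b) i a := by
  ext t
  by_cases h1 : t = i
  · subst h1; rw [shift_ne _ h, shift_same, shift_same, shift_ne _ h]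
  · by_cases h2 : t = j
    · subst h2; rw [shift_same, shift_ne _ h1, shift_ne _ h1, shift_same]
    · rw [shift_ne _ h2, shift_ne _ h1, shift_ne _ h1, shift_ne _ h2]

theorem shift_shift (i : Fin N) (a b : ℤ) : shift (shift k i a) i b = shift k i (a + b) := by
  ext t
  by_cases h1 : t = i
  · subst h1; simp [add_assoc]
  · rw [shift_ne _ h1, shift_ne _ h1, shift_ne _ h1]

@[simp] theorem shift_zero (i : Fin N) : shift k i 0 = k := by
  simp [shift]

theorem sum_shift (i : Fin N) (a : ℤ) : ∑ j, shift k i a j = ∑ j, k j + a := by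
  rw [shift, Finset.sum_update_of_mem (Finset.mem_univ i), ← Finset.add_sum_erase _ _
    (Finset.mem_univ i), Finset.sdiff_singleton_eq_erase]
  ring

theorem shift_comp (σ : Equiv.Perm (Fin N)) (i : Fin N) (a : ℤ) :
    shift (k ∘ σ) i a = shift k (σ i) a ∘ σ := by
  ext t
  by_cases h1 : t = i
  · subst h1; simp
  · have : σ t ≠ σ i := fun h => h1 (σ.injective h)
    simp [shift_ne _ h1, shift_ne _ this]

end shift

/-- The second quantization of the operator `x ^ j ↦ w (j - a) x ^ (j - a)` on polynomials,
acting on functions of the exponents `k`. -/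
def shiftOp {N : ℕ} {R : Type*} [CommRing R] (a : ℤ) (w : ℤ → R) :
    Module.End R ((Fin N → ℤ) → R) where
  -- The cutoff discards negative exponents, so polynomials go to polynomials. It is the only source
  -- of the cocycle below.
  toFun f k := ∑ i, if 0 ≤ k i then w (k i) * f (shift k i a) else 0
  map_add' f g := by
    ext k
    simp only [Pi.add_apply, ← Finset.sum_add_distrib]
    refine Finset.sum_congr rfl fun i _ => ?_
    split_ifs <;> ring
  map_smul' c f := by
    ext k
    simp only [Pi.smul_apply, smul_eq_mul, RingHom.id_apply, Finset.mul_sum]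
    refine Finset.sum_congr rfl fun i _ => ?_
    split_ifs <;> ring

section shiftOp

variable {N : ℕ} {R : Type*} [CommRing R]

theorem shiftOp_apply (a : ℤ) (w : ℤ → R) (f : (Fin N → ℤ) → R) (k : Fin N → ℤ) :
    shiftOp a w f k = ∑ i, if 0 ≤ k i then w (k i) * f (shift k i a) else 0 := rfl

theorem shiftOp_zero_apply (w : ℤ → R) (f : (Fin N → ℤ) → R) {k : Fin N → ℤ}
    (hk : ∀ i, 0 ≤ k i) : shiftOp 0 w f k = (∑ i, w (k i)) * f k := by
  rw [shiftOp_apply, Finset.sum_mul]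
  refine Finset.sum_congr rfl fun i _ => ?_
  rw [if_pos (hk i), shift_zero]

/-- Shifts of two different coordinates commute exactly, cutoffs included. Only the terms in which
both operators act on the same coordinate survive. -/
theorem shiftOp_comm_apply (a b : ℤ) (w w' : ℤ → R) (f : (Fin N → ℤ) → R) (k : Fin N → ℤ) :
    shiftOp a w (shiftOp b w' f) k = shiftOp b w' (shiftOp a w f) k +
      ∑ i, if 0 ≤ k i then ((if 0 ≤ k i + a then w (k i) * w' (k i + a) else 0) -
        (if 0 ≤ k i + b then w' (k i) * w (k i + b) else 0)) * f (shift k i (a + b)) else 0 := by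
  rw [← sub_eq_iff_eq_add']
  have expand : ∀ (a b : ℤ) (w w' : ℤ → R), shiftOp a w (shiftOp b w' f) k =
      ∑ i, ∑ j, if 0 ≤ k i then w (k i) * (if 0 ≤ shift k i a j then
        w' (shift k i a j) * f (shift (shift k i a) j b) else 0) else 0 := by
    intro a b w w'
    rw [shiftOp_apply]
    refine Finset.sum_congr rfl fun i _ => ?_
    split_ifs with h
    · rw [shiftOp_apply, Finset.mul_sum]
    · simp
  rw [expand, expand b a w' w, Finset.sum_comm (γ := Fin N), ← Finset.sum_sub_distrib]
  refine Finset.sum_congr rfl fun j _ => ?_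
  rw [← Finset.sum_sub_distrib, Finset.sum_eq_single j]
  · rw [shift_same, shift_same, shift_shift, shift_shift, add_comm b a]
    split_ifs <;> ring
  · intro i _ hij
    rw [shift_ne _ hij.symm, shift_ne _ hij, shift_comm _ hij]
    split_ifs <;> ring
  · exact fun h => absurd (Finset.mem_univ j) h

theorem shiftOp_comm_of_nonneg {a b : ℤ} (ha : 0 ≤ a) (hb : 0 ≤ b)
    (f : (Fin N → ℤ) → R) :
    shiftOp a 1 (shiftOp b 1 f) = shiftOp b 1 (shiftOp a 1 f) := by
  ext k
  rw [shiftOp_comm_apply, add_eq_left]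
  refine Finset.sum_eq_zero fun i _ => ?_
  split_ifs <;> first | omega | simp

/-- Antisymmetric functions supported on points with nonnegative coordinates whose sum exceeds the
minimal possible value `0 + 1 + ⋯ + (N - 1)` by at most `D`. -/
structure IsFermionic (D : ℤ) (f : (Fin N → ℤ) → R) : Prop where
  antisymm (σ : Equiv.Perm (Fin N)) (k : Fin N → ℤ) :
    f (k ∘ σ) = ((Equiv.Perm.sign σ : ℤ) : R) * f k
  nonneg {k : Fin N → ℤ} (hf : f k ≠ 0) (i : Fin N) : 0 ≤ k i
  degree {k : Fin N → ℤ} (hf : f k ≠ 0) : ∑ i, k i ≤ ∑ i : Fin N, (i : ℤ) + D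

/-- Summing over all coordinates preserves antisymmetry. The coordinates not shifted must already be
nonnegative, and the cutoff takes care of the shifted one. -/
theorem IsFermionic.shiftOp {D : ℤ} {f : (Fin N → ℤ) → R} (hf : IsFermionic D f) (a : ℤ)
    (w : ℤ → R) : IsFermionic (D - a) (shiftOp a w f) where
  antisymm σ k := by
    rw [shiftOp_apply, shiftOp_apply, Finset.mul_sum]
    refine Fintype.sum_equiv σ _ _ fun i => ?_
    rw [shift_comp, hf.antisymm, Function.comp_apply]
    split_ifs <;> ring
  nonneg {k} h i := by
    by_contra hi
    apply h
    rw [shiftOp_apply]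
    refine Finset.sum_eq_zero fun j _ => ?_
    by_cases hj : 0 ≤ k j
    · have hij : i ≠ j := by rintro rfl; exact hi hj
      have : f (shift k j a) = 0 := by
        by_contra h0
        have := hf.nonneg h0 i
        rw [shift_ne _ hij] at this
        exact hi this
      simp [this]
    · simp [hj]
  degree {k} h := by
    rw [shiftOp_apply] at h
    obtain ⟨i, _, hi⟩ := Finset.exists_ne_zero_of_sum_ne_zero h
    have : f (shift k i a) ≠ 0 := by
      intro h0
      simp [h0] at hi
    have := hf.degree this
    rw [sum_shift] at this
    linarith

theorem IsFermionic.add {D : ℤ} {f g : (Fin N → ℤ) → R} (hf : IsFermionic D f)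
    (hg : IsFermionic D g) : IsFermionic D (f + g) where
  antisymm σ k := by
    rw [Pi.add_apply, Pi.add_apply, hf.antisymm, hg.antisymm, mul_add]
  nonneg {k} h i := by
    by_cases h1 : f k = 0
    · exact hg.nonneg (fun h2 => h (by simp [h1, h2])) i
    · exact hf.nonneg h1 i
  degree {k} h := by
    by_cases h1 : f k = 0
    · exact hg.degree (fun h2 => h (by simp [h1, h2]))
    · exact hf.degree h1

theorem IsFermionic.smul {D : ℤ} {f : (Fin N → ℤ) → R} (hf : IsFermionic D f) (c : R) :
    IsFermionic D (c • f) where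
  antisymm σ k := by
    rw [Pi.smul_apply, Pi.smul_apply, hf.antisymm, smul_eq_mul, smul_eq_mul]; ring
  nonneg {k} h i := hf.nonneg (fun h2 => h (by simp [h2])) i
  degree {k} h := hf.degree (fun h2 => h (by simp [h2]))

/-- Pauli exclusion: swapping two equal coordinates fixes k but changes the sign of f k. -/
theorem IsFermionic.injective [IsDomain R] [CharZero R] {D : ℤ} {f : (Fin N → ℤ) → R}
    (hf : IsFermionic D f) {k : Fin N → ℤ} (h : f k ≠ 0) : Function.Injective k := by
  intro i j hij
  by_contra hne
  apply h
  have h1 := hf.antisymm (Equiv.swap i j) k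
  have h2 : k ∘ Equiv.swap i j = k := by
    ext t
    rw [Function.comp_apply, Equiv.swap_apply_def]
    split_ifs with h3 h4
    · rw [h3, hij]
    · rw [h4, hij]
    · rfl
  rw [h2, Equiv.Perm.sign_swap hne] at h1
  have h3 : (2 : R) * f k = 0 := by
    push_cast at h1
    linear_combination h1
  simpa using h3

end shiftOp

/-! ### Distinct nonnegative exponents of nearly minimal sum -/

theorem sum_fin_le_sum_of_injective {N : ℕ} {k : Fin N → ℤ} (hinj : Function.Injective k)
    (hk : ∀ i, 0 ≤ k i) : ∑ i : Fin N, (i : ℤ) ≤ ∑ i, k i := by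
  have h := Finset.sum_range_le_sum (s := Finset.univ.image k) (c := 0) (by
    intro x hx
    obtain ⟨i, _, rfl⟩ := Finset.mem_image.1 hx
    exact hk i)
  rw [Finset.card_image_of_injective _ hinj, Finset.card_univ, Fintype.card_fin,
    Finset.sum_image (fun _ _ _ _ h => hinj h), ← Fin.sum_univ_eq_sum_range
      (fun n : ℕ => (0 : ℤ) + n)] at h
  simpa using h

/-- If the sum of the coordinates is close to the minimum then all small values occur. -/
theorem exists_eq_of_sum_le {N : ℕ} {k : Fin N → ℤ} (hinj : Function.Injective k)
    (hk : ∀ i, 0 ≤ k i) {D : ℤ} (hD : ∑ i, k i ≤ ∑ i : Fin N, (i : ℤ) + D) {v : ℤ} (hv : 0 ≤ v)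
    (hvN : v + D < N) : ∃ i, k i = v := by
  by_contra! hne
  -- If v is missed, lowering all values above v by 1 keeps them distinct and nonnegative. At least
  -- N − v > D values are lowered, which pushes the sum below its minimum.
  have h1 := sum_fin_le_sum_of_injective (k := fun i => if v < k i then k i - 1 else k i) (by
    intro i j hij
    have hi := hne i
    have hj := hne j
    apply hinj
    simp only at hij
    split_ifs at hij <;> omega) (by
    intro i
    have := hk i
    split_ifs <;> omega)
  have h2 : ∀ i, (if v < k i then k i - 1 else k i) = k i - 1 + (if k i < v then 1 else 0) := by
    intro i
    have := hne i
    split_ifs <;> omega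
  simp only [h2, Finset.sum_add_distrib, Finset.sum_sub_distrib] at h1
  have h3 : (∑ i, if k i < v then (1 : ℤ) else 0) ≤ v := by
    rw [Finset.sum_boole]
    have h4 : (univ.filter fun i => k i < v).card ≤ (Finset.Ico 0 v).card :=
      Finset.card_le_card_of_injOn k (fun i hi => by
        simp only [Finset.coe_filter, Finset.mem_univ, true_and, Set.mem_ofPred_eq] at hi
        simp [hk i, hi]) (fun _ _ _ _ h => hinj h)
    rw [Int.card_Ico] at h4
    have : ((univ.filter fun i => k i < v).card : ℤ) ≤ ((v - 0).toNat : ℤ) := by exact_mod_cast h4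
    omega
  simp at h1 h3
  linarith

section comm

variable {N : ℕ} {R : Type*} [CommRing R] [IsDomain R] [CharZero R]

/-- There are no states below the vacuum degree; this is why annihilation operators kill the vacuum.
-/
theorem IsFermionic.eq_zero {D : ℤ} {f : (Fin N → ℤ) → R} (hf : IsFermionic D f) (hD : D < 0) :
    f = 0 := by
  ext k
  by_contra h
  have h1 := hf.degree h
  have h2 := sum_fin_le_sum_of_injective (hf.injective h) (hf.nonneg h)
  linarith

/-- The commutation relation of the shift operators. The last term is the cocycle. -/
theorem IsFermionic.shiftOp_comm {D : ℤ} {f : (Fin N → ℤ) → R} (hf : IsFermionic D f) {a b : ℤ}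
    (ha : 0 ≤ a) (hD : -b + D ≤ N) (w w' : ℤ → R) :
    HurwitzCC.shiftOp a w (HurwitzCC.shiftOp b w' f) =
      HurwitzCC.shiftOp b w' (HurwitzCC.shiftOp a w f) +
      HurwitzCC.shiftOp (a + b) (fun j => w j * w' (j + a) - w' j * w (j + b)) f +
      (if a + b = 0 then ∑ j ∈ Finset.Ico 0 a, w' j * w (j + b) else 0) • f := by
  ext k
  rw [shiftOp_comm_apply, Pi.add_apply, Pi.add_apply, add_assoc, add_right_inj,
    ← sub_eq_iff_eq_add', HurwitzCC.shiftOp_apply, ← Finset.sum_sub_distrib]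
  -- Because a ≥ 0, the cutoff in the first product never acts. The one in the second acts exactly
  -- for 0 ≤ k i < −b.
  have h1 : ∀ i, ((if 0 ≤ k i then ((if 0 ≤ k i + a then w (k i) * w' (k i + a) else 0) -
        (if 0 ≤ k i + b then w' (k i) * w (k i + b) else 0)) * f (shift k i (a + b)) else 0) -
      if 0 ≤ k i then (w (k i) * w' (k i + a) - w' (k i) * w (k i + b)) * f (shift k i (a + b))
        else 0) =
      if 0 ≤ k i ∧ k i < -b then w' (k i) * w (k i + b) * f (shift k i (a + b)) else 0 := by
    intro i
    by_cases h0 : 0 ≤ k i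
    · have h2 : 0 ≤ k i + a := by omega
      by_cases h3 : k i < -b
      · rw [if_pos h0, if_pos h0, if_pos (⟨h0, h3⟩ : 0 ≤ k i ∧ k i < -b), if_pos h2,
          if_neg (by omega : ¬ 0 ≤ k i + b)]
        ring
      · rw [if_pos h0, if_pos h0, if_neg (fun h : 0 ≤ k i ∧ k i < -b => h3 h.2), if_pos h2,
          if_pos (by omega : 0 ≤ k i + b)]
        ring
    · rw [if_neg h0, if_neg h0, if_neg (fun h : 0 ≤ k i ∧ k i < -b => h0 h.1), sub_zero]
  simp only [h1]
  rw [Pi.smul_apply, smul_eq_mul]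
  split_ifs with hab
  · simp only [hab, shift_zero]
    by_cases hk : f k = 0
    · simp [hk]
    have hinj := hf.injective hk
    rw [Finset.sum_mul, ← Finset.sum_filter]
    refine Finset.sum_nbij k ?_ (fun _ _ _ _ h => hinj h) ?_ (fun _ _ => rfl)
    · intro i hi
      have := (Finset.mem_filter.1 hi).2
      rw [Finset.mem_Ico]
      omega
    -- For v < a = −b the bound gives v + D < N, so v is a coordinate of k. The error is therefore
    -- the same scalar at every point of the support.
    · intro v hv
      have hv' := Finset.mem_Ico.1 (Finset.mem_coe.1 hv)
      obtain ⟨i, rfl⟩ := exists_eq_of_sum_le hinj (hf.nonneg hk) (hf.degree hk) hv'.1 (by omega)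
      refine ⟨i, ?_, rfl⟩
      simp only [Finset.coe_filter, Finset.mem_univ, true_and, Set.mem_ofPred_eq]
      omega
  · rw [zero_mul]
    by_cases hinj : Function.Injective k
    · refine Finset.sum_eq_zero fun i _ => ?_
      split_ifs with hi
      -- A point of the support has a coordinate equal to the small value k i. After the nonzero
      -- shift it can only sit at another index j, against the injectivity of k.
      · have : f (shift k i (a + b)) = 0 := by
          by_contra hk
          obtain ⟨j, hj⟩ := exists_eq_of_sum_le (hf.injective hk) (hf.nonneg hk) (hf.degree hk)
            hi.1 (by omega)
          by_cases hij : j = i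
          · subst hij
            rw [shift_same] at hj
            omega
          · rw [shift_ne _ hij] at hj
            exact hij (hinj hj)
        rw [this, mul_zero]
      · rfl
    -- At a point with repeated coordinates, the error is the value of a shift operator with
    -- truncated weights, whose image is again antisymmetric.
    · have hg := hf.shiftOp (a + b)
        (fun j => if j < -b then w' j * w (j + b) else 0)
      have h0 : HurwitzCC.shiftOp (a + b) (fun j => if j < -b then w' j * w (j + b) else 0) f k
          = 0 := by
        by_contra h
        exact hinj (hg.injective h)
      rw [HurwitzCC.shiftOp_apply] at h0
      refine (Finset.sum_congr rfl fun i _ => ?_).trans h0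
      by_cases h2 : 0 ≤ k i <;> by_cases h3 : k i < -b <;> simp [h2, h3]

end comm

/-! ### The vacuum -/

/-- The exponents `N - 1, …, 1, 0` of the vacuum. -/
def rho (N : ℕ) (i : Fin N) : ℤ := N - 1 - i

theorem rho_nonneg {N : ℕ} (i : Fin N) : 0 ≤ rho N i := by
  have := i.isLt
  unfold rho; omega

theorem rho_injective (N : ℕ) : Function.Injective (rho N) := by
  intro i j h
  unfold rho at h
  ext
  omega

theorem sum_rho (N : ℕ) : ∑ i, rho N i = ∑ i : Fin N, (i : ℤ) := by
  refine Fintype.sum_equiv Fin.revPerm _ _ fun i => ?_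
  have := i.isLt
  simp only [Fin.revPerm_apply, Fin.val_rev, rho]
  omega

/-- The vacuum: the coefficients of the Vandermonde determinant. -/
def vacuum (N : ℕ) (R : Type*) [CommRing R] (k : Fin N → ℤ) : R :=
  ∑ σ : Equiv.Perm (Fin N), if k = rho N ∘ σ then ((Equiv.Perm.sign σ : ℤ) : R) else 0

theorem vacuum_rho (N : ℕ) (R : Type*) [CommRing R] : vacuum N R (rho N) = 1 := by
  rw [vacuum, Finset.sum_eq_single 1]
  · simp
  · intro σ _ hσ
    rw [if_neg]
    intro h
    apply hσ
    ext i : 1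
    exact rho_injective N (congrFun h i).symm
  · exact fun h => absurd (Finset.mem_univ _) h

theorem isFermionic_vacuum (N : ℕ) (R : Type*) [CommRing R] :
    IsFermionic 0 (vacuum N R) := by
  have hex : ∀ {k : Fin N → ℤ}, vacuum N R k ≠ 0 → ∃ σ : Equiv.Perm (Fin N), k = rho N ∘ σ := by
    intro k h
    obtain ⟨σ, _, hσ⟩ := Finset.exists_ne_zero_of_sum_ne_zero h
    exact ⟨σ, by by_contra h1; simp [h1] at hσ⟩
  refine ⟨fun τ k => ?_, fun h i => ?_, fun h => ?_⟩
  · rw [vacuum, vacuum, Finset.mul_sum]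
    refine Fintype.sum_equiv (Equiv.mulRight τ⁻¹) _ _ fun σ => ?_
    have h1 : k ∘ τ = rho N ∘ σ ↔ k = rho N ∘ (Equiv.mulRight τ⁻¹ σ) := by
      constructor
      · intro h
        ext i
        have := congrFun h (τ⁻¹ i)
        simpa using this
      · rintro rfl
        ext i
        simp
    simp only [h1]
    split_ifs
    · rw [Equiv.coe_mulRight, Equiv.Perm.sign_mul, Equiv.Perm.sign_inv]
      rcases Int.units_eq_one_or (Equiv.Perm.sign τ) with h | h <;> simp [h]
    · simp
  · obtain ⟨σ, rfl⟩ := hex h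
    exact rho_nonneg _
  · obtain ⟨σ, rfl⟩ := hex h
    rw [add_zero, ← sum_rho]
    exact (Equiv.sum_comp σ (rho N)).le

/-! ### The algorithm -/

section Runs

variable {m n s : ℕ} {a : Fin m → ℕ} {b : Fin n → ℕ}

/-- The leftmost element violating p splits a list in only one way. Hence the operator treated by
the algorithm is determined by the word. -/
theorem eq_of_append_cons_eq {α : Type*} {p : α → Prop} {pre pre' post post' : List α} {Y Y' : α}
    (hpre : ∀ Z ∈ pre, p Z) (hY : ¬ p Y) (hpre' : ∀ Z ∈ pre', p Z) (hY' : ¬ p Y')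
    (h : pre ++ Y :: post = pre' ++ Y' :: post') : pre = pre' ∧ Y = Y' ∧ post = post' := by
  induction pre generalizing pre' with
  | nil =>
    cases pre' with
    | nil => simpa using h
    | cons Z t =>
      simp only [List.nil_append, List.cons_append, List.cons.injEq] at h
      exact absurd (h.1 ▸ hpre' Z (by simp)) hY
  | cons Z t ih =>
    cases pre' with
    | nil =>
      simp only [List.nil_append, List.cons_append, List.cons.injEq] at h
      exact absurd (h.1 ▸ hpre Z (by simp)) hY'
    | cons Z' t' =>
      simp only [List.cons_append, List.cons.injEq] at h
      have := ih (fun W hW => hpre W (by simp [hW])) (fun W hW => hpre' W (by simp [hW])) h.2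
      exact ⟨by rw [h.1, this.1], this.2⟩

theorem exists_leftmost {α : Type*} (p : α → Prop) (w : List α) :
    (∀ Z ∈ w, p Z) ∨ ∃ pre Y post, w = pre ++ Y :: post ∧ (∀ Z ∈ pre, p Z) ∧ ¬ p Y := by
  induction w with
  | nil => left; simp
  | cons X t ih =>
    by_cases hX : p X
    · rcases ih with h | ⟨pre, Y, post, rfl, hpre, hY⟩
      · left
        simpa [hX] using h
      · right
        exact ⟨X :: pre, Y, post, rfl, by simpa [hX] using hpre, hY⟩
    · right
      exact ⟨[], X, t, rfl, by simp, hX⟩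

theorem Run.eq_nil_of_nonneg {w : List (Op m n s)} {P : List (Op m n s × Op m n s)}
    {T : List (Op m n s)} (h : Run a b w P T) (hw : ∀ X ∈ w, 0 ≤ energy a b X) :
    P = [] ∧ T = w := by
  cases h with
  | done => exact ⟨rfl, rfl⟩
  | passing pre post X Y _ _ _ _ hY _ => exact absurd hY (not_lt.2 (hw Y (by simp)))
  | commutator pre post X Y _ _ _ _ hY _ => exact absurd hY (not_lt.2 (hw Y (by simp)))

theorem Run.cases_of_neg {pre post : List (Op m n s)} {Y : Op m n s}
    {P : List (Op m n s × Op m n s)} {T : List (Op m n s)} (h : Run a b (pre ++ Y :: post) P T)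
    (hpre : ∀ Z ∈ pre, 0 ≤ energy a b Z) (hY : energy a b Y < 0) :
    ∃ pre' X, pre = pre' ++ [X] ∧ (Run a b (pre' ++ Y :: X :: post) P T ∨
      ∃ P', P = (X, Y) :: P' ∧ Run a b (pre' ++ X.union Y :: post) P' T) := by
  generalize hw : pre ++ Y :: post = w at h
  cases h with
  | done _ h0 =>
    subst hw
    exact absurd (h0 Y (by simp)) hY.ne
  | passing pre₂ post₂ X₂ Y₂ _ _ hpre₂ hX₂ hY₂ h₂ =>
    have hw' : pre ++ Y :: post = (pre₂ ++ [X₂]) ++ Y₂ :: post₂ := by rw [hw]; simp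
    obtain ⟨h1, rfl, rfl⟩ := eq_of_append_cons_eq (p := fun Z => 0 ≤ energy a b Z) hpre
      (not_le.2 hY) (by simpa [or_imp, forall_and, hX₂] using hpre₂) (not_le.2 hY₂) hw'
    exact ⟨pre₂, X₂, h1, Or.inl h₂⟩
  | commutator pre₂ post₂ X₂ Y₂ P₂ _ hpre₂ hX₂ hY₂ h₂ =>
    have hw' : pre ++ Y :: post = (pre₂ ++ [X₂]) ++ Y₂ :: post₂ := by rw [hw]; simp
    obtain ⟨h1, rfl, rfl⟩ := eq_of_append_cons_eq (p := fun Z => 0 ≤ energy a b Z) hpre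
      (not_le.2 hY) (by simpa [or_imp, forall_and, hX₂] using hpre₂) (not_le.2 hY₂) hw'
    exact ⟨pre₂, X₂, h1, Or.inr ⟨P₂, rfl, h₂⟩⟩

/-- The leftmost negative operator travels left until it is commuted with something; a run in which
it reaches the left end does not exist. So the first commutator involves Y and an operator to its
left. -/
theorem Run.head_of_neg {pre post : List (Op m n s)} {Y : Op m n s}
    {P : List (Op m n s × Op m n s)} {T : List (Op m n s)} (h : Run a b (pre ++ Y :: post) P T)
    (hpre : ∀ Z ∈ pre, 0 ≤ energy a b Z) (hY : energy a b Y < 0) :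
    ∃ Z ∈ pre, ∃ P', P = (Z, Y) :: P' := by
  induction pre using List.reverseRecOn generalizing post with
  | nil =>
    obtain ⟨_, _, h1, _⟩ := h.cases_of_neg hpre hY
    simp at h1
  | append_singleton pre' X ih =>
    obtain ⟨pre₂, X₂, h1, h2⟩ := h.cases_of_neg hpre hY
    obtain ⟨rfl, h3⟩ := List.append_inj' h1 rfl
    obtain rfl : X = X₂ := by simpa using h3
    rcases h2 with h2 | ⟨P', rfl, _⟩
    · obtain ⟨Z, hZ, P', rfl⟩ := ih h2 fun Z hZ => hpre Z (by simp [hZ])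
      exact ⟨Z, by simp [hZ], P', rfl⟩
    · exact ⟨X, by simp, P', rfl⟩

/-- The labels of `X` and `Y` have no index in common. -/
def Op.IsDisjoint (X Y : Op m n s) : Prop :=
  Disjoint X.I Y.I ∧ Disjoint X.J Y.J ∧ Disjoint X.K Y.K

theorem Op.IsDisjoint.symm {X Y : Op m n s} (h : X.IsDisjoint Y) : Y.IsDisjoint X :=
  ⟨h.1.symm, h.2.1.symm, h.2.2.symm⟩

theorem Op.IsDisjoint.union_left {X Y Z : Op m n s} (hX : X.IsDisjoint Z) (hY : Y.IsDisjoint Z) :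
    (X.union Y).IsDisjoint Z :=
  ⟨Finset.disjoint_union_left.2 ⟨hX.1, hY.1⟩, Finset.disjoint_union_left.2 ⟨hX.2.1, hY.2.1⟩,
    Finset.disjoint_union_left.2 ⟨hX.2.2, hY.2.2⟩⟩

theorem energy_union {X Y : Op m n s} (h : X.IsDisjoint Y) :
    energy a b (X.union Y) = energy a b X + energy a b Y := by
  simp only [energy, Op.union]
  rw [Finset.sum_union h.1, Finset.sum_union h.2.1]
  ring

variable (a b) in
/-- The properties of words that are preserved by the algorithm. -/
structure IsBalanced (N : ℕ) (w : List (Op m n s)) : Prop where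
  disjoint : w.Pairwise Op.IsDisjoint
  ne_empty : ∀ X ∈ w, X ≠ ⟨∅, ∅, ∅⟩
  sum_energy : (w.map (energy a b)).sum = 0
  -- This bound keeps the intermediate states in the range of degrees where the commutation relation
  -- is valid.
  sum_abs_energy : (w.map fun X => |energy a b X|).sum ≤ N

theorem IsBalanced.swap {N : ℕ} {pre post : List (Op m n s)} {X Y : Op m n s}
    (h : IsBalanced a b N (pre ++ X :: Y :: post)) :
    IsBalanced a b N (pre ++ Y :: X :: post) := by
  have hp : (pre ++ X :: Y :: post).Perm (pre ++ Y :: X :: post) :=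
    List.Perm.append_left _ (List.Perm.swap _ _ _)
  exact ⟨(hp.pairwise_iff fun h => h.symm).1 h.disjoint,
    fun Z hZ => h.ne_empty Z (hp.mem_iff.2 hZ),
    by rw [← (hp.map _).sum_eq]; exact h.sum_energy,
    by rw [← (hp.map _).sum_eq]; exact h.sum_abs_energy⟩

theorem IsBalanced.isDisjoint {N : ℕ} {pre post : List (Op m n s)} {X Y : Op m n s}
    (h : IsBalanced a b N (pre ++ X :: Y :: post)) : X.IsDisjoint Y := by
  have := (List.pairwise_append.1 h.disjoint).2.1
  exact (List.pairwise_cons.1 this).1 Y (by simp)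

theorem IsBalanced.union {N : ℕ} {pre post : List (Op m n s)} {X Y : Op m n s}
    (h : IsBalanced a b N (pre ++ X :: Y :: post)) :
    IsBalanced a b N (pre ++ X.union Y :: post) := by
  have hXY := h.isDisjoint
  refine ⟨?_, ?_, ?_, ?_⟩
  · have h1 := h.disjoint
    simp only [List.pairwise_append, List.pairwise_cons] at h1 ⊢
    obtain ⟨h2, ⟨h3, h4, h5⟩, h6⟩ := h1
    refine ⟨h2, ⟨fun Z hZ => (h3 Z (by simp [hZ])).union_left (h4 Z hZ), h5⟩, fun Z hZ W hW => ?_⟩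
    rcases List.mem_cons.1 hW with rfl | hW
    · exact ((h6 Z hZ X (by simp)).symm.union_left (h6 Z hZ Y (by simp)).symm).symm
    · exact h6 Z hZ W (by simp [hW])
  · intro Z hZ
    rcases List.mem_append.1 hZ with hZ | hZ
    · exact h.ne_empty Z (by simp [hZ])
    · rcases List.mem_cons.1 hZ with rfl | hZ
      · intro h0
        apply h.ne_empty X (by simp)
        simp only [Op.union, Op.mk.injEq, Finset.union_eq_empty] at h0
        exact Op.ext h0.1.1 h0.2.1.1 h0.2.2.1
      · exact h.ne_empty Z (by simp [hZ])
  · have h1 := h.sum_energy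
    simp only [List.map_append, List.map_cons, List.sum_append, List.sum_cons] at h1 ⊢
    rw [energy_union hXY, ← h1]
    ring
  · have h1 := h.sum_abs_energy
    simp only [List.map_append, List.map_cons, List.sum_append, List.sum_cons] at h1 ⊢
    rw [energy_union hXY]
    have := abs_add_le (energy a b X) (energy a b Y)
    linarith

/-- A label disjoint from itself is empty, so no label occurs twice in a balanced word. -/
theorem IsBalanced.notMem {N : ℕ} {pre post : List (Op m n s)} {X : Op m n s}
    (h : IsBalanced a b N (pre ++ X :: post)) : X ∉ pre := by
  intro hX
  have h1 := (List.pairwise_append.1 h.disjoint).2.2 X hX X (by simp)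
  apply h.ne_empty X (by simp)
  obtain ⟨h2, h3, h4⟩ := h1
  rw [disjoint_self, Finset.bot_eq_empty] at h2 h3 h4
  exact Op.ext h2 h3 h4

open Classical in
/-- The contribution of a run with commutators `P` that starts from `w`, for given values `fin` of
the final operators and `fac` of the commutators. -/
def runValue (a : Fin m → ℕ) (b : Fin n → ℕ) {R : Type*} [CommRing R] (fin : Op m n s → R)
    (fac : Op m n s × Op m n s → R) (w : List (Op m n s)) (P : List (Op m n s × Op m n s)) : R :=
  if h : ∃ T, Run a b w P T then (h.choose.map fin).prod * (P.map fac).prod else 0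

/-- By `Run.perm_final` the commutators fix the final word up to order, so the choice in `runValue`
is immaterial. -/
theorem Run.runValue_eq {R : Type*} [CommRing R] (fin : Op m n s → R)
    (fac : Op m n s × Op m n s → R) {w : List (Op m n s)} {P : List (Op m n s × Op m n s)}
    {T : List (Op m n s)} (h : Run a b w P T) :
    runValue a b fin fac w P = (T.map fin).prod * (P.map fac).prod := by
  have h' : ∃ T, Run a b w P T := ⟨T, h⟩
  rw [runValue, dif_pos h', ((h'.choose_spec.perm_final h).map fin).prod_eq]

/-- A function on words that satisfies the recursion of the algorithm is the sum of the
contributions of all runs. -/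
theorem exists_sum_runValue {R : Type*} [CommRing R] (N : ℕ) (fin : Op m n s → R)
    (fac : Op m n s × Op m n s → R) (V : List (Op m n s) → R)
    (hzero : ∀ w, (∀ X ∈ w, energy a b X = 0) → V w = (w.map fin).prod)
    (hneg : ∀ Y post, IsBalanced a b N (Y :: post) → energy a b Y < 0 → V (Y :: post) = 0)
    (hstep : ∀ pre X Y post, IsBalanced a b N (pre ++ X :: Y :: post) → 0 ≤ energy a b X →
      energy a b Y < 0 → V (pre ++ X :: Y :: post) =
        V (pre ++ Y :: X :: post) + fac (X, Y) * V (pre ++ X.union Y :: post))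
    (w : List (Op m n s)) (hw : IsBalanced a b N w) :
    ∃ S : Finset (List (Op m n s × Op m n s)), (∀ P, P ∈ S ↔ ∃ T, Run a b w P T) ∧
      ∑ P ∈ S, runValue a b fin fac w P = V w := by
  classical
  -- A commutator shortens the word. A passing step keeps the length but shortens the part before Y,
  -- so an inner induction on that prefix is nested.
  induction hl : w.length using Nat.strong_induction_on generalizing w with
  | _ l IH =>
  rcases exists_leftmost (fun Z => 0 ≤ energy a b Z) w with hall | ⟨pre, Y, post, rfl, hpre, hY⟩
  · have h0 : ∀ X ∈ w, energy a b X = 0 := by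
      have h1 := hw.sum_energy
      intro X hX
      refine List.all_zero_of_le_zero_le_of_sum_eq_zero (l := w.map (energy a b)) ?_ h1
        (List.mem_map_of_mem hX)
      intro e he
      obtain ⟨Z, hZ, rfl⟩ := List.mem_map.1 he
      exact hall Z hZ
    refine ⟨{[]}, fun P => ?_, ?_⟩
    · rw [Finset.mem_singleton]
      constructor
      · rintro rfl
        exact ⟨w, Run.done w h0⟩
      · rintro ⟨T, hT⟩
        exact (hT.eq_nil_of_nonneg hall).1
    · rw [Finset.sum_singleton, (Run.done w h0).runValue_eq, hzero w h0]
      simp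
  · rw [not_le] at hY
    subst hl
    induction pre using List.reverseRecOn generalizing post with
    | nil =>
      refine ⟨∅, fun P => ?_, ?_⟩
      · simp only [Finset.notMem_empty, false_iff]
        rintro ⟨T, hT⟩
        obtain ⟨Z, hZ, _⟩ := hT.head_of_neg hpre hY
        simp at hZ
      · rw [Finset.sum_empty, List.nil_append, hneg Y post hw hY]
    | append_singleton pre' X ih =>
      have hX : 0 ≤ energy a b X := hpre X (by simp)
      have hpre' : ∀ Z ∈ pre', 0 ≤ energy a b Z := fun Z hZ => hpre Z (by simp [hZ])
      have heq : pre' ++ [X] ++ Y :: post = pre' ++ X :: Y :: post := by simp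
      rw [heq] at hw IH ⊢
      obtain ⟨S₁, hS₁, hV₁⟩ := ih (X :: post) hw.swap hpre' (by
        intro m' hm'
        refine IH m' ?_
        simpa using hm')
      obtain ⟨S₂, hS₂, hV₂⟩ := IH _ (by simp) (pre' ++ X.union Y :: post) hw.union rfl
      refine ⟨S₁ ∪ S₂.image (fun P => (X, Y) :: P), fun P => ?_, ?_⟩
      · rw [Finset.mem_union, hS₁, Finset.mem_image]
        constructor
        · rintro (⟨T, hT⟩ | ⟨P', hP', rfl⟩)
          · exact ⟨T, Run.passing _ _ _ _ _ _ hpre' hX hY hT⟩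
          · obtain ⟨T, hT⟩ := (hS₂ P').1 hP'
            exact ⟨T, Run.commutator _ _ _ _ _ _ hpre' hX hY hT⟩
        · rintro ⟨T, hT⟩
          rw [← heq] at hT
          obtain ⟨pre₂, X₂, h1, h2⟩ := hT.cases_of_neg hpre hY
          obtain ⟨rfl, h3⟩ := List.append_inj' h1 rfl
          obtain rfl : X = X₂ := by simpa using h3
          rcases h2 with h2 | ⟨P', rfl, h2⟩
          · exact Or.inl ⟨T, h2⟩
          · exact Or.inr ⟨P', (hS₂ P').2 ⟨T, h2⟩, rfl⟩
      · rw [Finset.sum_union, Finset.sum_image, hstep _ _ _ _ hw hX hY, ← hV₁, ← hV₂,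
          Finset.mul_sum]
        · congr 1
          · refine Finset.sum_congr rfl fun P hP => ?_
            obtain ⟨T, hT⟩ := (hS₁ P).1 hP
            rw [hT.runValue_eq, (Run.passing _ _ _ _ _ _ hpre' hX hY hT).runValue_eq]
          · refine Finset.sum_congr rfl fun P hP => ?_
            obtain ⟨T, hT⟩ := (hS₂ P).1 hP
            rw [hT.runValue_eq, (Run.commutator _ _ _ _ _ _ hpre' hX hY hT).runValue_eq,
              List.map_cons, List.prod_cons]
            ring
        · intro P _ P' _ h
          simpa using h
        -- A run that lets Y pass X has a first commutator (Z, Y) with Z left of X, and X does not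
        -- occur there. Hence the list of commutators remembers each choice.
        · rw [Finset.disjoint_left]
          intro P hP hP'
          obtain ⟨T, hT⟩ := (hS₁ P).1 hP
          obtain ⟨P', _, rfl⟩ := Finset.mem_image.1 hP'
          obtain ⟨Z, hZ, P'', h⟩ := hT.head_of_neg hpre' hY
          simp only [List.cons.injEq, Prod.mk.injEq] at h
          exact hw.notMem (h.1.1 ▸ hZ)

theorem isBalanced_initialWord {N : ℕ} (ha : ∑ i, a i = ∑ j, b j)
    (hN : ∑ i, a i + ∑ j, b j ≤ N) : IsBalanced a b N (initialWord m n s) := by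
  have hI : ∀ i, energy a b (⟨{i}, ∅, ∅⟩ : Op m n s) = a i := fun i => by simp [energy]
  have hK : ∀ k, energy a b (⟨∅, ∅, {k}⟩ : Op m n s) = 0 := fun i => by simp [energy]
  have hJ : ∀ j, energy a b (⟨∅, {j}, ∅⟩ : Op m n s) = -b j := fun i => by simp [energy]
  refine ⟨?_, ?_, ?_, ?_⟩
  · have hnd : ∀ t, (List.finRange t).Pairwise (· ≠ ·) := fun t => List.nodup_finRange t
    simp only [initialWord, List.pairwise_append, List.pairwise_map, List.mem_append, List.mem_map]
    refine ⟨⟨(hnd m).imp ?_, (hnd s).imp ?_, ?_⟩, (hnd n).imp ?_, ?_⟩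
    · intro i j h; simp [Op.IsDisjoint, h]
    · intro i j h; simp [Op.IsDisjoint, h]
    · rintro _ ⟨i, _, rfl⟩ _ ⟨j, _, rfl⟩; simp [Op.IsDisjoint]
    · intro i j h; simp [Op.IsDisjoint, h]
    · rintro _ (⟨i, _, rfl⟩ | ⟨i, _, rfl⟩) _ ⟨j, _, rfl⟩ <;> simp [Op.IsDisjoint]
  · intro X hX
    simp only [initialWord, List.mem_append, List.mem_map] at hX
    rcases hX with (⟨i, _, rfl⟩ | ⟨i, _, rfl⟩) | ⟨i, _, rfl⟩ <;> simp
  · simp only [initialWord, List.map_append, List.map_map, Function.comp_def, List.sum_append, hI,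
      hJ, hK]
    rw [← List.ofFn_eq_map, ← List.ofFn_eq_map, ← List.ofFn_eq_map, List.sum_ofFn, List.sum_ofFn,
      List.sum_ofFn]
    have : (∑ i, (a i : ℤ)) = ∑ j, (b j : ℤ) := by exact_mod_cast ha
    simp [this]
  · simp only [initialWord, List.map_append, List.map_map, Function.comp_def, List.sum_append, hI,
      hJ, hK]
    rw [← List.ofFn_eq_map, ← List.ofFn_eq_map, ← List.ofFn_eq_map, List.sum_ofFn, List.sum_ofFn,
      List.sum_ofFn]
    have : (∑ i, (a i : ℤ)) + ∑ j, (b j : ℤ) ≤ N := by exact_mod_cast hN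
    simpa using this

end Runs

/-! ### The operators `𝓔(I, J, K)` -/

section Operators

variable {m n s : ℕ}

instance : CharZero (FractionRing (MvPowerSeries (Fin s) ℚ)) :=
  algebraRat.charZero _

/-- The function `e^{t z_K}` in the field of fractions. -/
def expFrac (K : Finset (Fin s)) (t : ℚ) : FractionRing (MvPowerSeries (Fin s) ℚ) :=
  algebraMap (MvPowerSeries (Fin s) ℚ) _ (expSeries (t • zsum K))

theorem expFrac_add (K : Finset (Fin s)) (t u : ℚ) :
    expFrac K (t + u) = expFrac K t * expFrac K u := by
  rw [expFrac, expFrac, expFrac, ← map_mul, add_smul,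
    expSeries_add (constantCoeff_smul_eq_zero _ (constantCoeff_zsum K))
      (constantCoeff_smul_eq_zero _ (constantCoeff_zsum K))]

@[simp] theorem expFrac_zero (K : Finset (Fin s)) : expFrac K 0 = 1 := by
  rw [expFrac, zero_smul, expSeries_zero, map_one]

@[simp] theorem expFrac_empty (t : ℚ) : expFrac (∅ : Finset (Fin s)) t = 1 := by
  rw [expFrac, zsum_empty, smul_zero, expSeries_zero, map_one]

theorem expFrac_union {K L : Finset (Fin s)} (h : Disjoint K L) (t : ℚ) :
    expFrac (K ∪ L) t = expFrac K t * expFrac L t := by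
  rw [expFrac, expFrac, expFrac, ← map_mul, zsum_union h, smul_add,
    expSeries_add (constantCoeff_smul_eq_zero _ (constantCoeff_zsum K))
      (constantCoeff_smul_eq_zero _ (constantCoeff_zsum L))]

/-- The determinant is x z_L − y z_K, so its ζ is a difference of products of exponentials in z_K
and z_L, the shape in which brackets of weights appear. -/
theorem algebraMap_zeta_det (x y : ℤ) (K L : Finset (Fin s)) :
    algebraMap (MvPowerSeries (Fin s) ℚ) (FractionRing (MvPowerSeries (Fin s) ℚ))
      (zeta (Matrix.det !![((x : ℤ) : MvPowerSeries (Fin s) ℚ), zsum K;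
        ((y : ℤ) : MvPowerSeries (Fin s) ℚ), zsum L])) =
      expFrac L (x / 2) * expFrac K (-y / 2) - expFrac L (-x / 2) * expFrac K (y / 2) := by
  have h1 : Matrix.det !![((x : ℤ) : MvPowerSeries (Fin s) ℚ), zsum K;
      ((y : ℤ) : MvPowerSeries (Fin s) ℚ), zsum L] =
      (x : ℚ) • zsum L + (-y : ℚ) • zsum K := by
    rw [Matrix.det_fin_two_of, MvPowerSeries.smul_eq_C_mul, MvPowerSeries.smul_eq_C_mul,
      map_neg, map_intCast, map_intCast]
    ring
  have hL := constantCoeff_zsum L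
  have hK := constantCoeff_zsum K
  rw [h1, zeta_eq (by rw [map_add, constantCoeff_smul_eq_zero _ hL,
    constantCoeff_smul_eq_zero _ hK, add_zero]), map_sub, smul_add, smul_add, smul_smul, smul_smul,
    smul_smul, smul_smul, expSeries_add (constantCoeff_smul_eq_zero _ hL)
    (constantCoeff_smul_eq_zero _ hK), expSeries_add (constantCoeff_smul_eq_zero _ hL)
    (constantCoeff_smul_eq_zero _ hK), map_mul, map_mul]
  have e1 : (1 / 2 * x : ℚ) = x / 2 := by ring
  have e2 : (1 / 2 * -y : ℚ) = -y / 2 := by ring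
  have e3 : (-(1 / 2) * x : ℚ) = -x / 2 := by ring
  have e4 : (-(1 / 2) * -y : ℚ) = y / 2 := by ring
  rw [e1, e2, e3, e4]
  rfl

theorem algebraMap_zeta_zsum (K : Finset (Fin s)) :
    algebraMap (MvPowerSeries (Fin s) ℚ) (FractionRing (MvPowerSeries (Fin s) ℚ)) (zeta (zsum K)) =
      expFrac K (1 / 2) - expFrac K (-(1 / 2)) := by
  rw [zeta_eq (constantCoeff_zsum K), map_sub]
  rfl

theorem algebraMap_zeta_zsum_ne_zero {K : Finset (Fin s)} (hK : K ≠ ∅) :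
    algebraMap (MvPowerSeries (Fin s) ℚ) (FractionRing (MvPowerSeries (Fin s) ℚ)) (zeta (zsum K))
      ≠ 0 := by
  rw [Ne, FaithfulSMul.algebraMap_eq_zero_iff]
  exact zeta_ne_zero hK

/-- The weights of the operator `𝓔_e(z_K)` in the model with `N` variables. -/
def weight (N : ℕ) (e : ℤ) (K : Finset (Fin s)) (j : ℤ) :
    FractionRing (MvPowerSeries (Fin s) ℚ) :=
  -- The term e/2 gives the midpoint of the exponents j and j + e. Subtracting N − 1/2 sends the
  -- exponent of row i (from 0) to λ_i − (i + 1) + 1/2.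
  expFrac K (j + e / 2 - N + 1 / 2)

open Classical in
/-- The vacuum expectation of an operator of energy zero. For the operators `𝓔(∅, ∅, {k})` of the
initial word, the constant term is removed. -/
def vacuumValue (X : Op m n s) : FractionRing (MvPowerSeries (Fin s) ℚ) :=
  if ∃ k, X = ⟨∅, ∅, {k}⟩ then 0 else finalFactor X

/-- The operator `𝓔(I, J, K)`. -/
def opValue (N : ℕ) (a : Fin m → ℕ) (b : Fin n → ℕ) (X : Op m n s) :
    Module.End (FractionRing (MvPowerSeries (Fin s) ℚ))
      ((Fin N → ℤ) → FractionRing (MvPowerSeries (Fin s) ℚ)) :=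
  shiftOp (energy a b X) (weight N (energy a b X) X.K) +
    -- Normal ordering: the eigenvalue on the finite vacuum is removed and replaced by the
    -- prescribed expectation.
    (if energy a b X = 0 then vacuumValue X - ∑ i, weight N 0 X.K (rho N i) else 0) • 1

variable {N : ℕ} {a : Fin m → ℕ} {b : Fin n → ℕ}

theorem opValue_apply (X : Op m n s)
    (f : (Fin N → ℤ) → FractionRing (MvPowerSeries (Fin s) ℚ)) :
    opValue N a b X f = shiftOp (energy a b X) (weight N (energy a b X) X.K) f +
      (if energy a b X = 0 then vacuumValue X - ∑ i, weight N 0 X.K (rho N i) else 0) • f := rfl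

theorem IsFermionic.opValue {D : ℤ} {f : (Fin N → ℤ) → FractionRing (MvPowerSeries (Fin s) ℚ)}
    (hf : IsFermionic D f) (X : Op m n s) :
    IsFermionic (D - energy a b X) (opValue N a b X f) := by
  rw [opValue_apply]
  split_ifs with h
  · refine (hf.shiftOp _ _).add ?_
    rw [h, sub_zero]
    exact hf.smul _
  · rw [zero_smul, add_zero]
    exact hf.shiftOp _ _

theorem opValue_apply_rho {X : Op m n s} (hX : energy a b X = 0)
    (f : (Fin N → ℤ) → FractionRing (MvPowerSeries (Fin s) ℚ)) :
    opValue N a b X f (rho N) = vacuumValue X * f (rho N) := by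
  rw [opValue_apply, if_pos hX, hX, Pi.add_apply, shiftOp_zero_apply _ _ rho_nonneg, Pi.smul_apply,
    smul_eq_mul]
  ring

/-- The sum telescopes. In the limit of infinitely many variables only 1/ζ would remain; the
truncation leaves the boundary term e^{−N z_K}. -/
theorem zeta_mul_sum_weight (K : Finset (Fin s)) :
    (expFrac K (1 / 2) - expFrac K (-(1 / 2))) * ∑ i, weight N 0 K (rho N i) =
      1 - expFrac K (-N) := by
  have h : ∀ i : Fin N, (expFrac K (1 / 2) - expFrac K (-(1 / 2))) * weight N 0 K (rho N i) =
      expFrac K (-(i : ℕ)) - expFrac K (-((i : ℕ) + 1 : ℕ)) := by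
    intro i
    rw [weight, sub_mul, ← expFrac_add, ← expFrac_add, rho]
    congr 2 <;> push_cast <;> ring
  rw [Finset.mul_sum, Finset.sum_congr rfl fun i _ => h i,
    Fin.sum_univ_eq_sum_range (fun i => expFrac K (-(i : ℕ)) - expFrac K (-(i + 1 : ℕ))) N,
    Finset.sum_range_sub' (fun i => expFrac K (-(i : ℕ))) N]
  simp

/-- The same telescoping; the result carries the factor e^{−N z_K} that cancels the boundary term of
`zeta_mul_sum_weight`. -/
theorem zeta_mul_cocycle (K : Finset (Fin s)) {e : ℤ} (he : 0 ≤ e) :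
    (expFrac K (1 / 2) - expFrac K (-(1 / 2))) *
      ∑ j ∈ Finset.Ico 0 e, expFrac K (j - e / 2 - N + 1 / 2) =
      expFrac K (-N) * (expFrac K (e / 2) - expFrac K (-e / 2)) := by
  obtain ⟨t, rfl⟩ := Int.eq_ofNat_of_zero_le he
  have h1 : ∑ j ∈ Finset.Ico (0 : ℤ) (t : ℤ), expFrac K ((j : ℚ) - ((t : ℤ) : ℚ) / 2 - N + 1 / 2) =
      ∑ j ∈ Finset.range t, expFrac K ((j : ℚ) - (t : ℚ) / 2 - N + 1 / 2) := by
    symm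
    refine Finset.sum_nbij (fun j => (j : ℤ)) ?_ ?_ ?_ ?_
    · intro j hj
      have := Finset.mem_range.1 hj
      rw [Finset.mem_Ico]
      omega
    · intro i _ j _ h
      simpa using h
    · intro j hj
      have hj := Finset.mem_Ico.1 (Finset.mem_coe.1 hj)
      exact ⟨j.toNat, by simp; omega, by simp; omega⟩
    · intro j _
      simp
  have h2 : ∀ j : ℕ, (expFrac K (1 / 2) - expFrac K (-(1 / 2))) *
      expFrac K ((j : ℚ) - (t : ℚ) / 2 - N + 1 / 2) =
      expFrac K (((j + 1 : ℕ) : ℚ) - (t : ℚ) / 2 - N) - expFrac K ((j : ℚ) - (t : ℚ) / 2 - N) := by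
    intro j
    rw [sub_mul, ← expFrac_add, ← expFrac_add]
    congr 2 <;> push_cast <;> ring
  rw [h1, Finset.mul_sum, Finset.sum_congr rfl fun j _ => h2 j,
    Finset.sum_range_sub (fun j : ℕ => expFrac K ((j : ℚ) - (t : ℚ) / 2 - N)), mul_sub,
    ← expFrac_add, ← expFrac_add]
  congr 2 <;> push_cast <;> ring

theorem algebraMap_commutatorFactor_of_ne {X Y : Op m n s}
    (h : ¬ (X.K = ∅ ∧ Y.K = ∅ ∧ energy a b X + energy a b Y = 0)) :
    algebraMap (MvPowerSeries (Fin s) ℚ) (FractionRing (MvPowerSeries (Fin s) ℚ))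
      (commutatorFactor a b (X, Y)) =
      expFrac Y.K (energy a b X / 2) * expFrac X.K (-energy a b Y / 2) -
        expFrac Y.K (-energy a b X / 2) * expFrac X.K (energy a b Y / 2) := by
  rw [commutatorFactor, if_neg h]
  exact algebraMap_zeta_det _ _ _ _

/-- Relative to the midpoint exponent j + (x + y)/2, the K-factor is displaced by ∓y/2 and the
L-factor by ±x/2. This is the origin of ζ of the determinant. -/
theorem weight_bracket {K L : Finset (Fin s)} (h : Disjoint K L) (x y j : ℤ) :
    weight N x K j * weight N y L (j + x) - weight N y L j * weight N x K (j + y) =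
      (expFrac L (x / 2) * expFrac K (-y / 2) - expFrac L (-x / 2) * expFrac K (y / 2)) *
        weight N (x + y) (K ∪ L) j := by
  simp only [weight]
  rw [expFrac_union h, sub_mul]
  have h1 : ∀ t u v w : ℚ, expFrac L t * expFrac K u * (expFrac K v * expFrac L w) =
      expFrac K (v + u) * expFrac L (w + t) := by
    intro t u v w
    rw [expFrac_add, expFrac_add]; ring
  rw [h1, h1, mul_comm (expFrac L _) (expFrac K _)]
  congr 3 <;> push_cast <;> ring

theorem shiftOp_smul_weight (e : ℤ) (c : FractionRing (MvPowerSeries (Fin s) ℚ))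
    (w : ℤ → FractionRing (MvPowerSeries (Fin s) ℚ))
    (f : (Fin N → ℤ) → FractionRing (MvPowerSeries (Fin s) ℚ)) :
    shiftOp e (fun j => c * w j) f = c • shiftOp e w f := by
  ext k
  rw [Pi.smul_apply, shiftOp_apply, shiftOp_apply, Finset.smul_sum]
  refine Finset.sum_congr rfl fun i _ => ?_
  split_ifs
  · rw [smul_eq_mul, mul_assoc]
  · rw [smul_zero]

/-- All weights are 1, and all N coordinates in the support are nonnegative, so the operator counts
coordinates. -/
theorem IsFermionic.shiftOp_zero_one {D : ℤ}
    {f : (Fin N → ℤ) → FractionRing (MvPowerSeries (Fin s) ℚ)} (hf : IsFermionic D f) :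
    HurwitzCC.shiftOp 0 (weight N 0 ∅) f = (N : FractionRing (MvPowerSeries (Fin s) ℚ)) • f := by
  ext k
  rw [HurwitzCC.shiftOp_apply, Pi.smul_apply]
  simp only [weight, expFrac_empty, shift_zero, one_mul]
  by_cases hk : f k = 0
  · simp [hk]
  · simp [hf.nonneg hk]

/-- The commutation relation between the operators `𝓔(I, J, K)`. -/
theorem IsFermionic.opValue_comm {D : ℤ}
    {f : (Fin N → ℤ) → FractionRing (MvPowerSeries (Fin s) ℚ)} (hf : IsFermionic D f)
    {X Y : Op m n s} (hXY : X.IsDisjoint Y) (hX : 0 ≤ energy a b X) (hY : energy a b Y < 0)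
    (hD : -energy a b Y + D ≤ N) :
    HurwitzCC.opValue N a b X (HurwitzCC.opValue N a b Y f) =
      HurwitzCC.opValue N a b Y (HurwitzCC.opValue N a b X f) +
      algebraMap (MvPowerSeries (Fin s) ℚ) (FractionRing (MvPowerSeries (Fin s) ℚ))
        (commutatorFactor a b (X, Y)) • HurwitzCC.opValue N a b (X.union Y) f := by
  -- Negative energy forces a nonempty J. Thus the union is never one of the initial operators 𝓔(∅,
  -- ∅, {k}), whose constant was removed.
  have hYJ : Y.J ≠ ∅ := by
    intro h
    rw [energy, h, Finset.sum_empty, sub_zero] at hY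
    exact absurd hY (not_lt.2 (Finset.sum_nonneg fun _ _ => Int.natCast_nonneg _))
  have hvac : vacuumValue (X.union Y) = finalFactor (X.union Y) := by
    rw [vacuumValue, if_neg]
    rintro ⟨k, hk⟩
    have := congrArg Op.J hk
    simp only [Op.union, Finset.union_eq_empty] at this
    exact hYJ this.2
  simp only [opValue_apply, map_add, map_smul]
  rw [hf.shiftOp_comm hX hD, energy_union hXY, hvac]
  simp only [weight_bracket hXY.2.2, shiftOp_smul_weight]
  set x := energy a b X with hx
  set y := energy a b Y with hy
  rw [if_neg hY.ne, zero_smul, add_zero, zero_smul, add_zero, zero_smul, add_zero]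
  have huK : (X.union Y).K = X.K ∪ Y.K := rfl
  rw [huK]
  -- In the conventional case the weights are all 1, so their bracket vanishes and the cocycle is x.
  -- The union acts as N + (1 − N) = 1, in agreement with the factor x.
  by_cases hemp : X.K = ∅ ∧ Y.K = ∅ ∧ x + y = 0
  · have hfac : algebraMap (MvPowerSeries (Fin s) ℚ) (FractionRing (MvPowerSeries (Fin s) ℚ))
        (commutatorFactor a b (X, Y)) = x := by
      rw [commutatorFactor, if_pos hemp, map_intCast]
    obtain ⟨h1, h2, h3⟩ := hemp
    have hfin : finalFactor (X.union Y) = 1 := by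
      rw [finalFactor, if_pos (by rw [huK, h1, h2, Finset.empty_union])]
    rw [hfac, hfin, if_pos h3, if_pos h3, h1, h2, h3, Finset.empty_union, hf.shiftOp_zero_one]
    simp only [weight, expFrac_empty]
    have h4 : ((x.toNat : ℕ) : FractionRing (MvPowerSeries (Fin s) ℚ)) =
        ((x : ℤ) : FractionRing (MvPowerSeries (Fin s) ℚ)) := by
      conv_rhs => rw [← Int.toNat_of_nonneg hX]
      rw [Int.cast_natCast]
    ext k
    simp only [Pi.add_apply, Pi.smul_apply, smul_eq_mul, mul_one, sub_self, zero_mul, add_zero,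
      Finset.sum_const, Int.card_Ico, sub_zero, nsmul_eq_mul, h4, Finset.card_univ,
      Fintype.card_fin]
    ring
  · rw [algebraMap_commutatorFactor_of_ne hemp, smul_add, smul_smul, ← add_assoc]
    rw [← hx, ← hy]
    by_cases h3 : x + y = 0
    · have hK : X.K ∪ Y.K ≠ ∅ := by
        intro h
        rw [Finset.union_eq_empty] at h
        exact hemp ⟨h.1, h.2, h3⟩
      have hfin : finalFactor (X.union Y) =
          1 / (expFrac (X.K ∪ Y.K) (1 / 2) - expFrac (X.K ∪ Y.K) (-(1 / 2))) := by
        rw [finalFactor, if_neg (by rw [huK]; exact hK), algebraMap_zeta_zsum, huK]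
      have hne := algebraMap_zeta_zsum_ne_zero hK
      rw [algebraMap_zeta_zsum] at hne
      rw [if_pos h3, if_pos h3, hfin]
      have hyx : (y : ℚ) = -(x : ℚ) := by
        have : y = -x := by omega
        rw [this]; push_cast; ring
      have hS := zeta_mul_sum_weight (N := N) (X.K ∪ Y.K)
      have hC := zeta_mul_cocycle (N := N) (X.K ∪ Y.K) hX
      have hsum : ∑ j ∈ Finset.Ico 0 x, weight N y Y.K j * weight N x X.K (j + y) =
          ∑ j ∈ Finset.Ico 0 x, expFrac (X.K ∪ Y.K) (j - x / 2 - N + 1 / 2) := by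
        refine Finset.sum_congr rfl fun j _ => ?_
        rw [expFrac_union hXY.2.2, weight, weight, mul_comm]
        congr 2 <;> push_cast <;> rw [hyx] <;> ring
      have hdet : expFrac Y.K (x / 2) * expFrac X.K (-y / 2) -
          expFrac Y.K (-x / 2) * expFrac X.K (y / 2) =
          expFrac (X.K ∪ Y.K) (x / 2) - expFrac (X.K ∪ Y.K) (-x / 2) := by
        rw [expFrac_union hXY.2.2, expFrac_union hXY.2.2, hyx, neg_neg]
        ring
      -- The cocycle is the commutator factor times the constant in `opValue` of the union. After
      -- multiplication by ζ both sides are e^{−N z}(e^{xz/2} − e^{−xz/2}) with z = z_{K∪L}.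
      have key : ∑ j ∈ Finset.Ico 0 x, weight N y Y.K j * weight N x X.K (j + y) =
          (expFrac Y.K (x / 2) * expFrac X.K (-y / 2) -
            expFrac Y.K (-x / 2) * expFrac X.K (y / 2)) *
          (1 / (expFrac (X.K ∪ Y.K) (1 / 2) - expFrac (X.K ∪ Y.K) (-(1 / 2))) -
            ∑ i, weight N 0 (X.K ∪ Y.K) (rho N i)) := by
        rw [hsum, hdet]
        apply mul_left_cancel₀ hne
        have hinv := mul_one_div_cancel hne
        rw [hC]
        linear_combination (expFrac (X.K ∪ Y.K) (x / 2) - expFrac (X.K ∪ Y.K) (-x / 2)) *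
          (hS - hinv)
      rw [key]
      abel
    -- The union has nonzero energy, so neither a cocycle nor a constant is present.
    · rw [if_neg h3, if_neg h3]
      simp only [zero_smul, mul_zero, add_zero]
      abel

/-! ### Words of operators -/

variable (N a b) in
/-- The product of the operators of a word applied to the vacuum. -/
def wordState (w : List (Op m n s)) : (Fin N → ℤ) → FractionRing (MvPowerSeries (Fin s) ℚ) :=
  w.foldr (fun X f => opValue N a b X f) (vacuum N _)

theorem isFermionic_wordState (w : List (Op m n s)) :
    IsFermionic (-(w.map (energy a b)).sum) (wordState N a b w) := by
  induction w with
  | nil => simpa [wordState] using isFermionic_vacuum N _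
  | cons X t ih =>
    have := ih.opValue (a := a) (b := b) X
    rw [List.map_cons, List.sum_cons, neg_add_rev]
    exact this

theorem wordState_append_congr {c : FractionRing (MvPowerSeries (Fin s) ℚ)}
    {t u v : List (Op m n s)} (h : wordState N a b t = wordState N a b u + c • wordState N a b v)
    (pre : List (Op m n s)) : wordState N a b (pre ++ t) =
      wordState N a b (pre ++ u) + c • wordState N a b (pre ++ v) := by
  induction pre with
  | nil => exact h
  | cons X p ih =>
    have h1 : ∀ w, wordState N a b (X :: w) = opValue N a b X (wordState N a b w) := fun _ => rfl
    rw [List.cons_append, List.cons_append, List.cons_append, h1, h1, h1, ih, map_add, map_smul]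

theorem neg_sum_le_sum_abs (w : List (Op m n s)) :
    -(w.map (energy a b)).sum ≤ (w.map fun X => |energy a b X|).sum := by
  induction w with
  | nil => simp
  | cons X t ih =>
    have := neg_abs_le (energy a b X)
    simp only [List.map_cons, List.sum_cons]
    linarith

theorem sum_abs_nonneg (w : List (Op m n s)) : 0 ≤ (w.map fun X => |energy a b X|).sum :=
  List.sum_nonneg fun x hx => by
    obtain ⟨X, _, rfl⟩ := List.mem_map.1 hx
    exact abs_nonneg _

/-- The state of `post` has degree bound minus its total energy. Adding −energy Y stays below the
total absolute energy, hence below N. -/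
theorem wordState_step {pre post : List (Op m n s)} {X Y : Op m n s}
    (hw : IsBalanced a b N (pre ++ X :: Y :: post)) (hX : 0 ≤ energy a b X)
    (hY : energy a b Y < 0) :
    wordState N a b (pre ++ X :: Y :: post) = wordState N a b (pre ++ Y :: X :: post) +
      algebraMap (MvPowerSeries (Fin s) ℚ) (FractionRing (MvPowerSeries (Fin s) ℚ))
        (commutatorFactor a b (X, Y)) • wordState N a b (pre ++ X.union Y :: post) := by
  refine wordState_append_congr ?_ pre
  refine (isFermionic_wordState post).opValue_comm hw.isDisjoint hX hY ?_
  have h1 := hw.sum_abs_energy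
  simp only [List.map_append, List.map_cons, List.sum_append, List.sum_cons] at h1
  have h2 := sum_abs_nonneg (a := a) (b := b) pre
  have h3 := neg_sum_le_sum_abs (a := a) (b := b) post
  have h4 := neg_abs_le (energy a b Y)
  have h5 := abs_nonneg (energy a b X)
  linarith

/-- The sum over all runs computes the vacuum expectation of the initial word. -/
theorem exists_sum_runs (w : List (Op m n s)) (hw : IsBalanced a b N w) :
    ∃ S : Finset (List (Op m n s × Op m n s)), (∀ P, P ∈ S ↔ ∃ T, Run a b w P T) ∧
      ∑ P ∈ S, runValue a b vacuumValue (fun c => algebraMap (MvPowerSeries (Fin s) ℚ)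
        (FractionRing (MvPowerSeries (Fin s) ℚ)) (commutatorFactor a b c)) w P =
        wordState N a b w (rho N) := by
  refine exists_sum_runValue N vacuumValue _ (fun w => wordState N a b w (rho N)) ?_ ?_ ?_ w hw
  · intro w hw
    induction w with
    | nil => simp [wordState, vacuum_rho]
    | cons X t ih =>
      have h1 : wordState N a b (X :: t) = opValue N a b X (wordState N a b t) := rfl
      rw [h1, opValue_apply_rho (hw X (by simp)), ih fun Z hZ => hw Z (by simp [hZ])]
      simp
  · intro Y post hw hY
    have h1 : wordState N a b (Y :: post) = opValue N a b Y (wordState N a b post) := rfl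
    have h2 := (isFermionic_wordState (N := N) (a := a) (b := b) post)
    -- Total energy zero makes the rest of the word have positive energy, so its state lies below
    -- the vacuum degree.
    have h3 : -(post.map (energy a b)).sum < 0 := by
      have := hw.sum_energy
      simp only [List.map_cons, List.sum_cons] at this
      linarith
    simp only [h1, h2.eq_zero h3, map_zero, Pi.zero_apply]
  · intro pre X Y post hw hX hY
    simp only [wordState_step hw hX hY, Pi.add_apply, Pi.smul_apply, smul_eq_mul]

/-- Giving the value 0 to 𝓔(∅, ∅, {k}) kills the runs in which one of these is left over. The other
runs that are not patterns contribute 0 anyway, so all runs may be summed. -/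
theorem sum_commutationPatterns (hw : IsBalanced a b N (initialWord m n s)) :
    ∑ P ∈ commutationPatterns s a b, ((finalOperators a b P).map finalFactor).prod *
      (P.map fun c => algebraMap (MvPowerSeries (Fin s) ℚ)
        (FractionRing (MvPowerSeries (Fin s) ℚ)) (commutatorFactor a b c)).prod =
      wordState N a b (initialWord m n s) (rho N) := by
  classical
  obtain ⟨S, hS, hV⟩ := exists_sum_runs (initialWord m n s) hw
  rw [← hV]
  have hsub : commutationPatterns s a b ⊆ S := by
    intro P hP
    rw [commutationPatterns, Set.Finite.mem_toFinset] at hP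
    exact (hS P).2 hP.1
  have hval : ∀ P, (∃ T, Run a b (initialWord m n s) P T) →
      runValue a b vacuumValue (fun c => algebraMap (MvPowerSeries (Fin s) ℚ)
        (FractionRing (MvPowerSeries (Fin s) ℚ)) (commutatorFactor a b c)) (initialWord m n s) P =
      if ∀ k, (⟨∅, ∅, {k}⟩ : Op m n s) ∉ finalOperators a b P then contribution a b P else 0 := by
    intro P hP
    have h1 : finalOperators a b P = hP.choose := by rw [finalOperators, dif_pos hP]
    rw [hP.choose_spec.runValue_eq, ← h1]
    split_ifs with h
    · rw [contribution]
      congr 2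
      refine List.map_congr_left fun X hX => ?_
      rw [vacuumValue, if_neg]
      rintro ⟨k, rfl⟩
      exact h k hX
    · push Not at h
      obtain ⟨k, hk⟩ := h
      rw [List.prod_eq_zero, zero_mul]
      exact List.mem_map.2 ⟨_, hk, by rw [vacuumValue, if_pos ⟨k, rfl⟩]⟩
  refine Finset.sum_subset_zero_on_sdiff hsub ?_ ?_
  · intro P hP
    rw [Finset.mem_sdiff, commutationPatterns, Set.Finite.mem_toFinset] at hP
    rw [hval P ((hS P).1 hP.1)]
    split_ifs with h
    · by_contra h0
      exact hP.2 ⟨(hS P).1 hP.1, h, h0⟩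
    · rfl
  · intro P hP
    have hP' := hP
    rw [commutationPatterns, Set.Finite.mem_toFinset] at hP'
    rw [hval P hP'.1, if_pos hP'.2.1]
    rfl

end Operators

/-! ### Partitions and strictly decreasing sequences -/

section Partitions

variable {d : ℕ}

/-- The parts of a partition, continued by zeros. -/
def partExt (lam : Nat.Partition d) (i : ℕ) : ℕ := (rows lam).getD i 0

theorem partExt_of_lt (lam : Nat.Partition d) (i : Fin (len lam)) :
    partExt lam i = part lam i := by
  simp [partExt, part]

theorem partExt_of_ge (lam : Nat.Partition d) {i : ℕ} (hi : len lam ≤ i) : partExt lam i = 0 :=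
  List.getD_eq_default _ _ hi

theorem pos_of_mem_rows {lam : Nat.Partition d} {p : ℕ} (hp : p ∈ rows lam) : 0 < p := by
  rw [rows, Multiset.mem_sort] at hp
  exact lam.parts_pos hp

theorem part_pos (lam : Nat.Partition d) (i : Fin (len lam)) : 0 < part lam i :=
  pos_of_mem_rows (List.get_mem _ _)

theorem ofFn_part (lam : Nat.Partition d) : List.ofFn (part lam) = rows lam :=
  List.ofFn_get (rows lam)

theorem sum_rows (lam : Nat.Partition d) : (rows lam).sum = d := by
  rw [← ofFn_part, List.sum_ofFn, sum_part]

theorem len_le (lam : Nat.Partition d) : len lam ≤ d := by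
  conv_rhs => rw [← sum_rows lam]
  exact List.length_le_sum_of_one_le _ fun p hp => pos_of_mem_rows hp

theorem pairwise_rows (lam : Nat.Partition d) : (rows lam).Pairwise (· ≥ ·) :=
  Multiset.pairwise_sort _ _

theorem part_antitone (lam : Nat.Partition d) : Antitone (part lam) := by
  intro i j hij
  rcases hij.eq_or_lt with rfl | h
  · exact le_rfl
  · exact List.pairwise_iff_get.1 (pairwise_rows lam) i j h

theorem partExt_antitone (lam : Nat.Partition d) : Antitone (partExt lam) := by
  intro i j hij
  rcases lt_or_ge j (len lam) with h | h
  · have := part_antitone lam (a := ⟨i, hij.trans_lt h⟩) (b := ⟨j, h⟩) hij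
    rw [← partExt_of_lt, ← partExt_of_lt] at this
    exact this
  · rw [partExt_of_ge lam h]
    exact Nat.zero_le _

theorem partition_ext {lam lam' : Nat.Partition d} (h : ∀ i, partExt lam i = partExt lam' i) :
    lam = lam' := by
  have hlen : ∀ {p q : Nat.Partition d}, (∀ i, partExt p i = partExt q i) → len p ≤ len q := by
    intro p q hpq
    by_contra hlt
    rw [not_le] at hlt
    have h1 := hpq (len q)
    rw [partExt_of_ge q le_rfl] at h1
    have h2 := partExt_of_lt p ⟨len q, hlt⟩
    have h3 := part_pos p ⟨len q, hlt⟩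
    simp only at h2
    omega
  have hr : rows lam = rows lam' := by
    refine List.ext_getElem (le_antisymm (hlen h) (hlen fun i => (h i).symm)) fun i h1 h2 => ?_
    have := h i
    rwa [partExt, partExt, List.getD_eq_getElem _ _ h1, List.getD_eq_getElem _ _ h2] at this
  apply Nat.Partition.ext
  rw [← Multiset.sort_eq lam.parts (· ≥ ·), ← Multiset.sort_eq lam'.parts (· ≥ ·)]
  exact congrArg _ hr

theorem getD_filter_ne_zero (L : List ℕ) (hL : L.Pairwise (· ≥ ·)) (i : ℕ) :
    (L.filter (· ≠ 0)).getD i 0 = L.getD i 0 := by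
  induction L generalizing i with
  | nil => rfl
  | cons p t ih =>
    rw [List.pairwise_cons] at hL
    by_cases hp : p = 0
    · have h0 : ∀ q ∈ p :: t, q = 0 := by
        intro q hq
        rcases List.mem_cons.1 hq with rfl | hq
        · exact hp
        · have := hL.1 q hq
          omega
      have h1 : (p :: t).filter (· ≠ 0) = [] := by
        rw [List.filter_eq_nil_iff]
        intro q hq
        simp [h0 q hq]
      rw [h1]
      rcases lt_or_ge i (p :: t).length with h | h
      · rw [List.getD_eq_getElem _ _ h, h0 _ (List.getElem_mem h)]
        rfl
      · rw [List.getD_eq_default _ _ h]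
        rfl
    · rw [List.filter_cons_of_pos (by simpa using hp)]
      cases i with
      | zero => rfl
      | succ i => simpa using ih hL.2 i

/-- The strictly decreasing sequence of exponents that corresponds to a partition. -/
def exponents (N : ℕ) (lam : Nat.Partition d) (i : Fin N) : ℤ := partExt lam i + rho N i

theorem exponents_nonneg (N : ℕ) (lam : Nat.Partition d) (i : Fin N) :
    0 ≤ exponents N lam i := by
  have := rho_nonneg i
  unfold exponents
  omega

theorem exponents_strictAnti (N : ℕ) (lam : Nat.Partition d) : StrictAnti (exponents N lam) := by
  intro i j hij
  have h1 := partExt_antitone lam (Fin.le_def.1 hij.le)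
  have h2 := Fin.lt_def.1 hij
  unfold exponents rho
  omega

/-- A strictly monotone map on `Fin N` is determined by its range, and a permutation does not change
the range. -/
theorem eq_of_strictAnti_comp {N : ℕ} {k : Fin N → ℤ} {σ τ : Equiv.Perm (Fin N)}
    (hσ : StrictAnti (k ∘ σ)) (hτ : StrictAnti (k ∘ τ)) : k ∘ σ = k ∘ τ := by
  have h1 : StrictMono (fun i => -(k ∘ σ) i) := hσ.neg
  have h2 : StrictMono (fun i => -(k ∘ τ) i) := hτ.neg
  have h3 : (fun i => -(k ∘ σ) i) = fun i => -(k ∘ τ) i := by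
    rw [← StrictMono.range_inj h1 h2]
    ext x
    constructor
    · rintro ⟨i, rfl⟩
      exact ⟨τ.symm (σ i), by simp⟩
    · rintro ⟨i, rfl⟩
      exact ⟨σ.symm (τ i), by simp⟩
  ext i
  have := congrFun h3 i
  simpa using this

theorem antitone_sub_rho {N : ℕ} {k : Fin N → ℤ} (hk : StrictAnti k) :
    Antitone (fun i => k i - rho N i) := by
  cases N with
  | zero => intro i; exact i.elim0
  | succ M =>
    rw [Fin.antitone_iff_succ_le]
    intro i
    have h1 := hk (Fin.castSucc_lt_succ (i := i))
    simp only [rho, Fin.val_succ, Fin.val_castSucc]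
    push_cast
    omega

/-- Subtracting the staircase `rho` from k leaves a weakly decreasing sequence of sum d. It is
nonnegative because its last entry is that of k. -/
theorem exists_partition_of_strictAnti {N : ℕ} {k : Fin N → ℤ} (hk : StrictAnti k)
    (h0 : ∀ i, 0 ≤ k i) (hd : ∑ i, k i = ∑ i : Fin N, (i : ℤ) + d) :
    ∃ lam : Nat.Partition d, exponents N lam = k := by
  have hanti := antitone_sub_rho hk
  have hnn : ∀ i, 0 ≤ k i - rho N i := by
    intro i
    have hN : 0 < N := i.pos
    have h1 := hanti (show i ≤ ⟨N - 1, by omega⟩ from Fin.le_def.2 (by simp only; omega))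
    have h2 := h0 ⟨N - 1, by omega⟩
    simp only [rho] at h1 ⊢
    omega
  set l : Fin N → ℕ := fun i => (k i - rho N i).toNat with hl
  have hl' : ∀ i, (l i : ℤ) = k i - rho N i := fun i => Int.toNat_of_nonneg (hnn i)
  have hlanti : Antitone l := fun i j hij => Int.toNat_le_toNat (hanti hij)
  have hsum : ((List.ofFn l : List ℕ) : Multiset ℕ).sum = d := by
    rw [Multiset.sum_coe, List.sum_ofFn]
    have : (∑ i, (l i : ℤ)) = d := by
      simp only [hl', Finset.sum_sub_distrib, hd, sum_rho]
      ring
    exact_mod_cast this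
  have hpair : (List.ofFn l).Pairwise (· ≥ ·) := by
    rw [List.pairwise_ofFn]
    exact fun i j hij => hlanti hij.le
  refine ⟨Nat.Partition.ofSums d _ hsum, ?_⟩
  have hrows : rows (Nat.Partition.ofSums d _ hsum) = (List.ofFn l).filter (· ≠ 0) := by
    rw [rows, Nat.Partition.ofSums_parts, Multiset.filter_coe, Multiset.coe_sort]
    exact List.mergeSort_eq_self _ (hpair.filter _)
  ext i
  rw [exponents, partExt, hrows, getD_filter_ne_zero _ hpair, List.getD_eq_getElem _ _ (by simp),
    List.getElem_ofFn, hl']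
  simp

/-- Each point with distinct nonnegative coordinates and the right sum is a permutation of the
exponents of exactly one partition. -/
theorem sum_exponents_eq_one {N : ℕ} (hN : d ≤ N) {R : Type*} [CommRing R] {k : Fin N → ℤ}
    (hk : Function.Injective k) (h0 : ∀ i, 0 ≤ k i)
    (hd : ∑ i, k i = ∑ i : Fin N, (i : ℤ) + d) :
    ∑ lam : Nat.Partition d, ∑ σ : Equiv.Perm (Fin N),
      (if exponents N lam = k ∘ σ then (1 : R) else 0) = 1 := by
  have hsort : ∃ σ : Equiv.Perm (Fin N), StrictAnti (k ∘ σ) := by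
    refine ⟨Tuple.sort (fun i => -k i), ?_⟩
    have h1 := Tuple.monotone_sort (fun i => -k i)
    have h2 : StrictMono ((fun i => -k i) ∘ Tuple.sort (fun i => -k i)) :=
      h1.strictMono_of_injective fun i j h => by simpa [hk.eq_iff] using h
    intro i j hij
    have := h2 hij
    simpa using this
  obtain ⟨σ, hσ⟩ := hsort
  obtain ⟨lam, hlam⟩ := exists_partition_of_strictAnti hσ (fun i => h0 (σ i))
    (by rw [← hd]; exact Equiv.sum_comp σ k)
  rw [Finset.sum_eq_single lam, Finset.sum_eq_single σ, if_pos hlam]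
  · intro τ _ hτ
    rw [if_neg]
    intro h
    apply hτ
    rw [hlam] at h
    ext i : 1
    exact hk (congrFun h i).symm
  · exact fun h => absurd (Finset.mem_univ _) h
  · intro lam' _ hne
    refine Finset.sum_eq_zero fun τ _ => if_neg fun h => hne ?_
    have h1 : exponents N lam' = exponents N lam := by
      rw [hlam, h]
      exact eq_of_strictAnti_comp (h ▸ exponents_strictAnti N lam') hσ
    apply partition_ext
    intro i
    rcases lt_or_ge i N with hi | hi
    · have := congrFun h1 ⟨i, hi⟩
      simpa [exponents] using this
    · rw [partExt_of_ge _ ((len_le _).trans (hN.trans hi)),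
        partExt_of_ge _ ((len_le _).trans (hN.trans hi))]
  · exact fun h => absurd (Finset.mem_univ _) h

end Partitions

/-! ### Products of power sums -/

section PowerSums

variable {N : ℕ} {R : Type*} [CommRing R]

/-- The sum of the values of `F` at the exponents of the monomials of `∏_{p ∈ L} ∑_i x_i ^ p`. -/
def psumEval {N : ℕ} {R : Type*} [CommRing R] : List ℕ → ((Fin N → ℤ) → R) → R
  | [], F => F 0
  | p :: L, F => ∑ i, psumEval L fun v => F (shift v i p)

theorem psumEval_congr (L : List ℕ) {F G : (Fin N → ℤ) → R}
    (h : ∀ v, (∀ i, 0 ≤ v i) → ∑ i, v i = ((L.sum : ℕ) : ℤ) → F v = G v) :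
    psumEval L F = psumEval L G := by
  induction L generalizing F G with
  | nil => exact h 0 (by simp) (by simp)
  | cons p L ih =>
    refine Finset.sum_congr rfl fun i _ => ih fun v hv hs => h _ ?_ ?_
    · intro j
      by_cases hj : j = i
      · subst hj; rw [shift_same]; have := hv j; omega
      · rw [shift_ne _ hj]; exact hv j
    · rw [sum_shift, hs, List.sum_cons]; push_cast; ring

theorem psumEval_sum {ι : Type*} (s : Finset ι) (L : List ℕ) (F : ι → (Fin N → ℤ) → R) :
    psumEval L (fun v => ∑ t ∈ s, F t v) = ∑ t ∈ s, psumEval L (F t) := by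
  induction L generalizing F with
  | nil => rfl
  | cons p L ih =>
    simp only [psumEval]
    rw [Finset.sum_comm]
    exact Finset.sum_congr rfl fun i _ => ih _

theorem psumEval_mul (L : List ℕ) (F : (Fin N → ℤ) → R) (c : R) :
    psumEval L (fun v => F v * c) = psumEval L F * c := by
  induction L generalizing F with
  | nil => rfl
  | cons p L ih =>
    simp only [psumEval, ih, Finset.sum_mul]

theorem psumEval_map {S : Type*} [CommRing S] (φ : R →+* S) (L : List ℕ) (F : (Fin N → ℤ) → R) :
    psumEval L (fun v => φ (F v)) = φ (psumEval L F) := by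
  induction L generalizing F with
  | nil => rfl
  | cons p L ih => simp only [psumEval, ih, map_sum]

theorem psumEval_comp (L : List ℕ) (F : (Fin N → ℤ) → R) (σ : Equiv.Perm (Fin N)) :
    psumEval L (fun v => F (v ∘ σ)) = psumEval L F := by
  induction L generalizing F with
  | nil => rfl
  | cons p L ih =>
    simp only [psumEval]
    refine Fintype.sum_equiv σ⁻¹ _ _ fun i => ?_
    refine Eq.trans ?_ (ih _)
    congr 1
    ext v
    rw [shift_comp]
    simp

theorem psumEval_perm {L L' : List ℕ} (h : L.Perm L') (F : (Fin N → ℤ) → R) :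
    psumEval L F = psumEval L' F := by
  induction h generalizing F with
  | nil => rfl
  | cons p _ ih => exact Finset.sum_congr rfl fun i _ => ih _
  | swap p q L =>
    simp only [psumEval]
    rw [Finset.sum_comm]
    refine Finset.sum_congr rfl fun i _ => Finset.sum_congr rfl fun j _ => ?_
    congr 1
    ext v
    by_cases hij : i = j
    · subst hij; rw [shift_shift, shift_shift, add_comm]
    · rw [shift_comm _ hij]
  | trans _ _ ih₁ ih₂ => rw [ih₁, ih₂]

theorem psumEval_ofFn {n : ℕ} (p : Fin n → ℕ) (F : (Fin N → ℤ) → R) :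
    psumEval (List.ofFn p) F =
      ∑ c : Fin n → Fin N, F fun i => ∑ t, if c t = i then (p t : ℤ) else 0 := by
  induction n generalizing F with
  | zero =>
    rw [List.ofFn_zero, psumEval, Fintype.sum_unique]
    simp only [Finset.univ_eq_empty, Finset.sum_empty]
    rfl
  | succ n ih =>
    rw [List.ofFn_succ, psumEval, ← (Fin.consEquiv fun _ => Fin N).sum_comp,
      Fintype.sum_prod_type]
    refine Finset.sum_congr rfl fun i _ => ?_
    rw [ih]
    refine Finset.sum_congr rfl fun c _ => ?_
    congr 1
    ext j
    rw [Fin.sum_univ_succ]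
    simp only [Fin.consEquiv_apply, Fin.cons_zero, Fin.cons_succ]
    by_cases hj : j = i
    · subst hj
      rw [shift_same, if_pos rfl, add_comm]
    · rw [shift_ne _ hj, if_neg (Ne.symm hj), zero_add]

/-- The product of the operators `α_p`, `p ∈ L`. -/
def annihilate (L : List ℕ) (f : (Fin N → ℤ) → R) : (Fin N → ℤ) → R :=
  L.foldr (fun (p : ℕ) f => shiftOp (p : ℤ) 1 f) f

variable (N R) in
/-- The product of the operators `α_{-p}`, `p ∈ L`, applied to the vacuum. -/
def create (L : List ℕ) : (Fin N → ℤ) → R :=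
  L.foldr (fun (p : ℕ) f => shiftOp (-(p : ℤ)) 1 f) (vacuum N R)

theorem isFermionic_create (L : List ℕ) : IsFermionic (L.sum : ℕ) (create N R L) := by
  induction L with
  | nil => simpa [create] using isFermionic_vacuum N R
  | cons p L ih =>
    have := ih.shiftOp (-(p : ℤ)) 1
    rw [sub_neg_eq_add] at this
    rw [List.sum_cons, Nat.cast_add, add_comm]
    exact this

/-- Shifts by p ≥ 0 keep nonnegative coordinates nonnegative, so the cutoff never acts. -/
theorem annihilate_apply (L : List ℕ) (f : (Fin N → ℤ) → R) {k : Fin N → ℤ} (hk : ∀ i, 0 ≤ k i) :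
    annihilate L f k = psumEval L fun v => f (k + v) := by
  induction L generalizing k with
  | nil => simp [annihilate, psumEval]
  | cons p L ih =>
    have h1 : annihilate (p :: L) f = shiftOp (p : ℤ) 1 (annihilate L f) := rfl
    rw [h1, shiftOp_apply, psumEval]
    refine Finset.sum_congr rfl fun i _ => ?_
    rw [if_pos (hk i), Pi.one_apply, one_mul, ih]
    · congr 1
      ext v
      congr 1
      ext j
      by_cases hj : j = i
      · subst hj; simp; ring
      · simp [shift_ne _ hj]
    · intro j
      by_cases hj : j = i
      · subst hj; rw [shift_same]; have := hk j; omega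
      · rw [shift_ne _ hj]; exact hk j

theorem create_apply (L : List ℕ) (k : Fin N → ℤ) :
    create N R L k = psumEval L fun v => vacuum N R (k - v) := by
  induction L generalizing k with
  | nil => simp [create, psumEval]
  | cons p L ih =>
    have h1 : create N R (p :: L) = shiftOp (-(p : ℤ)) 1 (create N R L) := rfl
    rw [h1, shiftOp_apply, psumEval]
    refine Finset.sum_congr rfl fun i _ => ?_
    -- The cutoff may be dropped: where it acts, the shifted point has a negative coordinate and the
    -- state vanishes there.
    have h2 : (if 0 ≤ k i then (1 : ℤ → R) (k i) * create N R L (shift k i (-(p : ℤ))) else 0) =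
        create N R L (shift k i (-(p : ℤ))) := by
      split_ifs with h
      · simp
      · by_contra hne
        have := (isFermionic_create L).nonneg (Ne.symm hne) i
        rw [shift_same] at this
        omega
    rw [h2, ih]
    congr 1
    ext v
    congr 1
    ext j
    by_cases hj : j = i
    · subst hj; simp; ring
    · simp [shift_ne _ hj]

theorem vacuum_map {S : Type*} [CommRing S] (φ : R →+* S) (k : Fin N → ℤ) :
    φ (vacuum N R k) = vacuum N S k := by
  rw [vacuum, vacuum, map_sum]
  refine Finset.sum_congr rfl fun σ _ => ?_
  split_ifs <;> simp

/-- The matrix elements are integers in every coefficient ring, which links the characters over ℚ to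
states over the field of fractions. -/
theorem create_map {S : Type*} [CommRing S] (φ : R →+* S) (L : List ℕ) (k : Fin N → ℤ) :
    φ (create N R L k) = create N S L k := by
  rw [create_apply, create_apply, ← psumEval_map]
  simp only [vacuum_map]

theorem create_perm {L L' : List ℕ} (h : L.Perm L') : create N R L = create N R L' := by
  ext k
  rw [create_apply, create_apply, psumEval_perm h]

/-- The annihilation operators are adjoint to the creation operators. -/
theorem IsFermionic.annihilate_rho [IsDomain R] [CharZero R] {d : ℕ} (hN : d ≤ N) {D : ℤ}
    {f : (Fin N → ℤ) → R} (hf : IsFermionic D f) {L : List ℕ} (hL : L.sum = d) :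
    annihilate L f (rho N) = ∑ lam : Nat.Partition d,
      create N R L (exponents N lam) * f (exponents N lam) := by
  rw [annihilate_apply L f rho_nonneg]
  simp only [create_apply, ← psumEval_mul]
  rw [← psumEval_sum]
  have h1 : ∀ v : Fin N → ℤ, ∑ lam : Nat.Partition d,
      vacuum N R (exponents N lam - v) * f (exponents N lam) =
      ∑ σ : Equiv.Perm (Fin N), ∑ lam : Nat.Partition d,
        if exponents N lam = v + rho N ∘ σ then
          ((Equiv.Perm.sign σ : ℤ) : R) * f (v + rho N ∘ σ) else 0 := by
    intro v
    rw [Finset.sum_comm]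
    refine Finset.sum_congr rfl fun lam _ => ?_
    rw [vacuum, Finset.sum_mul]
    refine Finset.sum_congr rfl fun σ _ => ?_
    simp only [sub_eq_iff_eq_add']
    split_ifs with h
    · rw [h]
    · rw [zero_mul]
  simp only [h1]
  rw [psumEval_sum]
  -- Products of power sums are symmetric, so v may be permuted by σ. The antisymmetry of f then
  -- cancels the sign of σ.
  have h2 : ∀ σ : Equiv.Perm (Fin N), psumEval L (fun v => ∑ lam : Nat.Partition d,
      if exponents N lam = v + rho N ∘ σ then
        ((Equiv.Perm.sign σ : ℤ) : R) * f (v + rho N ∘ σ) else 0) =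
      psumEval L fun v => (∑ lam : Nat.Partition d,
        if exponents N lam = (rho N + v) ∘ σ then (1 : R) else 0) * f (rho N + v) := by
    intro σ
    rw [← psumEval_comp L _ σ]
    congr 1
    ext v
    have h3 : v ∘ σ + rho N ∘ σ = (rho N + v) ∘ σ := by
      ext i; simp [add_comm]
    simp only [h3, hf.antisymm, Finset.sum_mul]
    refine Finset.sum_congr rfl fun lam _ => ?_
    rw [← mul_assoc]
    rcases Int.units_eq_one_or (Equiv.Perm.sign σ) with h | h <;> simp [h]
  rw [Finset.sum_congr rfl fun σ _ => h2 σ, ← psumEval_sum]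
  refine psumEval_congr L fun v hv hs => ?_
  rw [← Finset.sum_mul, Finset.sum_comm]
  -- On the support of f the exponents are distinct, so exactly one pair (λ, σ) sorts them.
  by_cases h0 : f (rho N + v) = 0
  · rw [h0, mul_zero]
  · rw [sum_exponents_eq_one hN (hf.injective h0) (hf.nonneg h0), one_mul]
    simp only [Pi.add_apply, Finset.sum_add_distrib, hs, sum_rho, hL]

end PowerSums

/-! ### The vacuum expectation of the initial word -/

section InitialWord

variable {d : ℕ}

/-- The generating series of the shifted symmetric power sums of `λ`. -/
def contentSeries (N : ℕ) (lam : Nat.Partition d) : PowerSeries ℚ :=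
  ∑ i : Fin N, (PowerSeries.rescale ((partExt lam i : ℚ) - ((i : ℕ) + 1 : ℚ) + 1 / 2)
    (PowerSeries.exp ℚ) - PowerSeries.rescale (-((i : ℕ) + 1 : ℚ) + 1 / 2) (PowerSeries.exp ℚ))

theorem coeff_contentSeries {N : ℕ} (hN : d ≤ N) (lam : Nat.Partition d) (p : ℕ) :
    PowerSeries.coeff p (contentSeries N lam) = shiftedPowerSum p lam / (p.factorial : ℚ) := by
  rw [contentSeries, map_sum, shiftedPowerSum, Finset.sum_div]
  simp only [map_sub, PowerSeries.coeff_rescale, PowerSeries.coeff_exp]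
  have hlen : len lam ≤ N := (len_le lam).trans hN
  set F : ℕ → ℚ := fun i => (((partExt lam i : ℚ) - ((i : ℕ) + 1 : ℚ) + 1 / 2) ^ p -
    (-((i : ℕ) + 1 : ℚ) + 1 / 2) ^ p) / (p.factorial : ℚ) with hF
  have h1 : ∑ i : Fin N, F i = ∑ i : Fin (len lam), F i := by
    rw [Fin.sum_univ_eq_sum_range F N, Fin.sum_univ_eq_sum_range F (len lam)]
    symm
    refine Finset.sum_subset (Finset.range_mono hlen) fun i _ hi => ?_
    rw [Finset.mem_range, not_lt] at hi
    simp only [hF, partExt_of_ge lam hi]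
    simp
  refine Eq.trans (Finset.sum_congr rfl fun i _ => ?_)
    (h1.trans (Finset.sum_congr rfl fun i _ => ?_))
  · simp only [hF, eq_ratCast, Rat.cast_id]
    ring
  · simp only [hF, partExt_of_lt]

variable {s m n N : ℕ}

theorem expFrac_singleton (k : Fin s) (t : ℚ) : expFrac {k} t =
    algebraMap (MvPowerSeries (Fin s) ℚ) _ ((PowerSeries.rescale t (PowerSeries.exp ℚ)).subst
      (MvPowerSeries.X k : MvPowerSeries (Fin s) ℚ)) := by
  rw [expFrac, subst_rescale_exp _ (by simp), zsum, Finset.sum_singleton]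

/-- Removing the eigenvalue of the finite vacuum is precisely the subtraction of (−i + 1/2)^k in
p_k(λ). -/
theorem sum_weight_exponents (lam : Nat.Partition d) (k : Fin s) :
    ∑ i, weight N 0 {k} (exponents N lam i) - ∑ i, weight N 0 {k} (rho N i) =
      algebraMap (MvPowerSeries (Fin s) ℚ) _ ((contentSeries N lam).subst
        (MvPowerSeries.X k : MvPowerSeries (Fin s) ℚ)) := by
  have hX : PowerSeries.HasSubst (MvPowerSeries.X k : MvPowerSeries (Fin s) ℚ) :=
    PowerSeries.HasSubst.X k
  rw [← PowerSeries.coe_substAlgHom hX, contentSeries, map_sum, map_sum, ← Finset.sum_sub_distrib]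
  refine Finset.sum_congr rfl fun i _ => ?_
  rw [map_sub, map_sub, PowerSeries.coe_substAlgHom, ← expFrac_singleton, ← expFrac_singleton,
    weight, weight, exponents, rho]
  congr 2 <;> push_cast <;> ring

variable {a : Fin m → ℕ} {b : Fin n → ℕ}

theorem weight_empty (e : ℤ) : weight N e (∅ : Finset (Fin s)) = 1 := by
  ext j
  simp [weight]

theorem opValue_left {i : Fin m} (hi : 0 < a i) :
    opValue N a b (⟨{i}, ∅, ∅⟩ : Op m n s) = shiftOp (a i : ℤ) 1 := by
  have he : energy a b (⟨{i}, ∅, ∅⟩ : Op m n s) = a i := by simp [energy]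
  rw [opValue, he, if_neg (by omega), zero_smul, add_zero, weight_empty]

theorem opValue_right {j : Fin n} (hj : 0 < b j) :
    opValue N a b (⟨∅, {j}, ∅⟩ : Op m n s) = shiftOp (-(b j : ℤ)) 1 := by
  have he : energy a b (⟨∅, {j}, ∅⟩ : Op m n s) = -b j := by simp [energy]
  rw [opValue, he, if_neg (by omega), zero_smul, add_zero, weight_empty]

theorem opValue_middle_apply (lam : Nat.Partition d) (k : Fin s)
    (f : (Fin N → ℤ) → FractionRing (MvPowerSeries (Fin s) ℚ)) :
    opValue N a b (⟨∅, ∅, {k}⟩ : Op m n s) f (exponents N lam) =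
      algebraMap (MvPowerSeries (Fin s) ℚ) _ ((contentSeries N lam).subst
        (MvPowerSeries.X k : MvPowerSeries (Fin s) ℚ)) * f (exponents N lam) := by
  have he : energy a b (⟨∅, ∅, {k}⟩ : Op m n s) = 0 := by simp [energy]
  rw [opValue_apply, he, if_pos rfl, vacuumValue, if_pos ⟨k, rfl⟩, Pi.add_apply,
    shiftOp_zero_apply _ _ (exponents_nonneg N lam), ← sum_weight_exponents, Pi.smul_apply,
    smul_eq_mul]
  ring

theorem wordState_right (hb : ∀ j, 0 < b j) :
    wordState N a b ((List.finRange n).map (fun j => (⟨∅, {j}, ∅⟩ : Op m n s))) =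
      create N _ (List.ofFn b) := by
  rw [wordState, create, List.ofFn_eq_map, List.foldr_map, List.foldr_map]
  congr 1
  ext j f : 2
  rw [opValue_right (hb j)]

theorem wordState_middle (lam : Nat.Partition d) (w : List (Op m n s)) (l : List (Fin s)) :
    wordState N a b (l.map (fun k => (⟨∅, ∅, {k}⟩ : Op m n s)) ++ w) (exponents N lam) =
      (l.map fun k => algebraMap (MvPowerSeries (Fin s) ℚ)
        (FractionRing (MvPowerSeries (Fin s) ℚ)) ((contentSeries N lam).subst
        (MvPowerSeries.X k : MvPowerSeries (Fin s) ℚ))).prod *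
        wordState N a b w (exponents N lam) := by
  induction l with
  | nil => simp
  | cons k l ih =>
    rw [List.map_cons, List.cons_append, List.map_cons, List.prod_cons, mul_assoc, ← ih,
      ← opValue_middle_apply (a := a) (b := b)]
    rfl

theorem wordState_left (ha : ∀ i, 0 < a i) (w : List (Op m n s)) :
    wordState N a b ((List.finRange m).map (fun i => (⟨{i}, ∅, ∅⟩ : Op m n s)) ++ w) =
      annihilate (List.ofFn a) (wordState N a b w) := by
  rw [wordState, annihilate, List.ofFn_eq_map, List.foldr_append, List.foldr_map, List.foldr_map]
  congr 1
  ext j f : 2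
  rw [opValue_left (ha j)]

/-- The sum over all partitions of `d` computed by the initial word. -/
def hurwitzSeries (N s : ℕ) (mu nu : Nat.Partition d) : MvPowerSeries (Fin s) ℚ :=
  ∑ lam : Nat.Partition d,
    MvPowerSeries.C (((create N ℤ (rows mu) (exponents N lam) : ℤ) : ℚ) *
      ((create N ℤ (rows nu) (exponents N lam) : ℤ) : ℚ)) *
    ∏ k, (contentSeries N lam).subst (MvPowerSeries.X k : MvPowerSeries (Fin s) ℚ)

/-- The positive operators are adjoint to creation operators, which inserts a sum over λ; the middle
operators are diagonal at each λ. -/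
theorem wordState_initialWord (hN : d ≤ N) (mu nu : Nat.Partition d) :
    wordState N (part mu) (part nu) (initialWord (len mu) (len nu) s) (rho N) =
      algebraMap (MvPowerSeries (Fin s) ℚ) _ (hurwitzSeries N s mu nu) := by
  rw [initialWord, List.append_assoc, wordState_left (part_pos mu), ofFn_part,
    (isFermionic_wordState _).annihilate_rho hN (sum_rows mu), hurwitzSeries, map_sum]
  refine Finset.sum_congr rfl fun lam _ => ?_
  rw [wordState_middle, wordState_right (part_pos nu), ofFn_part, map_mul, map_mul, map_mul,
    map_prod, ← List.ofFn_eq_map, List.prod_ofFn]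
  have hc : ∀ L : List ℕ, create N (FractionRing (MvPowerSeries (Fin s) ℚ)) L (exponents N lam) =
      algebraMap (MvPowerSeries (Fin s) ℚ) (FractionRing (MvPowerSeries (Fin s) ℚ))
        (MvPowerSeries.C ((create N ℤ L (exponents N lam) : ℤ) : ℚ)) := by
    intro L
    rw [map_intCast, map_intCast, ← create_map (Int.castRingHom _), Int.coe_castRingHom]
  rw [hc, hc]
  ring

theorem coeff_hurwitzSeries (hN : d ≤ N) (mu nu : Nat.Partition d) (p : ℕ) :
    MvPowerSeries.coeff (Finsupp.equivFunOnFinite.symm fun _ : Fin s => p)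
      (hurwitzSeries N s mu nu) =
      ∑ lam : Nat.Partition d, ((create N ℤ (rows mu) (exponents N lam) : ℤ) : ℚ) *
        (shiftedPowerSum p lam / (p.factorial : ℚ)) ^ s *
        ((create N ℤ (rows nu) (exponents N lam) : ℤ) : ℚ) := by
  rw [hurwitzSeries, map_sum]
  refine Finset.sum_congr rfl fun lam _ => ?_
  rw [MvPowerSeries.coeff_C_mul, coeff_prod_subst_X]
  simp only [Finsupp.equivFunOnFinite_symm_apply_apply, coeff_contentSeries hN,
    Finset.prod_const, Finset.card_univ, Fintype.card_fin]
  ring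

end InitialWord

/-! ### Young tableaux -/

section Tableaux

variable {d : ℕ} (lam : Nat.Partition d)

/-- The row of a number in the tableau of shape `λ`. -/
def rowIdx (x : Fin d) : ℕ := (tableau lam x).1

/-- The column of a number in the tableau of shape `λ`. -/
def colIdx (x : Fin d) : ℕ := (tableau lam x).2

theorem rowIdx_lt_len (x : Fin d) : rowIdx lam x < len lam := (tableau lam x).1.isLt

theorem colIdx_lt (x : Fin d) : colIdx lam x < partExt lam (rowIdx lam x) := by
  rw [rowIdx, partExt_of_lt]
  exact (tableau lam x).2.isLt

variable {lam}

theorem eq_of_rowIdx_eq_of_colIdx_eq {x y : Fin d} (hr : rowIdx lam x = rowIdx lam y)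
    (hc : colIdx lam x = colIdx lam y) : x = y := by
  apply (tableau lam).injective
  unfold rowIdx at hr
  unfold colIdx at hc
  generalize tableau lam x = u at hr hc ⊢
  generalize tableau lam y = v at hr hc ⊢
  obtain ⟨i, j⟩ := u
  obtain ⟨i', j'⟩ := v
  obtain rfl : i = i' := Fin.ext hr
  obtain rfl : j = j' := Fin.ext hc
  rfl

theorem exists_box {i j : ℕ} (h : j < partExt lam i) :
    ∃ x, rowIdx lam x = i ∧ colIdx lam x = j := by
  have hi : i < len lam := by
    by_contra hi
    rw [partExt_of_ge lam (not_lt.1 hi)] at h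
    omega
  have hj : j < part lam ⟨i, hi⟩ := by rwa [← partExt_of_lt]
  exact ⟨(tableau lam).symm ⟨⟨i, hi⟩, ⟨j, hj⟩⟩, 
    congrArg (fun b : Box lam => (b.1 : ℕ)) (Equiv.apply_symm_apply _ _),
    congrArg (fun b : Box lam => (b.2 : ℕ)) (Equiv.apply_symm_apply _ _)⟩

theorem exists_box_above {x : Fin d} {i : ℕ} (h : i ≤ rowIdx lam x) :
    ∃ y, rowIdx lam y = i ∧ colIdx lam y = colIdx lam x :=
  exists_box ((colIdx_lt lam x).trans_le (partExt_antitone lam h))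

theorem card_rowIdx_eq (i : ℕ) : (univ.filter fun x => rowIdx lam x = i).card = partExt lam i := by
  rw [← Finset.card_range (partExt lam i)]
  refine Finset.card_nbij (colIdx lam) ?_ ?_ ?_
  · intro x hx
    simp only [Finset.coe_filter, Finset.mem_univ, true_and, Set.mem_ofPred_eq] at hx
    rw [Finset.mem_coe, Finset.mem_range, ← hx]
    exact colIdx_lt lam x
  · intro x hx y hy h
    simp only [Finset.coe_filter, Finset.mem_univ, true_and, Set.mem_ofPred_eq] at hx hy
    exact eq_of_rowIdx_eq_of_colIdx_eq (hx.trans hy.symm) h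
  · intro j hj
    rw [Finset.mem_coe, Finset.mem_range] at hj
    obtain ⟨x, h1, h2⟩ := exists_box hj
    exact ⟨x, by simpa using h1, h2⟩

variable (lam) in
/-- The values of `f` in each column are distinct. -/
def IsColumnInjective (f : Fin d → ℕ) : Prop :=
  ∀ x y, colIdx lam x = colIdx lam y → f x = f y → x = y

/-- If the column reaches row k, the right side is k, the most that distinct values below k allow.
Otherwise the right side counts the whole column. -/
theorem card_column_le {f : Fin d → ℕ} (hf : IsColumnInjective lam f) (j k : ℕ) :
    (univ.filter fun x => f x < k ∧ colIdx lam x = j).card ≤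
      (univ.filter fun x => rowIdx lam x < k ∧ colIdx lam x = j).card := by
  by_cases h : ∃ x, colIdx lam x = j ∧ k ≤ rowIdx lam x
  · obtain ⟨x, hx, hk⟩ := h
    have h1 : (univ.filter fun x => f x < k ∧ colIdx lam x = j).card ≤ (range k).card := by
      refine Finset.card_le_card_of_injOn f ?_ ?_
      · intro y hy
        simp only [Finset.coe_filter, Finset.mem_univ, true_and, Set.mem_ofPred_eq] at hy
        simpa using hy.1
      · intro y hy z hz h
        simp only [Finset.coe_filter, Finset.mem_univ, true_and, Set.mem_ofPred_eq] at hy hz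
        exact hf y z (hy.2.trans hz.2.symm) h
    have h2 : (range k).card ≤ (univ.filter fun x => rowIdx lam x < k ∧ colIdx lam x = j).card := by
      refine Finset.card_le_card_of_surjOn (rowIdx lam) ?_
      intro i hi
      rw [Finset.mem_coe, Finset.mem_range] at hi
      obtain ⟨y, hy1, hy2⟩ := exists_box_above (hi.le.trans hk)
      refine ⟨y, ?_, hy1⟩
      simp [hy1, hy2, hi, hx]
    exact h1.trans h2
  · push Not at h
    refine Finset.card_le_card fun x hx => ?_
    simp only [Finset.mem_filter, Finset.mem_univ, true_and] at hx ⊢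
    exact ⟨h x hx.2, hx.2⟩

theorem card_lt_eq_sum (f : Fin d → ℕ) (k : ℕ) :
    (univ.filter fun x => f x < k).card = ∑ j ∈ univ.image (colIdx lam),
      (univ.filter fun x => f x < k ∧ colIdx lam x = j).card := by
  rw [Finset.card_eq_sum_card_fiberwise (f := colIdx lam) (t := univ.image (colIdx lam))]
  · simp only [Finset.filter_filter]
  · intro x _
    simp

/-- Dominance: the content of a column-injective filling is dominated by λ. -/
theorem card_lt_le {f : Fin d → ℕ} (hf : IsColumnInjective lam f) (k : ℕ) :
    (univ.filter fun x => f x < k).card ≤ (univ.filter fun x => rowIdx lam x < k).card := by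
  rw [card_lt_eq_sum (lam := lam), card_lt_eq_sum (lam := lam)]
  exact Finset.sum_le_sum fun j _ => card_column_le hf j k

theorem mem_rowGroup {σ : Equiv.Perm (Fin d)} :
    σ ∈ rowGroup lam ↔ ∀ x, rowIdx lam (σ x) = rowIdx lam x := by
  simp only [rowGroup, Finset.mem_filter, Finset.mem_univ, true_and, rowIdx, Fin.ext_iff]

theorem mem_columnGroup {σ : Equiv.Perm (Fin d)} :
    σ ∈ columnGroup lam ↔ ∀ x, colIdx lam (σ x) = colIdx lam x := by
  simp only [columnGroup, Finset.mem_filter, Finset.mem_univ, true_and, colIdx]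

/-- A column injective map with the same content as the row index is a column permutation of it. -/
theorem exists_columnGroup {f : Fin d → ℕ} (hf : IsColumnInjective lam f)
    (hcard : ∀ k, (univ.filter fun x => f x < k).card =
      (univ.filter fun x => rowIdx lam x < k).card) :
    ∃ q ∈ columnGroup lam, ∀ x, f x = rowIdx lam (q x) := by
  -- Equality of the totals forces equality in the inequality of every column.
  have hcol : ∀ x k, (univ.filter fun y => f y < k ∧ colIdx lam y = colIdx lam x).card =
      (univ.filter fun y => rowIdx lam y < k ∧ colIdx lam y = colIdx lam x).card := by
    intro x k
    have h := hcard k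
    rw [card_lt_eq_sum (lam := lam), card_lt_eq_sum (lam := lam),
      Finset.sum_eq_sum_iff_of_le fun j _ => card_column_le hf j k] at h
    exact h _ (by simp)
  -- Taking k to be the height of the column of x shows that f stays below this height. So the box
  -- in row f x of that column exists; q will send x to it.
  have hlt : ∀ x, colIdx lam x < partExt lam (f x) := by
    intro x
    set C := univ.filter fun y => colIdx lam y = colIdx lam x with hC
    have hB : (univ.filter fun y => rowIdx lam y < C.card ∧ colIdx lam y = colIdx lam x) = C := by
      ext y
      simp only [hC, Finset.mem_filter, Finset.mem_univ, true_and, and_iff_right_iff_imp]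
      intro hy
      have : (range (rowIdx lam y + 1)).card ≤ C.card := by
        refine Finset.card_le_card_of_surjOn (rowIdx lam) ?_
        intro i hi
        rw [Finset.mem_coe, Finset.mem_range] at hi
        obtain ⟨z, hz1, hz2⟩ := exists_box_above (Nat.lt_succ_iff.1 hi)
        exact ⟨z, by simp [hC, hz2, hy], hz1⟩
      rw [Finset.card_range] at this
      rw [hC] at this
      omega
    have h1 := hcol x C.card
    rw [hB] at h1
    have hsub : (univ.filter fun y => f y < C.card ∧ colIdx lam y = colIdx lam x) ⊆ C := by
      intro y hy
      simp only [hC, Finset.mem_filter, Finset.mem_univ, true_and] at hy ⊢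
      exact hy.2
    have hA := Finset.eq_of_subset_of_card_le hsub h1.ge
    have hx : f x < C.card := by
      have : x ∈ C := by simp [hC]
      rw [← hA, Finset.mem_filter] at this
      exact this.2.1
    have hex : ∃ y ∈ C, f x ≤ rowIdx lam y := by
      by_contra! hno
      have : C.card ≤ (range (f x)).card := by
        refine Finset.card_le_card_of_injOn (rowIdx lam) ?_ ?_
        · intro y hy
          simpa using hno y hy
        · intro y hy z hz h
          simp only [hC, Finset.coe_filter, Finset.mem_univ, true_and, Set.mem_ofPred_eq] at hy hz
          exact eq_of_rowIdx_eq_of_colIdx_eq h (hy.trans hz.symm)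
      rw [Finset.card_range] at this
      omega
    obtain ⟨y, hy, hfy⟩ := hex
    have hy' : colIdx lam y = colIdx lam x := by simpa [hC] using hy
    rw [← hy']
    exact (colIdx_lt lam y).trans_le (partExt_antitone lam hfy)
  choose q hq1 hq2 using fun x => exists_box (hlt x)
  have hinj : Function.Injective q := fun x y h =>
    hf x y (by rw [← hq2 x, h, hq2]) (by rw [← hq1 x, h, hq1])
  exact ⟨Equiv.ofBijective q (Finite.injective_iff_bijective.1 hinj),
    mem_columnGroup.2 fun x => hq2 x, fun x => (hq1 x).symm⟩

theorem exists_swap_of_not_isColumnInjective {f : Fin d → ℕ} (hf : ¬ IsColumnInjective lam f) :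
    ∃ x y, x ≠ y ∧ Equiv.swap x y ∈ columnGroup lam ∧ f x = f y := by
  unfold IsColumnInjective at hf
  push Not at hf
  obtain ⟨x, y, h1, h2, h3⟩ := hf
  refine ⟨x, y, h3, mem_columnGroup.2 fun z => ?_, h2⟩
  rw [Equiv.swap_apply_def]
  split_ifs with h4 h5
  · rw [h4, h1]
  · rw [h5, h1]
  · rfl

theorem mul_mem_rowGroup {σ τ : Equiv.Perm (Fin d)} (hσ : σ ∈ rowGroup lam)
    (hτ : τ ∈ rowGroup lam) : σ * τ ∈ rowGroup lam :=
  mem_rowGroup.2 fun x => by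
    rw [Equiv.Perm.mul_apply, mem_rowGroup.1 hσ, mem_rowGroup.1 hτ]

theorem inv_mem_rowGroup {σ : Equiv.Perm (Fin d)} (hσ : σ ∈ rowGroup lam) :
    σ⁻¹ ∈ rowGroup lam :=
  mem_rowGroup.2 fun x => by
    simpa using (mem_rowGroup.1 hσ (σ⁻¹ x)).symm

theorem mul_mem_columnGroup {σ τ : Equiv.Perm (Fin d)} (hσ : σ ∈ columnGroup lam)
    (hτ : τ ∈ columnGroup lam) : σ * τ ∈ columnGroup lam :=
  mem_columnGroup.2 fun x => by
    rw [Equiv.Perm.mul_apply, mem_columnGroup.1 hσ, mem_columnGroup.1 hτ]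

theorem inv_mem_columnGroup {σ : Equiv.Perm (Fin d)} (hσ : σ ∈ columnGroup lam) :
    σ⁻¹ ∈ columnGroup lam :=
  mem_columnGroup.2 fun x => by
    simpa using (mem_columnGroup.1 hσ (σ⁻¹ x)).symm

variable (lam) in
theorem one_mem_rowGroup : 1 ∈ rowGroup lam := mem_rowGroup.2 fun _ => rfl

variable (lam) in
theorem one_mem_columnGroup : 1 ∈ columnGroup lam := mem_columnGroup.2 fun _ => rfl

theorem eq_one_of_mem {σ : Equiv.Perm (Fin d)} (hσ : σ ∈ rowGroup lam)
    (hσ' : σ ∈ columnGroup lam) : σ = 1 := by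
  ext x : 1
  exact eq_of_rowIdx_eq_of_colIdx_eq (mem_rowGroup.1 hσ x) (mem_columnGroup.1 hσ' x)

end Tableaux

/-! ### The Young symmetrizer -/

section YoungSymmetrizer

variable {d : ℕ} (lam : Nat.Partition d)

/-- The sum over the row group. -/
def rowSum : MonoidAlgebra ℚ (Equiv.Perm (Fin d)) :=
  ∑ σ ∈ rowGroup lam, MonoidAlgebra.of ℚ _ σ

/-- The signed sum over the column group. -/
def columnSum : MonoidAlgebra ℚ (Equiv.Perm (Fin d)) :=
  ∑ σ ∈ columnGroup lam, ((Equiv.Perm.sign σ : ℤ) : ℚ) • MonoidAlgebra.of ℚ _ σ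

theorem youngSymmetrizer_eq : youngSymmetrizer lam = rowSum lam * columnSum lam := rfl

variable {lam}

theorem rowSum_mul_of {p : Equiv.Perm (Fin d)} (hp : p ∈ rowGroup lam) :
    rowSum lam * MonoidAlgebra.of ℚ _ p = rowSum lam := by
  rw [rowSum, Finset.sum_mul]
  refine Finset.sum_nbij' (· * p) (· * p⁻¹) ?_ ?_ ?_ ?_ ?_
  · exact fun σ hσ => mul_mem_rowGroup hσ hp
  · exact fun σ hσ => mul_mem_rowGroup hσ (inv_mem_rowGroup hp)
  · simp
  · simp
  · intro σ _
    rw [map_mul]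

theorem of_mul_columnSum {q : Equiv.Perm (Fin d)} (hq : q ∈ columnGroup lam) :
    MonoidAlgebra.of ℚ _ q * columnSum lam =
      ((Equiv.Perm.sign q : ℤ) : ℚ) • columnSum lam := by
  rw [columnSum, Finset.mul_sum, Finset.smul_sum]
  refine Finset.sum_nbij' (q * ·) (q⁻¹ * ·) ?_ ?_ ?_ ?_ ?_
  · exact fun σ hσ => mul_mem_columnGroup hq hσ
  · exact fun σ hσ => mul_mem_columnGroup (inv_mem_columnGroup hq) hσ
  · simp
  · simp
  · intro σ _
    rw [map_mul, mul_smul_comm, smul_smul, map_mul]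
    congr 1
    rcases Int.units_eq_one_or (Equiv.Perm.sign q) with h | h <;> simp [h]

theorem swap_conj {x y : Fin d} (g : Equiv.Perm (Fin d)) :
    g * Equiv.swap x y = Equiv.swap (g x) (g y) * g := by
  rw [Equiv.mul_swap_eq_swap_mul]

/-- Von Neumann's dichotomy. By dominance, either g = p q with a row permutation p and a column
permutation q, or g conjugates some column transposition to a row transposition. -/
theorem rowSum_mul_of_mul_columnSum (g : Equiv.Perm (Fin d)) :
    ∃ t : ℚ, rowSum lam * MonoidAlgebra.of ℚ _ g * columnSum lam = t • youngSymmetrizer lam := by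
  by_cases hf : IsColumnInjective lam (fun x => rowIdx lam (g x))
  · obtain ⟨q, hq, hgq⟩ := exists_columnGroup hf (by
      intro k
      refine Finset.card_bij (fun x _ => g x) ?_ ?_ ?_
      · intro x hx
        simpa using hx
      · intro x _ y _ h
        exact g.injective h
      · intro y hy
        exact ⟨g⁻¹ y, by simpa using hy, by simp⟩)
    have hp : g * q⁻¹ ∈ rowGroup lam := mem_rowGroup.2 fun x => by
      have := hgq (q⁻¹ x)
      simpa using this
    refine ⟨((Equiv.Perm.sign q : ℤ) : ℚ), ?_⟩
    have hg : g = (g * q⁻¹) * q := by simp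
    rw [hg, map_mul, ← mul_assoc, rowSum_mul_of hp, mul_assoc, of_mul_columnSum hq,
      mul_smul_comm, youngSymmetrizer_eq]
  · obtain ⟨x, y, hxy, hτ, h⟩ := exists_swap_of_not_isColumnInjective hf
    refine ⟨0, ?_⟩
    have hp : Equiv.swap (g x) (g y) ∈ rowGroup lam := mem_rowGroup.2 fun z => by
      rw [Equiv.swap_apply_def]
      split_ifs with h1 h2
      · rw [h1, h]
      · rw [h2, h]
      · rfl
    -- The row transposition is absorbed on the left, and the conjugate column transposition changes
    -- the sign on the right.
    have h1 : rowSum lam * MonoidAlgebra.of ℚ _ g * columnSum lam =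
        -(rowSum lam * MonoidAlgebra.of ℚ _ g * columnSum lam) := by
      calc rowSum lam * MonoidAlgebra.of ℚ _ g * columnSum lam
          = rowSum lam * MonoidAlgebra.of ℚ _ (Equiv.swap (g x) (g y)) *
            MonoidAlgebra.of ℚ _ g * columnSum lam := by rw [rowSum_mul_of hp]
        _ = rowSum lam * MonoidAlgebra.of ℚ _ g *
            (MonoidAlgebra.of ℚ _ (Equiv.swap x y) * columnSum lam) := by
          rw [mul_assoc (rowSum lam), ← map_mul, ← swap_conj, map_mul]
          simp only [mul_assoc]
        _ = _ := by
          rw [of_mul_columnSum hτ, Equiv.Perm.sign_swap hxy]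
          simp
    rw [zero_smul]
    have h2 := add_eq_zero_iff_eq_neg.2 h1
    rw [← two_smul ℚ] at h2
    exact (smul_eq_zero.1 h2).resolve_left two_ne_zero

theorem exists_rowSum_mul_mul_columnSum (y : MonoidAlgebra ℚ (Equiv.Perm (Fin d))) :
    ∃ t : ℚ, rowSum lam * y * columnSum lam = t • youngSymmetrizer lam := by
  induction y using MonoidAlgebra.induction_on with
  | of g => exact rowSum_mul_of_mul_columnSum g
  | add y z hy hz =>
    obtain ⟨t, ht⟩ := hy
    obtain ⟨u, hu⟩ := hz
    exact ⟨t + u, by rw [mul_add, add_mul, ht, hu, add_smul]⟩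
  | smul r y hy =>
    obtain ⟨t, ht⟩ := hy
    exact ⟨r * t, by rw [mul_smul_comm, smul_mul_assoc, ht, smul_smul]⟩

theorem exists_youngSymmetrizer_mul_mul (y : MonoidAlgebra ℚ (Equiv.Perm (Fin d))) :
    ∃ t : ℚ, youngSymmetrizer lam * y * youngSymmetrizer lam = t • youngSymmetrizer lam := by
  obtain ⟨t, ht⟩ := exists_rowSum_mul_mul_columnSum (lam := lam) (columnSum lam * y * rowSum lam)
  refine ⟨t, ?_⟩
  rw [← ht, youngSymmetrizer_eq]
  simp only [mul_assoc]

/-- The sum of the values of `F` weighted by the coefficients of the Young symmetrizer. -/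
theorem sum_coeff_youngSymmetrizer (F : Equiv.Perm (Fin d) → ℚ) :
    ∑ g, (youngSymmetrizer lam).coeff g * F g = ∑ p ∈ rowGroup lam, ∑ q ∈ columnGroup lam,
      ((Equiv.Perm.sign q : ℤ) : ℚ) * F (p * q) := by
  have h1 : youngSymmetrizer lam = ∑ p ∈ rowGroup lam, ∑ q ∈ columnGroup lam,
      MonoidAlgebra.single (p * q) ((Equiv.Perm.sign q : ℤ) : ℚ) := by
    rw [youngSymmetrizer_eq, rowSum, columnSum, Finset.sum_mul_sum]
    refine Finset.sum_congr rfl fun p _ => Finset.sum_congr rfl fun q _ => ?_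
    rw [mul_smul_comm, ← map_mul, MonoidAlgebra.of_apply, MonoidAlgebra.smul_single, smul_eq_mul,
      mul_one]
  rw [h1]
  simp only [MonoidAlgebra.coeff_sum, Finsupp.finsetSum_apply, Finset.sum_mul,
    MonoidAlgebra.coeff_single]
  rw [Finset.sum_comm]
  refine Finset.sum_congr rfl fun p _ => ?_
  rw [Finset.sum_comm]
  refine Finset.sum_congr rfl fun q _ => ?_
  rw [Finset.sum_eq_single (p * q)]
  · simp
  · intro g _ hg
    simp [hg.symm]
  · simp

/-- A permutation preserving rows and columns is trivial, so p q = 1 only for p = q = 1. -/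
theorem coeff_youngSymmetrizer_one : (youngSymmetrizer lam).coeff 1 = 1 := by
  have h := sum_coeff_youngSymmetrizer (lam := lam) (fun g => if g = 1 then 1 else 0)
  simp only [mul_ite, mul_one, mul_zero, Finset.sum_ite_eq', Finset.mem_univ, if_true] at h
  rw [h, Finset.sum_eq_single 1, Finset.sum_eq_single 1]
  · simp
  · intro q _ hq
    simp [hq]
  · exact fun h => absurd (one_mem_columnGroup lam) h
  · intro p hp hne
    refine Finset.sum_eq_zero fun q hq => if_neg fun h => hne ?_
    have : p = q⁻¹ := eq_inv_of_mul_eq_one_left h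
    exact eq_one_of_mem hp (this ▸ inv_mem_columnGroup hq)
  · exact fun h => absurd (one_mem_rowGroup lam) h

end YoungSymmetrizer

/-! ### Characters -/

section Character

theorem coeff_mul_eq_sum {G : Type*} [Group G] [Fintype G] (x y : MonoidAlgebra ℚ G) (g : G) :
    (x * y).coeff g = ∑ h, x.coeff h * y.coeff (h⁻¹ * g) := by
  rw [MonoidAlgebra.coeff_mul_apply_left, Finsupp.sum_fintype _ _ fun _ => zero_mul _]

theorem trace_monoidAlgebra {G : Type*} [Group G] [Fintype G]
    (T : MonoidAlgebra ℚ G →ₗ[ℚ] MonoidAlgebra ℚ G) :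
    LinearMap.trace ℚ _ T = ∑ g, (T (MonoidAlgebra.of ℚ G g)).coeff g := by
  classical
  rw [LinearMap.trace_eq_matrix_trace ℚ (MonoidAlgebra.basis G ℚ), Matrix.trace]
  refine Finset.sum_congr rfl fun g _ => ?_
  rw [Matrix.diag_apply, LinearMap.toMatrix_apply]
  rfl

theorem finite_monoidAlgebra {G : Type*} [Group G] [Fintype G] :
    Module.Finite ℚ (MonoidAlgebra ℚ G) := Module.Finite.of_basis (MonoidAlgebra.basis G ℚ)

variable {d : ℕ} (lam : Nat.Partition d)

/-- If n = 0, right multiplication by c would be nilpotent. But its trace is d! times the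
coefficient of c at 1, hence nonzero. -/
theorem exists_youngSymmetrizer_sq : ∃ n : ℚ, n ≠ 0 ∧
    youngSymmetrizer lam * youngSymmetrizer lam = n • youngSymmetrizer lam := by
  obtain ⟨n, hn⟩ := exists_youngSymmetrizer_mul_mul (lam := lam) 1
  rw [mul_one] at hn
  refine ⟨n, ?_, hn⟩
  rintro rfl
  rw [zero_smul] at hn
  have h1 : IsNilpotent (LinearMap.mulRight ℚ (youngSymmetrizer lam)) :=
    ⟨2, by rw [LinearMap.pow_mulRight, sq, hn, LinearMap.mulRight_zero_eq_zero]⟩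
  have := finite_monoidAlgebra (G := Equiv.Perm (Fin d))
  have h2 := (LinearMap.isNilpotent_trace_of_isNilpotent h1).eq_zero
  rw [trace_monoidAlgebra] at h2
  simp only [LinearMap.mulRight_apply, MonoidAlgebra.of_apply, MonoidAlgebra.coeff_single_mul_apply,
    inv_mul_cancel, coeff_youngSymmetrizer_one, mul_one, Finset.sum_const, Finset.card_univ,
    nsmul_eq_mul] at h2
  exact Fintype.card_ne_zero (by exact_mod_cast h2)

variable {lam} {n : ℚ}

/-- The character of a Specht module in terms of the Young symmetrizer. -/
theorem spechtCharacter_eq (hn : n ≠ 0)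
    (h : youngSymmetrizer lam * youngSymmetrizer lam = n • youngSymmetrizer lam)
    (g : Equiv.Perm (Fin d)) :
    spechtCharacter lam g = n⁻¹ * ∑ x, (youngSymmetrizer lam).coeff (x⁻¹ * g⁻¹ * x) := by
  have hfin := finite_monoidAlgebra (G := Equiv.Perm (Fin d))
  set incl : spechtModule lam →ₗ[ℚ] MonoidAlgebra ℚ (Equiv.Perm (Fin d)) :=
    (spechtModule lam).subtype.restrictScalars ℚ with hincl
  have hfin' : Module.Finite ℚ (spechtModule lam) :=
    Module.Finite.of_injective incl (Submodule.subtype_injective _)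
  have hmem : ∀ y, n⁻¹ • (y * youngSymmetrizer lam) ∈ spechtModule lam := by
    intro y
    rw [← smul_mul_assoc]
    exact Submodule.mem_span_singleton.2 ⟨_, rfl⟩
  -- c/n is idempotent, so this is a projection onto the ideal. Cyclicity of the trace moves the
  -- computation to the whole group algebra.
  let proj : MonoidAlgebra ℚ (Equiv.Perm (Fin d)) →ₗ[ℚ] spechtModule lam :=
    { toFun := fun y => ⟨n⁻¹ • (y * youngSymmetrizer lam), hmem y⟩
      map_add' := fun y z => by
        ext1
        simp [add_mul]
      map_smul' := fun t y => by
        ext1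
        change n⁻¹ • (t • y * youngSymmetrizer lam) = t • n⁻¹ • (y * youngSymmetrizer lam)
        rw [smul_mul_assoc, smul_comm] }
  have hproj : ∀ y : spechtModule lam, proj (incl y) = y := by
    rintro ⟨y, hy⟩
    obtain ⟨z, rfl⟩ := Submodule.mem_span_singleton.1 hy
    ext1
    change n⁻¹ • (z * youngSymmetrizer lam * youngSymmetrizer lam) = z * youngSymmetrizer lam
    rw [mul_assoc, h, mul_smul_comm, smul_smul, inv_mul_cancel₀ hn, one_smul]
  set L : Module.End ℚ (spechtModule lam) :=
    Algebra.lsmul ℚ ℚ (spechtModule lam) (MonoidAlgebra.of ℚ (Equiv.Perm (Fin d)) g) with hL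
  have hcomp : L = (L ∘ₗ proj) ∘ₗ incl := by
    ext1 y
    rw [LinearMap.comp_apply, LinearMap.comp_apply, hproj]
  have hS : spechtCharacter lam g = LinearMap.trace ℚ (spechtModule lam) L := rfl
  rw [hS, hcomp, LinearMap.trace_comp_comm', trace_monoidAlgebra, Finset.mul_sum]
  refine Finset.sum_congr rfl fun x _ => ?_
  have h1 : (incl ∘ₗ L ∘ₗ proj) (MonoidAlgebra.of ℚ _ x) = MonoidAlgebra.of ℚ _ g *
      (n⁻¹ • (MonoidAlgebra.of ℚ _ x * youngSymmetrizer lam)) := rfl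
  rw [h1, mul_smul_comm, MonoidAlgebra.coeff_smul, Finsupp.smul_apply, smul_eq_mul]
  simp only [MonoidAlgebra.of_apply, MonoidAlgebra.coeff_single_mul_apply, one_mul, mul_assoc]

/-- The character averages the coefficients of c over conjugates of g⁻¹, and every permutation is
conjugate to its inverse. Against a class function each of the d! conjugations gives the same sum.
-/
theorem sum_spechtCharacter_mul (hn : n ≠ 0)
    (h : youngSymmetrizer lam * youngSymmetrizer lam = n • youngSymmetrizer lam)
    {F : Equiv.Perm (Fin d) → ℚ} (hF : ∀ g g', IsConj g g' → F g = F g') :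
    ∑ g, spechtCharacter lam g * F g =
      n⁻¹ * d.factorial * ∑ g, (youngSymmetrizer lam).coeff g * F g := by
  simp only [spechtCharacter_eq hn h, Finset.sum_mul, Finset.mul_sum, mul_assoc]
  rw [Finset.sum_comm]
  have h1 : ∀ x : Equiv.Perm (Fin d),
      ∑ g, n⁻¹ * ((youngSymmetrizer lam).coeff (x⁻¹ * (g⁻¹ * x)) * F g) =
      ∑ g, n⁻¹ * ((youngSymmetrizer lam).coeff g * F g) := by
    intro x
    refine Fintype.sum_equiv ((Equiv.inv _).trans (MulAut.conj x⁻¹).toEquiv) _ _ fun g => ?_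
    have h2 : IsConj g (x⁻¹ * (g⁻¹ * x)) := by
      have h3 : IsConj g g⁻¹ := by
        rw [Equiv.Perm.isConj_iff_cycleType_eq, Equiv.Perm.cycleType_inv]
      refine h3.trans (isConj_iff.2 ⟨x⁻¹, ?_⟩)
      rw [inv_inv, mul_assoc]
    simp only [Equiv.trans_apply, Equiv.inv_apply, MulEquiv.toEquiv_eq_coe, EquivLike.coe_coe,
      MulAut.conj_apply, inv_inv, mul_assoc]
    rw [hF _ _ h2]
  rw [Finset.sum_congr rfl fun x _ => h1 x, Finset.sum_const, Finset.card_univ,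
    Fintype.card_perm, Fintype.card_fin, nsmul_eq_mul, Finset.mul_sum]
  refine Finset.sum_congr rfl fun g _ => ?_
  ring

theorem spechtCharacter_isConj (g g' : Equiv.Perm (Fin d)) (hg : IsConj g g') :
    spechtCharacter lam g = spechtCharacter lam g' := by
  obtain ⟨n, hn, h⟩ := exists_youngSymmetrizer_sq lam
  obtain ⟨y, rfl⟩ := isConj_iff.1 hg
  rw [spechtCharacter_eq hn h, spechtCharacter_eq hn h]
  congr 1
  refine Fintype.sum_equiv (Equiv.mulLeft y) _ _ fun x => ?_
  simp [mul_assoc]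

/-- The irreducibility of the Specht modules. -/
theorem sum_spechtCharacter_sq :
    ∑ g, spechtCharacter lam g * spechtCharacter lam g = d.factorial := by
  obtain ⟨n, hn, h⟩ := exists_youngSymmetrizer_sq lam
  rw [sum_spechtCharacter_mul hn h spechtCharacter_isConj]
  set c := youngSymmetrizer lam with hc
  choose t ht using exists_youngSymmetrizer_mul_mul (lam := lam)
  rw [← hc] at ht
  -- c³ is computed twice: as n² c, and by expanding the middle factor with c x c = t(x) c.
  have hcube : ∑ x, c.coeff x * t (MonoidAlgebra.of ℚ _ x) = n ^ 2 := by
    have h1 : c * c * c = n ^ 2 • c := by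
      rw [h, smul_mul_assoc, h, smul_smul, sq]
    have h2 : c = ∑ x, c.coeff x • MonoidAlgebra.of ℚ (Equiv.Perm (Fin d)) x := by
      ext g
      simp only [MonoidAlgebra.coeff_sum, MonoidAlgebra.coeff_smul, MonoidAlgebra.of_apply,
        Finsupp.finsetSum_apply, Finsupp.smul_apply, MonoidAlgebra.coeff_single, smul_eq_mul]
      rw [Finset.sum_eq_single g]
      · simp
      · intro x _ hx
        simp [hx]
      · simp
    have h3 : c * c * c = (∑ x, c.coeff x * t (MonoidAlgebra.of ℚ _ x)) • c := by
      conv_lhs => rw [mul_assoc]; enter [2, 1]; rw [h2]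
      rw [← mul_assoc, Finset.mul_sum, Finset.sum_mul, Finset.sum_smul]
      refine Finset.sum_congr rfl fun x _ => ?_
      rw [mul_smul_comm, smul_mul_assoc, ht, smul_smul]
    have h4 := congrArg (fun y => y.coeff 1) (h3.symm.trans h1)
    simpa [hc, coeff_youngSymmetrizer_one] using h4
  have h5 : ∑ g, c.coeff g * spechtCharacter lam g = n := by
    simp only [spechtCharacter_eq hn h, ← hc]
    -- Both sides are the coefficient at x of c x c = t(x) c.
    have h6 : ∀ x : Equiv.Perm (Fin d), ∑ g, c.coeff g * c.coeff (x⁻¹ * g⁻¹ * x) =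
        c.coeff x * t (MonoidAlgebra.of ℚ _ x) := by
      intro x
      have h7 := congrArg (fun y => y.coeff x) (ht (MonoidAlgebra.of ℚ _ x))
      simp only [MonoidAlgebra.coeff_smul, Finsupp.smul_apply, smul_eq_mul] at h7
      rw [mul_assoc, coeff_mul_eq_sum] at h7
      simp only [MonoidAlgebra.of_apply, MonoidAlgebra.coeff_single_mul_apply, one_mul] at h7 ⊢
      rw [mul_comm (c.coeff x), ← h7]
      simp only [mul_assoc]
    have h8 : ∀ g, c.coeff g * (n⁻¹ * ∑ x, c.coeff (x⁻¹ * g⁻¹ * x)) =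
        n⁻¹ * ∑ x, c.coeff g * c.coeff (x⁻¹ * g⁻¹ * x) := by
      intro g
      rw [← Finset.mul_sum]; ring
    rw [Finset.sum_congr rfl fun g _ => h8 g, ← Finset.mul_sum, Finset.sum_comm,
      Finset.sum_congr rfl fun x _ => h6 x, hcube]
    field_simp
  rw [h5]
  field_simp

end Character

/-! ### Colorings fixed by a permutation -/

section Colorings

/-- The sum recovers the number of ones; needed because cycle types omit fixed points. -/
theorem multiset_eq_of_filter_eq {M M' : Multiset ℕ} (hM : ∀ p ∈ M, 0 < p) (hM' : ∀ p ∈ M', 0 < p)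
    (hsum : M.sum = M'.sum) (h : M.filter (2 ≤ ·) = M'.filter (2 ≤ ·)) : M = M' := by
  have hone : ∀ K : Multiset ℕ, (∀ p ∈ K, 0 < p) → K.filter (fun p => ¬ 2 ≤ p) =
      Multiset.replicate (K.filter (fun p => ¬ 2 ≤ p)).card 1 := by
    intro K hK
    refine Multiset.eq_replicate_card.2 fun p hp => ?_
    have h1 := Multiset.mem_filter.1 hp
    have h2 := hK p h1.1
    omega
  have h1 := Multiset.filter_add_not (fun p => 2 ≤ p) M
  have h2 := Multiset.filter_add_not (fun p => 2 ≤ p) M'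
  rw [← h1, ← h2, h, Multiset.sum_add, Multiset.sum_add, hone M hM, hone M' hM',
    Multiset.sum_replicate, Multiset.sum_replicate] at hsum
  rw [← h1, ← h2, h, hone M hM, hone M' hM']
  congr 2
  simpa using hsum

variable {d : ℕ} (g : Equiv.Perm (Fin d))

/-- The cycles of a permutation, including the fixed points. -/
abbrev Orbit : Type := Quotient (Equiv.Perm.SameCycle.setoid g)

open Classical in
instance : Fintype (Orbit g) := Quotient.fintype _

open Classical in
/-- The number of elements of a cycle. -/
def orbitSize (o : Orbit g) : ℕ := (univ.filter fun x => (Quotient.mk _ x : Orbit g) = o).card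

variable {g}

theorem orbit_mk_eq_iff {x y : Fin d} :
    (Quotient.mk _ x : Orbit g) = Quotient.mk _ y ↔ g.SameCycle x y := Quotient.eq

theorem orbit_mk_apply (x : Fin d) : (Quotient.mk _ (g x) : Orbit g) = Quotient.mk _ x :=
  orbit_mk_eq_iff.2 (Equiv.Perm.sameCycle_apply_left.2 (Equiv.Perm.SameCycle.refl _ _))

theorem orbitSize_mk_of_mem {x : Fin d} (hx : x ∈ g.support) :
    orbitSize g (Quotient.mk _ x) = (g.cycleOf x).support.card := by
  classical
  rw [orbitSize]
  congr 1
  ext y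
  simp only [Finset.mem_filter, Equiv.Perm.mem_support_cycleOf_iff, Finset.mem_univ, true_and, hx,
    and_true]
  rw [orbit_mk_eq_iff]
  exact Equiv.Perm.sameCycle_comm

theorem orbitSize_mk_of_notMem {x : Fin d} (hx : x ∉ g.support) :
    orbitSize g (Quotient.mk _ x) = 1 := by
  rw [orbitSize, Finset.card_eq_one]
  refine ⟨x, ?_⟩
  ext y
  simp only [Finset.mem_filter, Finset.mem_singleton, Finset.mem_univ, true_and]
  rw [orbit_mk_eq_iff]
  constructor
  · intro h
    rw [Equiv.Perm.mem_support, not_not] at hx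
    exact (h.symm.eq_of_left hx).symm
  · rintro rfl
    exact Equiv.Perm.SameCycle.refl _ _

theorem orbitSize_pos (o : Orbit g) : 0 < orbitSize g o := by
  induction o using Quotient.inductionOn with
  | h x => exact Finset.card_pos.2 ⟨x, by simp⟩

theorem sum_orbitSize : ∑ o, orbitSize g o = d := by
  classical
  have h := Finset.card_eq_sum_card_fiberwise (s := (univ : Finset (Fin d)))
    (t := (univ : Finset (Orbit g))) (f := fun x => Quotient.mk _ x) (by simp)
  rw [Finset.card_univ, Fintype.card_fin] at h
  refine Eq.trans (Finset.sum_congr rfl fun o _ => ?_) h.symm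
  rw [orbitSize]

theorem map_orbitSize :
    (univ : Finset (Orbit g)).val.map (orbitSize g) = g.partition.parts := by
  classical
  refine multiset_eq_of_filter_eq ?_ (fun p hp => g.partition.parts_pos hp) ?_ ?_
  · intro p hp
    obtain ⟨o, _, rfl⟩ := Multiset.mem_map.1 hp
    exact orbitSize_pos o
  · rw [g.partition.parts_sum, Fintype.card_fin]
    exact sum_orbitSize
  · rw [Equiv.Perm.filter_parts_partition_eq_cycleType, Multiset.filter_map,
      Equiv.Perm.cycleType]
    have hsupp : ∀ o : Orbit g, 2 ≤ orbitSize g o → o.out ∈ g.support := by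
      intro o ho
      by_contra hx
      have := orbitSize_mk_of_notMem hx
      rw [Quotient.out_eq] at this
      omega
    have hmem : ∀ o, o ∈ (univ : Finset (Orbit g)).val.filter ((2 ≤ ·) ∘ orbitSize g) →
        2 ≤ orbitSize g o := fun o ho => (Multiset.mem_filter.1 ho).2
    refine Multiset.map_eq_map_of_bij_of_nodup _ _ (Multiset.Nodup.filter _ univ.nodup)
      (Finset.nodup _) (fun o _ => g.cycleOf o.out) ?_ ?_ ?_ ?_
    · intro o ho
      exact Equiv.Perm.cycleOf_mem_cycleFactorsFinset_iff.2 (hsupp o (hmem o ho))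
    · intro o ho o' ho' h
      have h1 : o'.out ∈ (g.cycleOf o.out).support := by
        rw [h, Equiv.Perm.mem_support_cycleOf_iff]
        exact ⟨Equiv.Perm.SameCycle.refl _ _, hsupp o' (hmem o' ho')⟩
      rw [Equiv.Perm.mem_support_cycleOf_iff] at h1
      rw [← Quotient.out_eq o, ← Quotient.out_eq o']
      exact orbit_mk_eq_iff.2 h1.1
    · intro c hc
      have hc' : c ∈ g.cycleFactorsFinset := hc
      obtain ⟨x, hx⟩ := (Equiv.Perm.mem_cycleFactorsFinset_iff.1 hc').1.nonempty_support
      have hxg : x ∈ g.support := Equiv.Perm.mem_cycleFactorsFinset_support_le hc' hx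
      have hcx : c = g.cycleOf x :=
        Equiv.Perm.cycle_is_cycleOf hx hc'
      have hsame : g.SameCycle (Quotient.mk (Equiv.Perm.SameCycle.setoid g) x).out x :=
        orbit_mk_eq_iff.1 (Quotient.out_eq _)
      refine ⟨Quotient.mk _ x, ?_, ?_⟩
      · rw [Multiset.mem_filter]
        refine ⟨Finset.mem_univ_val _, ?_⟩
        rw [Function.comp_apply, orbitSize_mk_of_mem hxg]
        exact Equiv.Perm.two_le_card_support_cycleOf_iff.2 (Equiv.Perm.mem_support.1 hxg)
      · rw [hcx]
        exact hsame.cycleOf_eq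
    · intro o ho
      rw [Function.comp_apply]
      conv_lhs => rw [← Quotient.out_eq o]
      exact orbitSize_mk_of_mem (hsupp o (hmem o ho))

/-- The number of elements of each color. -/
def content {N : ℕ} (f : Fin d → Fin N) (i : Fin N) : ℤ := (univ.filter fun x => f x = i).card

theorem content_comp {N : ℕ} (f : Fin d → Fin N) (σ : Equiv.Perm (Fin d)) :
    content (f ∘ σ) = content f := by
  ext i
  rw [content, content]
  congr 1
  refine Finset.card_bij (fun x _ => σ x) ?_ ?_ ?_
  · intro x hx
    simpa using hx
  · intro x _ y _ h
    exact σ.injective h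
  · intro y hy
    exact ⟨σ⁻¹ y, by simpa using hy, by simp⟩

theorem content_orbit {N : ℕ} (f : Orbit g → Fin N) (i : Fin N) :
    content (fun x => f (Quotient.mk _ x)) i = ∑ o, if f o = i then (orbitSize g o : ℤ) else 0 := by
  classical
  rw [content, Finset.card_eq_sum_card_fiberwise (t := (univ : Finset (Orbit g)))
    (f := fun x => Quotient.mk _ x) (by simp), Nat.cast_sum]
  refine Finset.sum_congr rfl fun o _ => ?_
  rw [Finset.filter_filter]
  split_ifs with h
  · rw [orbitSize]
    congr 2
    ext x
    simp only [Finset.mem_filter, Finset.mem_univ, true_and, and_iff_right_iff_imp]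
    rintro rfl
    exact h
  · rw [Nat.cast_eq_zero, Finset.card_eq_zero, Finset.filter_eq_empty_iff]
    rintro x _ ⟨h1, rfl⟩
    exact h h1

/-- The power sum product of the cycle type enumerates the colorings fixed by a permutation. -/
theorem psumEval_partition {N : ℕ} {R : Type*} [CommRing R] {L : List ℕ}
    (hL : (L : Multiset ℕ) = g.partition.parts) (F : (Fin N → ℤ) → R) :
    psumEval L F = ∑ f : Fin d → Fin N, if f ∘ g = f then F (content f) else 0 := by
  classical
  set e := (Fintype.equivFin (Orbit g)).symm with he
  have h1 : L.Perm (List.ofFn fun t => orbitSize g (e t)) := by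
    rw [← Multiset.coe_eq_coe, hL, ← map_orbitSize, ← Fin.univ_val_map,
      ← Multiset.map_univ_val_equiv e, Multiset.map_map]
    rfl
  rw [psumEval_perm h1, psumEval_ofFn, ← Finset.sum_filter]
  symm
  -- A coloring fixed by g is constant on cycles, hence the same as a coloring of the set of cycles.
  refine Finset.sum_bij' (i := fun f _ t => f (e t).out)
    (j := fun c _ x => c (e.symm (Quotient.mk _ x))) ?_ ?_ ?_ ?_ ?_
  · simp
  · intro c _
    rw [Finset.mem_filter]
    refine ⟨Finset.mem_univ _, ?_⟩
    ext1 x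
    rw [Function.comp_apply, orbit_mk_apply]
  · intro f hf
    rw [Finset.mem_filter] at hf
    ext1 x
    beta_reduce
    rw [Equiv.apply_symm_apply]
    have hsame : g.SameCycle (Quotient.mk (Equiv.Perm.SameCycle.setoid g) x).out x :=
      orbit_mk_eq_iff.1 (Quotient.out_eq _)
    obtain ⟨k, hk⟩ := hsame.exists_nat_pow_eq
    have hpow : ∀ (k : ℕ) y, f ((g ^ k) y) = f y := by
      intro k
      induction k with
      | zero => simp
      | succ k ih =>
        intro y
        rw [pow_succ, Equiv.Perm.mul_apply, ih]
        exact congrFun hf.2 y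
    rw [← hpow k, hk]
  · intro c _
    ext1 t
    beta_reduce
    rw [Quotient.out_eq, Equiv.symm_apply_apply]
  · intro f hf
    rw [Finset.mem_filter] at hf
    congr 1
    have hfe : f = fun x => (fun o : Orbit g => f o.out) (Quotient.mk _ x) := by
      ext1 x
      have hsame : g.SameCycle (Quotient.mk (Equiv.Perm.SameCycle.setoid g) x).out x :=
        orbit_mk_eq_iff.1 (Quotient.out_eq _)
      obtain ⟨k, hk⟩ := hsame.exists_nat_pow_eq
      have hpow : ∀ (k : ℕ) y, f ((g ^ k) y) = f y := by
        intro k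
        induction k with
        | zero => simp
        | succ k ih =>
          intro y
          rw [pow_succ, Equiv.Perm.mul_apply, ih]
          exact congrFun hf.2 y
      simp only
      conv_lhs => rw [← hk, hpow k]
    ext1 i
    conv_lhs => rw [hfe]
    exact (content_orbit (fun o : Orbit g => f o.out) i).trans (Equiv.sum_comp e _).symm

end Colorings

/-! ### The pairing of the Young symmetrizer with the fermionic matrix elements -/

section Pairing

/-- If σ fixes everything below i, the partial sum reduces to σ i − i ≤ 0; the case σ i < i
contradicts injectivity. -/
theorem perm_eq_one_of_sum_le {N : ℕ} (σ : Equiv.Perm (Fin N))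
    (h : ∀ k ≤ N, ∑ i : Fin N, (if (i : ℕ) < k then ((σ i : ℕ) : ℤ) - (i : ℕ) else 0) ≤ 0) :
    σ = 1 := by
  have key : ∀ k : ℕ, ∀ i : Fin N, (i : ℕ) = k → σ i = i := by
    intro k
    induction k using Nat.strong_induction_on with
    | _ k ih =>
      rintro i rfl
      have h1 := h (i + 1) i.isLt
      rw [Finset.sum_eq_single i] at h1
      · rw [if_pos (Nat.lt_succ_self _)] at h1
        by_contra hne
        have hlt : (σ i : ℕ) < i := by
          have : (σ i : ℕ) ≠ i := fun h => hne (Fin.ext h)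
          omega
        exact hne (σ.injective (ih (σ i) hlt (σ i) rfl))
      · intro j _ hj
        split_ifs with hlt
        · rw [ih j (lt_of_le_of_ne (Nat.lt_succ_iff.1 hlt) fun h => hj (Fin.ext h)) j rfl, sub_self]
        · rfl
      · simp
  exact Equiv.ext fun i => key i i rfl

variable {d : ℕ} {lam : Nat.Partition d} {N : ℕ}

theorem card_lt_eq_sum_fin (f : Fin d → ℕ) {k : ℕ} (hk : k ≤ N) :
    (((univ.filter fun x => f x < k).card : ℕ) : ℤ) =
      ∑ i : Fin N, if (i : ℕ) < k then (((univ.filter fun x => f x = i).card : ℕ) : ℤ) else 0 := by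
  rw [Finset.card_eq_sum_card_fiberwise (t := Finset.range k) (f := f) (by
      intro x hx
      simpa using hx), Nat.cast_sum,
    Fin.sum_univ_eq_sum_range
      (fun i => if i < k then (((univ.filter fun x => f x = i).card : ℕ) : ℤ) else 0) N,
    ← Finset.sum_filter]
  refine Finset.sum_congr ?_ fun i hi => ?_
  · ext i
    simp only [Finset.mem_range, Finset.mem_filter]
    omega
  · rw [Finset.filter_filter]
    congr 2
    ext x
    simp only [Finset.mem_filter, Finset.mem_univ, true_and, and_iff_right_iff_imp]
    rintro rfl
    exact (Finset.mem_filter.1 hi).2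

theorem content_eq (f : Fin d → Fin N) (i : Fin N) :
    content f i = ((univ.filter fun x => (f x : ℕ) = i).card : ℕ) := by
  simp only [content, Fin.ext_iff]

/-- A nonzero vacuum coefficient means that the content is λ_i + σ i − i for a permutation σ.
Dominance bounds its partial sums by those of λ, so σ = 1. -/
theorem content_eq_of_vacuum_ne_zero {f : Fin d → Fin N}
    (hf : IsColumnInjective lam fun x => f x)
    (h : vacuum N ℚ (exponents N lam - content f) ≠ 0) (i : Fin N) :
    content f i = partExt lam i := by
  obtain ⟨σ, hσ⟩ : ∃ σ : Equiv.Perm (Fin N), exponents N lam - content f = rho N ∘ σ := by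
    by_contra hne
    push Not at hne
    exact h (Finset.sum_eq_zero fun σ _ => if_neg (hne σ))
  have hc : ∀ i, content f i = partExt lam i + (((σ i : ℕ) : ℤ) - (i : ℕ)) := by
    intro i
    have := congrFun hσ i
    simp only [Pi.sub_apply, exponents, Function.comp_apply, rho] at this
    linarith
  have h1 : σ = 1 := by
    refine perm_eq_one_of_sum_le σ fun k hk => ?_
    have h2 := Int.ofNat_le.2 (card_lt_le hf k)
    rw [card_lt_eq_sum_fin _ hk, card_lt_eq_sum_fin _ hk, ← sub_nonpos,
      ← Finset.sum_sub_distrib] at h2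
    refine le_of_eq_of_le (Finset.sum_congr rfl fun i _ => ?_) h2
    split_ifs
    · rw [← content_eq, hc, card_rowIdx_eq]
      ring
    · simp
  rw [hc, h1]
  simp

variable (lam) in
/-- The coloring of the boxes of a tableau by their rows. -/
def rowColor (hN : d ≤ N) (x : Fin d) : Fin N :=
  ⟨rowIdx lam x, (rowIdx_lt_len lam x).trans_le ((len_le lam).trans hN)⟩

theorem vacuum_rowColor (hN : d ≤ N) :
    vacuum N ℚ (exponents N lam - content (rowColor lam hN)) = 1 := by
  rw [← vacuum_rho (N := N) (R := ℚ)]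
  congr 1
  ext i
  rw [Pi.sub_apply, content_eq, exponents]
  have h : (univ.filter fun x => (rowColor lam hN x : ℕ) = i).card = partExt lam i :=
    card_rowIdx_eq (lam := lam) i
  rw [h]
  ring

/-- The signed number of the column permutations with the same effect on a coloring as a given
permutation. -/
def signedCount (lam : Nat.Partition d) (f : Fin d → Fin N) (p : Equiv.Perm (Fin d)) : ℚ :=
  ∑ q ∈ columnGroup lam, if f ∘ q = f ∘ p then ((Equiv.Perm.sign q : ℤ) : ℚ) else 0

theorem sum_columnGroup_mul_left {q : Equiv.Perm (Fin d)} (hq : q ∈ columnGroup lam)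
    (F : Equiv.Perm (Fin d) → ℚ) :
    ∑ q' ∈ columnGroup lam, F (q * q') = ∑ q' ∈ columnGroup lam, F q' := by
  refine Finset.sum_bij' (fun q' _ => q * q') (fun q' _ => q⁻¹ * q') ?_ ?_ ?_ ?_ ?_
  · exact fun q' hq' => mul_mem_columnGroup hq hq'
  · exact fun q' hq' => mul_mem_columnGroup (inv_mem_columnGroup hq) hq'
  · intros; simp
  · intros; simp
  · intros; rfl

theorem sum_columnGroup_inv (F : Equiv.Perm (Fin d) → ℚ) :
    ∑ q ∈ columnGroup lam, F q⁻¹ = ∑ q ∈ columnGroup lam, F q := by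
  refine Finset.sum_bij' (fun q' _ => q'⁻¹) (fun q' _ => q'⁻¹) ?_ ?_ ?_ ?_ ?_
  · exact fun q' hq' => inv_mem_columnGroup hq'
  · exact fun q' hq' => inv_mem_columnGroup hq'
  · intros; simp
  · intros; simp
  · intros; rfl

/-- Transposing two equally colored boxes of one column reverses all signs. -/
theorem signedCount_eq_zero {f : Fin d → Fin N} (hf : ¬ IsColumnInjective lam fun x => f x)
    (p : Equiv.Perm (Fin d)) : signedCount lam f p = 0 := by
  obtain ⟨x, y, hxy, hτ, h⟩ := exists_swap_of_not_isColumnInjective hf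
  have hfτ : f ∘ Equiv.swap x y = f := by
    ext1 z
    rw [Function.comp_apply, Equiv.swap_apply_def]
    split_ifs with h1 h2
    · rw [h1]
      exact (Fin.ext h).symm
    · rw [h2]
      exact Fin.ext h
    · rfl
  have h1 : signedCount lam f p = -signedCount lam f p := by
    conv_lhs => rw [signedCount, ← sum_columnGroup_mul_left hτ]
    rw [signedCount, ← Finset.sum_neg_distrib]
    refine Finset.sum_congr rfl fun q _ => ?_
    rw [Equiv.Perm.coe_mul, ← Function.comp_assoc, hfτ, Equiv.Perm.sign_mul,
      Equiv.Perm.sign_swap hxy]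
    split_ifs <;> simp
  linarith

/-- Only column permutations of the row coloring survive: the others either repeat a color in a
column or have a content at which the vacuum vanishes. -/
theorem sum_signedCount (hN : d ≤ N) (p : Equiv.Perm (Fin d)) :
    ∑ f : Fin d → Fin N, signedCount lam f p * vacuum N ℚ (exponents N lam - content f) =
      ∑ q ∈ columnGroup lam, signedCount lam (rowColor lam hN ∘ q) p := by
  classical
  have hinj : Set.InjOn (fun q : Equiv.Perm (Fin d) => rowColor lam hN ∘ q) (columnGroup lam) := by
    intro q hq q' hq' h
    refine Equiv.ext fun x => eq_of_rowIdx_eq_of_colIdx_eq (lam := lam) ?_ ?_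
    · exact congrArg (fun y : Fin N => (y : ℕ)) (congrFun h x)
    · rw [mem_columnGroup.1 hq, mem_columnGroup.1 hq']
  have himage : ∑ q ∈ columnGroup lam, signedCount lam (rowColor lam hN ∘ q) p =
      ∑ q ∈ columnGroup lam, signedCount lam (rowColor lam hN ∘ q) p *
        vacuum N ℚ (exponents N lam - content (rowColor lam hN ∘ q)) := by
    refine Finset.sum_congr rfl fun q _ => ?_
    rw [content_comp, vacuum_rowColor, mul_one]
  rw [himage, ← Finset.sum_image (f := fun f : Fin d → Fin N => signedCount lam f p *
    vacuum N ℚ (exponents N lam - content f)) hinj]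
  symm
  refine Finset.sum_subset (Finset.subset_univ _) fun f _ hf => ?_
  by_contra hne
  obtain ⟨h1, h2⟩ := mul_ne_zero_iff.1 hne
  have hci : IsColumnInjective lam fun x => f x := by
    by_contra h
    exact h1 (signedCount_eq_zero h p)
  have hcont := content_eq_of_vacuum_ne_zero hci h2
  obtain ⟨q, hq, hfq⟩ := exists_columnGroup hci (fun k => by
    rcases le_or_gt k N with hk | hk
    · have h3 := card_lt_eq_sum_fin (N := N) (fun x => (f x : ℕ)) hk
      have h4 := card_lt_eq_sum_fin (N := N) (rowIdx lam) hk
      have h5 : (((univ.filter fun x => (f x : ℕ) < k).card : ℕ) : ℤ) =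
          ((univ.filter fun x => rowIdx lam x < k).card : ℕ) := by
        rw [h3, h4]
        refine Finset.sum_congr rfl fun i _ => ?_
        rw [← content_eq, hcont, card_rowIdx_eq]
      exact_mod_cast h5
    · rw [Finset.filter_true_of_mem fun x _ => (f x).isLt.trans hk,
        Finset.filter_true_of_mem fun x _ =>
          show rowIdx lam x < k from (rowColor lam hN x).isLt.trans hk])
  exact hf (Finset.mem_image.2 ⟨q, hq, funext fun x => Fin.ext (hfq x).symm⟩)

theorem signedCount_rowColor (hN : d ≤ N) {q : Equiv.Perm (Fin d)} (hq : q ∈ columnGroup lam)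
    (p : Equiv.Perm (Fin d)) :
    signedCount lam (rowColor lam hN ∘ q) p⁻¹ = ∑ q' ∈ columnGroup lam,
      if q' * p * q⁻¹ ∈ rowGroup lam then
        ((Equiv.Perm.sign q' : ℤ) : ℚ) * ((Equiv.Perm.sign q⁻¹ : ℤ) : ℚ) else 0 := by
  rw [signedCount, ← sum_columnGroup_mul_left (inv_mem_columnGroup hq)]
  refine Finset.sum_congr rfl fun q' _ => ?_
  have hiff : (rowColor lam hN ∘ q) ∘ (q⁻¹ * q' : Equiv.Perm (Fin d)) =
      (rowColor lam hN ∘ q) ∘ (p⁻¹ : Equiv.Perm (Fin d)) ↔ q' * p * q⁻¹ ∈ rowGroup lam := by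
    rw [mem_rowGroup, funext_iff]
    constructor
    · intro h x
      have := congrArg Fin.val (h (p (q⁻¹ x)))
      simpa [rowColor] using this
    · intro h x
      have := h (q (p⁻¹ x))
      simpa [rowColor] using this
  simp only [hiff, Equiv.Perm.sign_mul]
  split_ifs
  · push_cast
    ring
  · rfl

theorem coeff_youngSymmetrizer (g : Equiv.Perm (Fin d)) :
    (youngSymmetrizer lam).coeff g = ∑ q ∈ columnGroup lam,
      if g * q⁻¹ ∈ rowGroup lam then ((Equiv.Perm.sign q : ℤ) : ℚ) else 0 := by
  classical
  have h := sum_coeff_youngSymmetrizer (lam := lam) fun g' => if g' = g then 1 else 0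
  simp only [mul_ite, mul_one, mul_zero, Finset.sum_ite_eq', Finset.mem_univ, if_true] at h
  rw [h, Finset.sum_comm]
  refine Finset.sum_congr rfl fun q _ => ?_
  rw [← Finset.sum_ite_eq' (rowGroup lam) (g * q⁻¹) fun _ => ((Equiv.Perm.sign q : ℤ) : ℚ)]
  refine Finset.sum_congr rfl fun p _ => ?_
  simp only [eq_mul_inv_iff_mul_eq]

/-- The inner sum is the Frobenius matrix element at g. Both its pairing with c and the coefficient
of c² at 1 reduce to the same signed count of relations between row and column permutations. -/
theorem sum_coeff_youngSymmetrizer_mul_vacuum (hN : d ≤ N) {n : ℚ}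
    (h : youngSymmetrizer lam * youngSymmetrizer lam = n • youngSymmetrizer lam) :
    ∑ g, (youngSymmetrizer lam).coeff g * ∑ f : Fin d → Fin N,
      (if f ∘ g = f then vacuum N ℚ (exponents N lam - content f) else 0) = n := by
  have hn : n = (youngSymmetrizer lam * youngSymmetrizer lam).coeff 1 := by
    rw [h]
    change n = n * (youngSymmetrizer lam).coeff 1
    rw [coeff_youngSymmetrizer_one, mul_one]
  rw [hn, coeff_mul_eq_sum, sum_coeff_youngSymmetrizer, sum_coeff_youngSymmetrizer]
  refine Finset.sum_congr rfl fun p hp => ?_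
  have h1 : ∑ q ∈ columnGroup lam, ((Equiv.Perm.sign q : ℤ) : ℚ) * ∑ f : Fin d → Fin N,
      (if f ∘ (p * q : Equiv.Perm (Fin d)) = f then vacuum N ℚ (exponents N lam - content f)
        else 0) =
      ∑ f : Fin d → Fin N,
        signedCount lam f p⁻¹ * vacuum N ℚ (exponents N lam - content f) := by
    -- Replacing f by f ∘ p, of the same content, turns invariance under p q into the condition
    -- counted by `signedCount` at p⁻¹.
    simp only [signedCount, Finset.mul_sum, Finset.sum_mul]
    rw [Finset.sum_comm]
    refine Finset.sum_bij' (fun f _ => f ∘ p) (fun f _ => f ∘ (p⁻¹ : Equiv.Perm (Fin d)))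
      (by simp) (by simp) ?_ ?_ ?_
    · intro f _
      ext1 x
      simp
    · intro f _
      ext1 x
      simp
    · intro f _
      refine Finset.sum_congr rfl fun q _ => ?_
      have hiff : f ∘ (p * q : Equiv.Perm (Fin d)) = f ↔
          (f ∘ p) ∘ q = (f ∘ p) ∘ (p⁻¹ : Equiv.Perm (Fin d)) := by
        have : (f ∘ p) ∘ (p⁻¹ : Equiv.Perm (Fin d)) = f := by
          ext1 x
          simp
        rw [this]
        rfl
      simp only [hiff, content_comp]
      split_ifs <;> simp
  rw [h1, sum_signedCount hN, ← sum_columnGroup_inv]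
  refine Finset.sum_congr rfl fun q hq => ?_
  rw [signedCount_rowColor hN (inv_mem_columnGroup hq), mul_one, coeff_youngSymmetrizer,
    Finset.mul_sum]
  refine Finset.sum_congr rfl fun q' _ => ?_
  have hiff : (p * q)⁻¹ * q'⁻¹ ∈ rowGroup lam ↔ q' * p * q⁻¹⁻¹ ∈ rowGroup lam := by
    have h2 : (p * q)⁻¹ * q'⁻¹ = (q' * p * q⁻¹⁻¹)⁻¹ := by group
    rw [h2]
    exact ⟨fun h => by simpa using inv_mem_rowGroup h, inv_mem_rowGroup⟩
  simp only [hiff]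
  split_ifs
  · rw [inv_inv, mul_comm]
  · rw [mul_zero]

end Pairing

/-! ### Norms of bosonic states -/

section Norm

variable {N : ℕ} {R : Type*} [CommRing R]

theorem annihilate_smul (L : List ℕ) (c : R) (f : (Fin N → ℤ) → R) :
    annihilate L (c • f) = c • annihilate L f := by
  induction L with
  | nil => rfl
  | cons p L ih =>
    change shiftOp _ _ (annihilate L _) = _ • shiftOp _ _ (annihilate L _)
    rw [ih, map_smul]

theorem shiftOp_annihilate (k : ℕ) (L : List ℕ) (f : (Fin N → ℤ) → R) :
    shiftOp (k : ℤ) 1 (annihilate L f) = annihilate L (shiftOp (k : ℤ) 1 f) := by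
  induction L with
  | nil => rfl
  | cons p L ih =>
    change shiftOp _ _ (shiftOp _ _ (annihilate L _)) = shiftOp _ _ (annihilate L _)
    rw [← ih, shiftOp_comm_of_nonneg (Int.natCast_nonneg _) (Int.natCast_nonneg _)]

theorem create_cons (p : ℕ) (L : List ℕ) :
    create N R (p :: L) = shiftOp (-(p : ℤ)) 1 (create N R L) := rfl

variable [IsDomain R] [CharZero R]

/-- The Heisenberg relation: [α_k, α_{−p}] is the cocycle, a sum of k ones if p = k and zero
otherwise, and α_k kills the vacuum. So α_k acts as a derivation removing a part k. -/
theorem shiftOp_create {k : ℕ} (hk : 0 < k) {L : List ℕ} (hL : L.sum ≤ N) :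
    shiftOp (k : ℤ) 1 (create N R L) = ((k * L.count k : ℕ) : R) • create N R (L.erase k) := by
  induction L with
  | nil =>
    rw [((isFermionic_create (N := N) (R := R) []).shiftOp (k : ℤ) 1).eq_zero (by simp; omega)]
    simp
  | cons p L ih =>
    rw [List.sum_cons] at hL
    have hw : (fun j : ℤ => (1 : ℤ → R) j * (1 : ℤ → R) (j + k) -
        (1 : ℤ → R) j * (1 : ℤ → R) (j + -(p : ℤ))) = 0 := by
      ext j
      simp
    have hzero : shiftOp ((k : ℤ) + -(p : ℤ)) 0 (create N R L) = 0 := by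
      ext v
      simp [shiftOp_apply]
    rw [create_cons, (isFermionic_create L).shiftOp_comm (Int.natCast_nonneg k)
      (by omega), ih (by omega), map_smul, hw, hzero, add_zero, ← create_cons]
    by_cases hkp : k = p
    · subst hkp
      rw [if_pos (by ring), List.erase_cons_head, List.count_cons_self]
      -- If k does not occur in L, the factor L.count k is 0, so the two states need not agree.
      have h1 : ((k * L.count k : ℕ) : R) • create N R (k :: L.erase k) =
          ((k * L.count k : ℕ) : R) • create N R L := by
        by_cases hmem : k ∈ L
        · rw [create_perm (List.perm_cons_erase hmem)]
        · rw [List.count_eq_zero_of_not_mem hmem]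
          simp
      rw [h1, ← add_smul]
      congr 1
      simp
      ring
    · rw [if_neg (by omega), zero_smul, add_zero, List.count_cons_of_ne (Ne.symm hkp),
        List.erase_cons_tail (by simpa using Ne.symm hkp)]

/-- The order of the centralizer of a permutation of cycle type `M`. -/
def centralizerCard (M : Multiset ℕ) : ℕ := M.prod * ∏ i ∈ M.toFinset, (M.count i).factorial

theorem centralizerCard_cons (k : ℕ) (M : Multiset ℕ) :
    centralizerCard (k ::ₘ M) = k * (M.count k + 1) * centralizerCard M := by
  have hext : ∏ i ∈ M.toFinset, (M.count i).factorial =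
      ∏ i ∈ insert k M.toFinset, (M.count i).factorial := by
    refine Finset.prod_subset (Finset.subset_insert _ _) fun i _ hi => ?_
    rw [Multiset.count_eq_zero_of_notMem fun h => hi (Multiset.mem_toFinset.2 h),
      Nat.factorial_zero]
  rw [centralizerCard, centralizerCard, hext, Multiset.toFinset_cons, Multiset.prod_cons,
    ← Finset.mul_prod_erase _ _ (Finset.mem_insert_self k _),
    ← Finset.mul_prod_erase (insert k M.toFinset) (fun i => (M.count i).factorial)
      (Finset.mem_insert_self k _), Multiset.count_cons_self, Nat.factorial_succ]
  have hrest : ∏ i ∈ (insert k M.toFinset).erase k, ((k ::ₘ M).count i).factorial =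
      ∏ i ∈ (insert k M.toFinset).erase k, (M.count i).factorial :=
    Finset.prod_congr rfl fun i hi => by
      rw [Multiset.count_cons_of_ne (Finset.ne_of_mem_erase hi)]
  rw [hrest]
  ring

/-- Each annihilation operator contributes its part times the current multiplicity, which builds up
the centralizer order. -/
theorem annihilate_create {L : List ℕ} (hpos : ∀ p ∈ L, 0 < p) (hL : L.sum ≤ N) :
    annihilate L (create N R L) (rho N) = (centralizerCard L : R) := by
  induction L with
  | nil => simp [annihilate, create, vacuum_rho, centralizerCard]
  | cons k L ih =>
    have hk := hpos k List.mem_cons_self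
    change shiftOp (k : ℤ) 1 (annihilate L _) _ = _
    rw [shiftOp_annihilate, shiftOp_create hk hL, List.erase_cons_head, annihilate_smul,
      Pi.smul_apply, ih (fun p hp => hpos p (List.mem_cons_of_mem _ hp))
        (by rw [List.sum_cons] at hL; omega), ← Multiset.cons_coe, centralizerCard_cons,
      List.count_cons_self, Multiset.coe_count, smul_eq_mul]
    push_cast
    ring

theorem sum_create_sq {d : ℕ} (hN : d ≤ N) {L : List ℕ} (hpos : ∀ p ∈ L, 0 < p)
    (hL : L.sum = d) :
    ∑ lam : Nat.Partition d, create N R L (exponents N lam) * create N R L (exponents N lam) =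
      (centralizerCard L : R) := by
  rw [← annihilate_create hpos (hL.le.trans hN),
    (isFermionic_create L).annihilate_rho hN hL]

end Norm

/-! ### Centralizers and conjugacy classes of the symmetric group -/

section Classes

variable {d : ℕ}

/-- The j fixed points add j parts equal to 1, whose only effect is the factor j!. -/
theorem centralizerCard_partition (g : Equiv.Perm (Fin d)) :
    centralizerCard g.partition.parts = Nat.card (Subgroup.centralizer {g}) := by
  have h : ∀ (M : Multiset ℕ), 1 ∉ M → ∀ j, centralizerCard (M + Multiset.replicate j 1) =
      j.factorial * centralizerCard M := by
    intro M hM j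
    induction j with
    | zero => simp
    | succ j ih =>
      rw [Multiset.replicate_succ, Multiset.add_cons, centralizerCard_cons, ih,
        Multiset.count_add, Multiset.count_eq_zero_of_notMem hM, Multiset.count_replicate_self,
        Nat.factorial_succ]
      ring
  rw [Equiv.Perm.nat_card_centralizer, Equiv.Perm.parts_partition,
    h _ fun h1 => lt_irrefl _ (Equiv.Perm.one_lt_of_mem_cycleType h1),
    Equiv.Perm.sum_cycleType, centralizerCard, mul_assoc]

theorem card_conjClasses_perm :
    Nat.card (ConjClasses (Equiv.Perm (Fin d))) = Fintype.card (Nat.Partition d) := by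
  let φ : Equiv.Perm (Fin d) → Nat.Partition d := fun g =>
    ⟨g.partition.parts, fun h => g.partition.parts_pos h, by
      rw [g.partition.parts_sum, Fintype.card_fin]⟩
  have hφ : ∀ g g', IsConj g g' ↔ φ g = φ g' := fun g g' => by
    rw [Equiv.Perm.partition_eq_of_isConj, Nat.Partition.ext_iff, Nat.Partition.ext_iff]
  rw [← Nat.card_eq_fintype_card]
  refine Nat.card_eq_of_bijective
    (Quotient.lift (s := IsConj.setoid _) φ fun g g' h => (hφ g g').1 h) ⟨?_, ?_⟩
  · intro x y
    induction x using Quotient.inductionOn with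
    | h g =>
      induction y using Quotient.inductionOn with
      | h g' => exact fun h => Quotient.sound ((hφ g g').2 h)
  · intro mu
    obtain ⟨g, hg⟩ := exists_perm_of_partition mu
    exact ⟨Quotient.mk _ g, Nat.Partition.ext hg⟩

/-- Both sides count commuting pairs of permutations; conjugacy classes correspond to partitions. -/
theorem sum_card_centralizer :
    ∑ g : Equiv.Perm (Fin d), Nat.card (Subgroup.centralizer {g}) =
      Fintype.card (Nat.Partition d) * d.factorial := by
  have h := card_comm_eq_card_conjClasses_mul_card (Equiv.Perm (Fin d))
  rw [card_conjClasses_perm, Nat.card_perm, Nat.card_fin] at h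
  rw [← h, ← Nat.card_sigma]
  refine Nat.card_congr
    { toFun := fun x => ⟨(x.1, x.2), (Subgroup.mem_centralizer_singleton_iff.1 x.2.2).symm⟩
      invFun := fun p => ⟨p.1.1, p.1.2, Subgroup.mem_centralizer_singleton_iff.2 p.2.eq.symm⟩
      left_inv := fun _ => rfl
      right_inv := fun _ => rfl }

end Classes

/-! ### The characters as matrix elements of bosonic operators -/

section CharacterFormula

variable {d N : ℕ}

/-- The fermionic matrix element that turns out to be the character value. -/
def matrixElement (N : ℕ) (lam : Nat.Partition d) (g : Equiv.Perm (Fin d)) : ℚ :=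
  create N ℚ g.partition.parts.toList (exponents N lam)

theorem matrixElement_isConj (lam : Nat.Partition d) (g g' : Equiv.Perm (Fin d))
    (h : IsConj g g') : matrixElement N lam g = matrixElement N lam g' := by
  rw [matrixElement, matrixElement, Equiv.Perm.partition_eq_of_isConj.1 h]

/-- The matrix element is a class function whose pairing with c is n, which cancels the n⁻¹ of the
character formula. -/
theorem sum_spechtCharacter_mul_matrixElement (hN : d ≤ N) (lam : Nat.Partition d) :
    ∑ g, spechtCharacter lam g * matrixElement N lam g = d.factorial := by
  obtain ⟨n, hn, h⟩ := exists_youngSymmetrizer_sq lam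
  rw [sum_spechtCharacter_mul hn h (matrixElement_isConj lam)]
  have h1 : ∀ g, matrixElement N lam g = ∑ f : Fin d → Fin N,
      if f ∘ g = f then vacuum N ℚ (exponents N lam - content f) else 0 := fun g => by
    rw [matrixElement, create_apply,
      psumEval_partition (Multiset.coe_toList _) fun v => vacuum N ℚ (exponents N lam - v)]
  simp only [h1]
  rw [sum_coeff_youngSymmetrizer_mul_vacuum hN h, mul_comm, ← mul_assoc, mul_inv_cancel₀ hn,
    one_mul]

/-- For fixed g the sum over λ is the norm of a bosonic state, the order of the centralizer of g. -/
theorem sum_matrixElement_sq (hN : d ≤ N) :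
    ∑ lam : Nat.Partition d, ∑ g, matrixElement N lam g * matrixElement N lam g =
      Fintype.card (Nat.Partition d) * d.factorial := by
  rw [Finset.sum_comm, ← Nat.cast_mul, ← sum_card_centralizer, Nat.cast_sum]
  refine Finset.sum_congr rfl fun g _ => ?_
  have h := sum_create_sq (R := ℚ) hN (L := g.partition.parts.toList)
    (fun p hp => g.partition.parts_pos (Multiset.mem_toList.1 hp))
    (by rw [Multiset.sum_toList, g.partition.parts_sum, Fintype.card_fin])
  rw [Multiset.coe_toList, centralizerCard_partition] at h
  exact h

/-- Norms of M are known only after summation over λ, which suffices: the summed squared distance is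
d! − 2 d! + d! per partition, and its terms are nonnegative rationals. -/
theorem spechtCharacter_eq_matrixElement (hN : d ≤ N) (lam : Nat.Partition d)
    (g : Equiv.Perm (Fin d)) : spechtCharacter lam g = matrixElement N lam g := by
  have h : ∑ lam : Nat.Partition d, ∑ g : Equiv.Perm (Fin d),
      (spechtCharacter lam g - matrixElement N lam g) ^ 2 = 0 := by
    have h1 : ∀ lam : Nat.Partition d, ∑ g : Equiv.Perm (Fin d),
        (spechtCharacter lam g - matrixElement N lam g) ^ 2 =
        ∑ g, matrixElement N lam g * matrixElement N lam g - d.factorial := by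
      intro lam
      have h2 : ∀ g : Equiv.Perm (Fin d), (spechtCharacter lam g - matrixElement N lam g) ^ 2 =
          spechtCharacter lam g * spechtCharacter lam g -
            2 * (spechtCharacter lam g * matrixElement N lam g) +
            matrixElement N lam g * matrixElement N lam g := fun g => by ring
      simp only [h2]
      rw [Finset.sum_add_distrib, Finset.sum_sub_distrib, ← Finset.mul_sum,
        sum_spechtCharacter_sq, sum_spechtCharacter_mul_matrixElement hN]
      ring
    simp only [h1]
    rw [Finset.sum_sub_distrib, sum_matrixElement_sq hN, Finset.sum_const, Finset.card_univ,
      nsmul_eq_mul, sub_self]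
  have h1 := (Finset.sum_eq_zero_iff_of_nonneg fun lam _ =>
    Finset.sum_nonneg fun g _ => sq_nonneg _).1 h lam (Finset.mem_univ _)
  have h2 := (Finset.sum_eq_zero_iff_of_nonneg fun g _ => sq_nonneg _).1 h1 g (Finset.mem_univ _)
  exact sub_eq_zero.1 ((pow_eq_zero_iff two_ne_zero).1 h2)

/-- The characters of the symmetric group are matrix elements of bosonic operators. -/
theorem chi_eq_create (hN : d ≤ N) (lam mu : Nat.Partition d) :
    chi lam mu = ((create N ℤ (rows mu) (exponents N lam) : ℤ) : ℚ) := by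
  obtain ⟨g, hg⟩ := exists_perm_of_partition mu
  have hperm : g.partition.parts.toList.Perm (rows mu) := by
    rw [← Multiset.coe_eq_coe, Multiset.coe_toList, hg, rows, Multiset.sort_eq]
  rw [chi_eq lam mu g hg, spechtCharacter_eq_matrixElement hN, matrixElement, create_perm hperm]
  exact (create_map (Int.castRingHom ℚ) _ _).symm

end CharacterFormula

end

end HurwitzCC

/-- The sum over commutation patterns is a formal power series `H` in `z_1, …, z_s` (an equality in
the field of fractions), and the Hurwitz number is the normalized coefficient of
`z_1^{r+1} ⋯ z_s^{r+1}` in `H`. -/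
theorem theorem4p6 (r s d : ℕ) (mu nu : Nat.Partition d) :
    ∃ H : MvPowerSeries (Fin s) ℚ,
      algebraMap (MvPowerSeries (Fin s) ℚ) (FractionRing (MvPowerSeries (Fin s) ℚ)) H =
        ∑ P ∈ HurwitzCC.commutationPatterns s (HurwitzCC.part mu) (HurwitzCC.part nu),
          ((HurwitzCC.finalOperators (HurwitzCC.part mu) (HurwitzCC.part nu) P).map
              HurwitzCC.finalFactor).prod *
            (P.map fun c => algebraMap (MvPowerSeries (Fin s) ℚ)
              (FractionRing (MvPowerSeries (Fin s) ℚ))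
              (HurwitzCC.commutatorFactor (HurwitzCC.part mu) (HurwitzCC.part nu) c)).prod ∧
      HurwitzCC.hurwitzNumber r s mu nu =
        1 / ((∏ i, (HurwitzCC.part mu i : ℚ)) * ∏ j, (HurwitzCC.part nu j : ℚ)) *
          MvPowerSeries.coeff (Finsupp.equivFunOnFinite.symm fun _ : Fin s => r + 1) H := by
  -- N = 2d bounds the total absolute energy of the initial word, d from μ and d from ν.
  have hN : d ≤ 2 * d := by omega
  refine ⟨HurwitzCC.hurwitzSeries (2 * d) s mu nu, ?_, ?_⟩
  · rw [HurwitzCC.sum_commutationPatterns (N := 2 * d) (HurwitzCC.isBalanced_initialWord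
      (by rw [HurwitzCC.sum_part, HurwitzCC.sum_part])
      (by rw [HurwitzCC.sum_part, HurwitzCC.sum_part]; omega)),
      HurwitzCC.wordState_initialWord hN]
  · rw [HurwitzCC.coeff_hurwitzSeries hN, HurwitzCC.hurwitzNumber]
    simp only [HurwitzCC.chi_eq_create hN]
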